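/- Let $\delta\in\mathbb R\setminus\{0\}$, let $k>\frac12+5$ be an integer and let $T>0$. Put $$\|f\|_{\Sigma^k}=\|f\|_{H^k(\mathbb R)}+\big\||x|^kf\big\|_{L^2(\mathbb R)} ,$$ and let $\psi(t,x)$ be a (classical) solution on $[0,T]\times\mathbb R$ of the derivative nonlinear Schrödinger equation $$ i\partial_t\psi+\partial_x^2\psi-2i\delta\,\partial_x(|\psi|^2\psi)=0 $$ with $\sup_{t\in[0,T]}\|\psi(t,\cdot)\|_{\Sigma^k}<\infty$. For $f\in L^2(\mathbb R)$ write $E(f)(x)=\exp\!\big(-i\delta\int_{-\infty}^x|f(y)|^2\,dy\big)$. Consider the following method with time step $\tau>0$, which is based on the coupled system $$\partial_tu=i\partial_x^2u-2\delta u^2\bar v,\qquad \partial_tv=i\partial_x^2v+2\delta v^2\bar u $$ for the gauge-transformed unknowns $u=E^2\psi$, $v=E\,\partial_x(E\psi)$, $E=E(\psi(t,\cdot))$. 1. Let $\psi_0=\psi(0,\cdot)$, $E_0=E(\psi_0)$, $u^0=E_0^2\psi_0$ and $v^0=E_0\,\partial_x(E_0\psi_0)$. 2. For $n\ge 0$ perform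 one Strang splitting step, with the exactly solvable nonlinear flow: $$u^{n+\frac12}=e^{i\frac\tau2\partial_x^2}u^n,\qquad v^{n+\frac12}=e^{i\frac\tau2\partial_x^2}v^n,$$ $$u^{n+1}=e^{i\frac\tau2\partial_x^2}\Big(e^{-2\delta\tau u^{n+\frac12}\overline{v^{n+\frac12}}}\,u^{n+\frac12}\Big),\qquad v^{n+1}=e^{i\frac\tau2\partial_x^2}\Big(e^{2\delta\tau\overline{u^{n+\frac12}}v^{n+\frac12}}\,v^{n+\frac12}\Big).$$ 3. Set $\psi^n=E(u^n)^{-2}u^n$. Then there exist constants $C>0$ and $\tau_0>0$, depending only on $\delta$, $T$, $k$ and (an upper bound for) $\sup_{t\in[0,T]}\|\psi(t,\cdot)\|_{\Sigma^k}$, such that for all $0<\tau<\tau_0$ and all integers $n\ge0$ with $t_n=n\tau\le T$ the functions to which $e^{i\frac\tau2\partial_x^2}$ is applied in the above method (starting from $u^n,v^n$) belong to $L^2(\mathbb R)$, so that the method is well defined, and $$\|\psi^n-\psi(t_n,\cdot)\|_{L^2(\mathbb R)}\le C\tau^2 .$$ -/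

import Mathlib

open MeasureTheory Set
open scoped FourierTransform ENNReal NNReal ComplexConjugate

noncomputable section

namespace DNLS

/-- The class in `L²(ℝ; ℂ)` of a square-integrable function (and `0` for any other function). -/
def toL2 (f : ℝ → ℂ) : Lp ℂ 2 (volume : Measure ℝ) :=
  open Classical in if h : MemLp f 2 volume then h.toLp f else 0

/-! ### The spaces `Σᵏ` -/

/-- The `Hᵏ(ℝ)`-norm, in `[0, ∞]`, of an element of `L²(ℝ)`:
`(∫ (1 + (2πξ)²)ᵏ |f̂(ξ)|² dξ)^(1/2)`. With the normalisation `f̂(ξ) = ∫ e^{-2πixξ} f(x) dx` of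
the Fourier transform, `∂ₓ` corresponds to multiplication by `2πiξ`. -/
def sobolevNorm (k : ℕ) (f : Lp ℂ 2 (volume : Measure ℝ)) : ℝ≥0∞ :=
  (∫⁻ ξ : ℝ, ENNReal.ofReal ((1 + (2 * Real.pi * ξ) ^ 2) ^ k) *
    ‖(𝓕 f : Lp ℂ 2 (volume : Measure ℝ)) ξ‖ₑ ^ 2) ^ (1 / 2 : ℝ)

/-- `‖f‖_{Σᵏ} = ‖f‖_{Hᵏ} + ‖ |x|ᵏ f ‖_{L²}`, in `[0, ∞]`; it is `∞` if `f ∉ L²`. -/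
def sigmaNorm (k : ℕ) (f : ℝ → ℂ) : ℝ≥0∞ :=
  open Classical in
  if MemLp f 2 volume then
    sobolevNorm k (toL2 f) + eLpNorm (fun x : ℝ => (|x| ^ k : ℝ) • f x) 2 volume
  else ⊤

/-! ### The derivative nonlinear Schrödinger equation -/

/-- `ψ` solves `i ∂ₜψ + ∂ₓ²ψ - 2iδ ∂ₓ(|ψ|²ψ) = 0` on `[0, T] × ℝ`. -/
structure IsSolution (δ T : ℝ) (ψ : ℝ → ℝ → ℂ) : Prop where
  contDiff_space : ∀ t ∈ Icc 0 T, ContDiff ℝ 2 (ψ t)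
  differentiable_time : ∀ t ∈ Icc 0 T, ∀ x : ℝ,
    DifferentiableWithinAt ℝ (fun s => ψ s x) (Icc 0 T) t
  equation : ∀ t ∈ Icc 0 T, ∀ x : ℝ,
    Complex.I * derivWithin (fun s => ψ s x) (Icc 0 T) t + iteratedDeriv 2 (ψ t) x
      - 2 * Complex.I * δ * deriv (fun y : ℝ => ((‖ψ t y‖ ^ 2 : ℝ) : ℂ) * ψ t y) x = 0

/-! ### The gauge transform -/

/-- The gauge factor `E(f)(x) = exp(-iδ ∫_{-∞}^x |f(y)|² dy)`. -/
def gauge (δ : ℝ) (f : ℝ → ℂ) (x : ℝ) : ℂ :=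
  Complex.exp (-(Complex.I * δ * ((∫ y in Iic x, ‖f y‖ ^ 2 : ℝ) : ℂ)))

/-- The transformed initial data `(u₀, v₀) = (E²ψ₀, E ∂ₓ(Eψ₀))` with `E = E(ψ₀)`. -/
def transform (δ : ℝ) (ψ₀ : ℝ → ℂ) : (ℝ → ℂ) × (ℝ → ℂ) :=
  (fun x => gauge δ ψ₀ x ^ 2 * ψ₀ x,
   fun x => gauge δ ψ₀ x * deriv (fun y => gauge δ ψ₀ y * ψ₀ y) x)

/-- The reconstruction `E(u)⁻² u`. -/
def reconstruct (δ : ℝ) (u : ℝ → ℂ) (x : ℝ) : ℂ :=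
  (gauge δ u x ^ 2)⁻¹ * u x

/-! ### The splitting scheme -/

/-- The symbol of `e^{it∂ₓ²}`. -/
def freeSymbol (t ξ : ℝ) : ℂ :=
  Complex.exp (-(Complex.I * ((t * (2 * Real.pi * ξ) ^ 2 : ℝ) : ℂ)))

/-- Multiplication by the symbol preserves `L²`, so the default value of `toL2` is not used in
`freeFlow` below. -/
theorem memLp_freeSymbol_mul (t : ℝ) (g : Lp ℂ 2 (volume : Measure ℝ)) :
    MemLp (fun ξ : ℝ => freeSymbol t ξ * g ξ) 2 volume := by
  refine (Lp.memLp g).of_le ?_ (Filter.Eventually.of_forall fun ξ => ?_)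
  · refine Continuous.aestronglyMeasurable ?_ |>.mul (Lp.aestronglyMeasurable g)
    unfold freeSymbol
    fun_prop
  · have h : ‖freeSymbol t ξ‖ = 1 := by
      rw [freeSymbol, Complex.norm_exp]
      simp only [Complex.neg_re, Complex.I_mul_re, Complex.ofReal_im]
      simp
    rw [norm_mul, h, one_mul]

/-- The free Schrödinger flow `e^{it∂ₓ²}` on `L²(ℝ)`. -/
def freeFlow (t : ℝ) (f : ℝ → ℂ) : ℝ → ℂ :=
  (𝓕⁻ (toL2 fun ξ => freeSymbol t ξ * (𝓕 (toL2 f) : Lp ℂ 2 (volume : Measure ℝ)) ξ) :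
    Lp ℂ 2 (volume : Measure ℝ))

/-- The free Schrödinger flow on both components. -/
def linearFlow (t : ℝ) (w : (ℝ → ℂ) × (ℝ → ℂ)) : (ℝ → ℂ) × (ℝ → ℂ) :=
  (freeFlow t w.1, freeFlow t w.2)

/-- The exact flow of `∂ₜu = -2δ u² v̄`, `∂ₜv = 2δ v² ū`. -/
def nonlinearFlow (δ t : ℝ) (w : (ℝ → ℂ) × (ℝ → ℂ)) : (ℝ → ℂ) × (ℝ → ℂ) :=
  (fun x => Complex.exp (-(2 * δ * t * (w.1 x * conj (w.2 x)))) * w.1 x,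
   fun x => Complex.exp (2 * δ * t * (conj (w.1 x) * w.2 x)) * w.2 x)

/-- One step of Strang splitting. -/
def strangStep (δ τ : ℝ) (w : (ℝ → ℂ) × (ℝ → ℂ)) : (ℝ → ℂ) × (ℝ → ℂ) :=
  linearFlow (τ / 2) (nonlinearFlow δ τ (linearFlow (τ / 2) w))

/-- The iterates `(uⁿ, vⁿ)` of the scheme with initial datum `ψ₀`. -/
def iterate (δ τ : ℝ) (ψ₀ : ℝ → ℂ) : ℕ → (ℝ → ℂ) × (ℝ → ℂ)
  | 0 => transform δ ψ₀
  | n + 1 => strangStep δ τ (iterate δ τ ψ₀ n)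

/-- The numerical approximation `ψⁿ` at time `nτ`. -/
def approx (δ τ : ℝ) (ψ₀ : ℝ → ℂ) (n : ℕ) : ℝ → ℂ :=
  reconstruct δ (iterate δ τ ψ₀ n).1

/-- Both components are square integrable. -/
def PairMemL2 (w : (ℝ → ℂ) × (ℝ → ℂ)) : Prop :=
  MemLp w.1 2 (volume : Measure ℝ) ∧ MemLp w.2 2 (volume : Measure ℝ)

end DNLS

end

/-!
The pair `(u, v)` solves a Schrödinger system whose nonlinearity contains no derivative, and the
nonlinear flow of the splitting multiplies `u` and `v` by exponentials of `u v̄`. The proof has four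
parts.

**Local error.** On the Fourier side, `A(s) = e^{is(2πξ)²} û(t₀ + s)` removes the linear evolution,
and `A' = -2δ ∫∫ e^{isφ} A B̄ A` with the phase `φ = (2π)²(ξ² - ξ₁² + ξ₂² - ξ₃²)`. A Strang step is
the exact flow of the same equation with the phase frozen at the middle `m = τ/2` of the step
(`frozenTwist`). Since `φ` is bounded by two derivatives, the two flows differ by `O(τ²)` inside the
step. Expanding `e^{isφ}` to second order about `m`, the first-order term is `s - m` times a fixed
function, up to `O(τ²)`. It integrates to zero over the step, so the error at its end is `O(τ³)` in
`L²` when `u` and `v` are in `H⁴` (`Curve.local_error`).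

**Stability.** The nonlinear flow is Lipschitz in `L²` with constant `1 + O(τ)` as long as its
arguments are bounded. It commutes with translations, so by difference quotients it also increases
the `H¹`-norm by a factor `1 + O(τ)` at most (`L2Bound.dsym_mul_fhat_nlFlow`). The `L^∞`-bound needed
for this is propagated by interpolation: an error of size `O(τ²)` in `L²` and `O(1)` in `H¹` is
`O(√τ)` in `L^∞` (`Curve.ae_norm_freeFlow_le`). Induction gives second-order convergence
(`exists_near_iterate`).

**Regularity of the exact solution.** A bound in `Σᵏ` with `k ≥ 6` gives `ψ ∈ H⁶` and, since `ψ` is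
Lipschitz and `|x|⁶ψ ∈ L²`, the decay `|ψ| ≤ C (1 + x²)⁻²`. Taylor expansion transfers it to
`∂ₓψ, ∂ₓ²ψ = O((1 + x²)⁻¹)` (`exists_regular`). The gauge factor satisfies
`∂ₓE² = -2iδ|ψ|²E²`, so multiplication by it costs one derivative only, and `u, v ∈ H⁴`
(`exists_sob_gauge_mul`). The decay permits differentiation under all integrals. Together with the
conservation law for `|ψ|²` this yields the equation for `u` (`IsSolution.flow`), and, as
`v = ∂ₓu + iδ|u|²u`, the one for `v` (`C2Decays.fourier_rhs_second`).

**Reconstruction.** `E(u)` depends on `u ∈ L²` in a locally Lipschitz way, uniformly in `x`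
(`L2Bound.reconstruct_sub`), and `|u| = |ψ|` gives `E(u)⁻²u = ψ`.
-/

namespace DNLS

/-! ### Quantitative `L²` bounds -/

/-- `f` is (a.e. strongly) measurable with `‖f‖_{L²} ≤ c`, where `0 ≤ c`. Keeping the bound as a
real number lets all constants be handled by real arithmetic. -/
structure L2Bound (f : ℝ → ℂ) (c : ℝ) : Prop where
  nonneg : 0 ≤ c
  meas : AEStronglyMeasurable f volume
  le : eLpNorm f 2 volume ≤ ENNReal.ofReal c

namespace L2Bound

variable {f g : ℝ → ℂ} {c d : ℝ}

theorem memLp (h : L2Bound f c) : MemLp f 2 volume :=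
  ⟨h.meas, h.le.trans_lt ENNReal.ofReal_lt_top⟩

theorem mono (h : L2Bound f c) (hcd : c ≤ d) : L2Bound f d :=
  ⟨h.nonneg.trans hcd, h.meas, h.le.trans (ENNReal.ofReal_le_ofReal hcd)⟩

theorem congr_ae (h : L2Bound f c) (hfg : f =ᵐ[volume] g) : L2Bound g c :=
  ⟨h.nonneg, h.meas.congr hfg, by rw [← eLpNorm_congr_ae hfg]; exact h.le⟩

theorem add (h : L2Bound f c) (h' : L2Bound g d) : L2Bound (fun x => f x + g x) (c + d) :=
  ⟨add_nonneg h.nonneg h'.nonneg, h.meas.add h'.meas, by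
    rw [ENNReal.ofReal_add h.nonneg h'.nonneg]
    exact (eLpNorm_add_le h.meas h'.meas (by norm_num)).trans (add_le_add h.le h'.le)⟩

theorem neg (h : L2Bound f c) : L2Bound (fun x => -f x) c :=
  ⟨h.nonneg, h.meas.neg, (eLpNorm_neg f 2 volume).trans_le h.le⟩

theorem sub (h : L2Bound f c) (h' : L2Bound g d) : L2Bound (fun x => f x - g x) (c + d) := by
  simpa [sub_eq_add_neg] using h.add h'.neg

/-- Pointwise domination with a constant factor. -/
theorem of_norm_le {K : ℝ} (hK : 0 ≤ K) (h : L2Bound f c) (hg : AEStronglyMeasurable g volume)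
    (hle : ∀ᵐ x, ‖g x‖ ≤ K * ‖f x‖) : L2Bound g (K * c) :=
  ⟨mul_nonneg hK h.nonneg, hg, by
    rw [ENNReal.ofReal_mul hK]
    refine (eLpNorm_le_mul_eLpNorm_of_ae_le_mul hle 2).trans ?_
    gcongr
    exact h.le⟩

theorem of_norm_le_one (h : L2Bound f c) (hg : AEStronglyMeasurable g volume)
    (hle : ∀ᵐ x, ‖g x‖ ≤ ‖f x‖) : L2Bound g c := by
  simpa using h.of_norm_le zero_le_one hg (by simpa using hle)

theorem const_mul (a : ℂ) (h : L2Bound f c) : L2Bound (fun x => a * f x) (‖a‖ * c) :=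
  h.of_norm_le (norm_nonneg _) (h.meas.const_mul a) (.of_forall fun x => by simp)

/-- Domination by a linear combination of two functions. -/
theorem of_norm_le_add {u : ℝ → ℂ} {K L : ℝ} (hK : 0 ≤ K) (hL : 0 ≤ L) (h : L2Bound f c)
    (h' : L2Bound g d) (hu : AEStronglyMeasurable u volume)
    (hle : ∀ᵐ x, ‖u x‖ ≤ K * ‖f x‖ + L * ‖g x‖) : L2Bound u (K * c + L * d) := by
  have h1 : L2Bound (fun x => ((K * ‖f x‖ : ℝ) : ℂ)) (K * c) :=
    h.of_norm_le hK (by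
      exact Complex.continuous_ofReal.comp_aestronglyMeasurable (h.meas.norm.const_mul K))
      (.of_forall fun x => by simp [abs_of_nonneg hK])
  have h2 : L2Bound (fun x => ((L * ‖g x‖ : ℝ) : ℂ)) (L * d) :=
    h'.of_norm_le hL (by
      exact Complex.continuous_ofReal.comp_aestronglyMeasurable (h'.meas.norm.const_mul L))
      (.of_forall fun x => by simp [abs_of_nonneg hL])
  refine (h1.add h2).of_norm_le_one hu ?_
  filter_upwards [hle] with x hx
  rw [← Complex.ofReal_add, Complex.norm_real, Real.norm_of_nonneg (by positivity)]
  exact hx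

theorem lintegral_le (h : L2Bound f c) : ∫⁻ x, ‖f x‖ₑ ^ 2 ≤ ENNReal.ofReal (c ^ 2) := by
  have := h.le
  rw [eLpNorm_eq_lintegral_rpow_enorm_toReal (by norm_num) (by norm_num)] at this
  simp only [ENNReal.toReal_ofNat, ENNReal.rpow_ofNat, one_div] at this
  have h2 := ENNReal.rpow_le_rpow this (z := 2) (by norm_num)
  rw [← ENNReal.rpow_mul] at h2
  norm_num at h2
  rwa [← ENNReal.ofReal_pow h.nonneg] at h2

theorem of_lintegral_le (hc : 0 ≤ c) (hf : AEStronglyMeasurable f volume)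
    (h : ∫⁻ x, ‖f x‖ₑ ^ 2 ≤ ENNReal.ofReal (c ^ 2)) : L2Bound f c := by
  refine ⟨hc, hf, ?_⟩
  rw [eLpNorm_eq_lintegral_rpow_enorm_toReal (by norm_num) (by norm_num)]
  simp only [ENNReal.toReal_ofNat, ENNReal.rpow_ofNat, one_div]
  refine (ENNReal.rpow_le_rpow h (by norm_num)).trans ?_
  rw [ENNReal.ofReal_pow hc, ← ENNReal.rpow_ofNat, ← ENNReal.rpow_mul]
  norm_num

end L2Bound

/-! ### The Fourier transform of square-integrable functions -/

/-- The `L²` Fourier transform of a square-integrable function, as a function. -/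
noncomputable def fhat (f : ℝ → ℂ) : ℝ → ℂ :=
  ⇑(𝓕 (toL2 f) : Lp ℂ 2 (volume : Measure ℝ))

/-- The `L²` inverse Fourier transform of a square-integrable function, as a function. -/
noncomputable def finv (f : ℝ → ℂ) : ℝ → ℂ :=
  ⇑(𝓕⁻ (toL2 f) : Lp ℂ 2 (volume : Measure ℝ))

theorem toL2_eq {f : ℝ → ℂ} (h : MemLp f 2 volume) : toL2 f = h.toLp f := by
  simp [toL2, h]

theorem coeFn_toL2 {f : ℝ → ℂ} (h : MemLp f 2 volume) : ⇑(toL2 f) =ᵐ[volume] f := by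
  rw [toL2_eq h]; exact h.coeFn_toLp

theorem toL2_congr {f g : ℝ → ℂ} (h : f =ᵐ[volume] g) : toL2 f = toL2 g := by
  by_cases hf : MemLp f 2 volume
  · have hg : MemLp g 2 volume := (memLp_congr_ae h).1 hf
    rw [toL2_eq hf, toL2_eq hg]
    exact (MemLp.toLp_eq_toLp_iff hf hg).2 h
  · have hg : ¬ MemLp g 2 volume := fun hg => hf ((memLp_congr_ae h).2 hg)
    simp [toL2, hf, hg]

theorem toL2_coe (f : Lp ℂ 2 (volume : Measure ℝ)) : toL2 f = f := by
  rw [toL2_eq (Lp.memLp f), Lp.toLp_coeFn]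

theorem toL2_sub {f g : ℝ → ℂ} (hf : MemLp f 2 volume) (hg : MemLp g 2 volume) :
    toL2 (fun x => f x - g x) = toL2 f - toL2 g := by
  rw [toL2_eq hf, toL2_eq hg, ← MemLp.toLp_sub hf hg, ← toL2_eq]
  rfl

theorem fhat_congr {f g : ℝ → ℂ} (h : f =ᵐ[volume] g) : fhat f = fhat g := by
  rw [fhat, fhat, toL2_congr h]

theorem finv_congr {f g : ℝ → ℂ} (h : f =ᵐ[volume] g) : finv f = finv g := by
  rw [finv, finv, toL2_congr h]

theorem memLp_fhat (f : ℝ → ℂ) : MemLp (fhat f) 2 volume := Lp.memLp _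

theorem memLp_finv (f : ℝ → ℂ) : MemLp (finv f) 2 volume := Lp.memLp _

theorem measurable_fhat (f : ℝ → ℂ) : Measurable (fhat f) := (Lp.stronglyMeasurable _).measurable

theorem toL2_fhat (f : ℝ → ℂ) : toL2 (fhat f) = 𝓕 (toL2 f) := toL2_coe _

theorem toL2_finv (f : ℝ → ℂ) : toL2 (finv f) = 𝓕⁻ (toL2 f) := toL2_coe _

theorem finv_fhat {f : ℝ → ℂ} (h : MemLp f 2 volume) : finv (fhat f) =ᵐ[volume] f := by
  rw [finv, toL2_fhat, FourierTransform.fourierInv_fourier_eq]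
  exact coeFn_toL2 h

theorem fhat_finv {f : ℝ → ℂ} (h : MemLp f 2 volume) : fhat (finv f) =ᵐ[volume] f := by
  rw [fhat, toL2_finv, FourierTransform.fourier_fourierInv_eq]
  exact coeFn_toL2 h

theorem fhat_sub {f g : ℝ → ℂ} (hf : MemLp f 2 volume) (hg : MemLp g 2 volume) :
    fhat (fun x => f x - g x) =ᵐ[volume] fun ξ => fhat f ξ - fhat g ξ := by
  have : (𝓕 (toL2 f - toL2 g) : Lp ℂ 2 (volume : Measure ℝ)) = 𝓕 (toL2 f) - 𝓕 (toL2 g) :=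
    map_sub (Lp.fourierTransformₗᵢ ℝ ℂ) _ _
  rw [fhat, toL2_sub hf hg, this]
  exact Lp.coeFn_sub _ _

theorem fhat_const_mul {f : ℝ → ℂ} (c : ℂ) (hf : MemLp f 2 volume) :
    fhat (fun x => c * f x) =ᵐ[volume] fun ξ => c * fhat f ξ := by
  have : toL2 (fun x => c * f x) = c • toL2 f := by
    rw [toL2_eq hf, ← MemLp.toLp_const_smul, ← toL2_eq]
    rfl
  rw [fhat, this, FourierTransform.fourier_smul]
  exact Lp.coeFn_smul _ _

theorem eLpNorm_toL2 {f : ℝ → ℂ} (h : MemLp f 2 volume) :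
    eLpNorm (toL2 f) 2 volume = eLpNorm f 2 volume := eLpNorm_congr_ae (coeFn_toL2 h)

theorem eLpNorm_fhat {f : ℝ → ℂ} (h : MemLp f 2 volume) :
    eLpNorm (fhat f) 2 volume = eLpNorm f 2 volume := by
  have h1 := Lp.norm_fourier_eq (toL2 f)
  rw [Lp.norm_def, Lp.norm_def, ENNReal.toReal_eq_toReal_iff' (Lp.eLpNorm_ne_top _)
    (Lp.eLpNorm_ne_top _), eLpNorm_toL2 h] at h1
  exact h1

theorem eLpNorm_finv {f : ℝ → ℂ} (h : MemLp f 2 volume) :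
    eLpNorm (finv f) 2 volume = eLpNorm f 2 volume := by
  rw [← eLpNorm_fhat (memLp_finv f), eLpNorm_congr_ae (fhat_finv h)]

theorem L2Bound.fhat {f : ℝ → ℂ} {c : ℝ} (h : L2Bound f c) : L2Bound (fhat f) c :=
  ⟨h.nonneg, (memLp_fhat f).1, (eLpNorm_fhat h.memLp).trans_le h.le⟩

theorem L2Bound.finv {f : ℝ → ℂ} {c : ℝ} (h : L2Bound f c) : L2Bound (finv f) c :=
  ⟨h.nonneg, (memLp_finv f).1, (eLpNorm_finv h.memLp).trans_le h.le⟩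

theorem L2Bound.of_fhat {f : ℝ → ℂ} {c : ℝ} (hf : MemLp f 2 volume) (h : L2Bound (DNLS.fhat f) c) :
    L2Bound f c :=
  ⟨h.nonneg, hf.1, (eLpNorm_fhat hf).symm.trans_le h.le⟩

/-- The `L²` Fourier transform is symmetric when paired with a test function. -/
theorem integral_mul_fhat {f : ℝ → ℂ} (hf : MemLp f 2 volume) (φ : SchwartzMap ℝ ℂ) :
    ∫ ξ, φ ξ * fhat f ξ = ∫ x, (𝓕 φ : SchwartzMap ℝ ℂ) x * f x := by
  have h := congrArg (fun T : TemperedDistribution ℝ ℂ => T φ)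
    (Lp.fourier_toTemperedDistribution_eq (toL2 f))
  simp only [TemperedDistribution.fourier_apply, Lp.toTemperedDistribution_apply] at h
  simp only [smul_eq_mul] at h
  rw [fhat, ← h]
  refine integral_congr_ae ?_
  filter_upwards [coeFn_toL2 hf] with x hx
  rw [hx]

/-- Two square-integrable functions agree if they have the same pairings with test functions. -/
theorem ae_eq_of_forall_integral {f g : ℝ → ℂ} (hf : LocallyIntegrable f volume)
    (hg : LocallyIntegrable g volume)
    (h : ∀ φ : SchwartzMap ℝ ℂ, HasCompactSupport φ → ∫ x, φ x * f x = ∫ x, φ x * g x) :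
    f =ᵐ[volume] g := by
  refine ae_eq_of_integral_contDiff_smul_eq hf hg fun φ hφ hφc => ?_
  have hc : HasCompactSupport fun x => ((φ x : ℝ) : ℂ) :=
    hφc.comp_left (g := fun r : ℝ => (r : ℂ)) (by simp)
  have hd : ContDiff ℝ (⊤ : ℕ∞) fun x => ((φ x : ℝ) : ℂ) := Complex.ofRealCLM.contDiff.comp hφ
  have := h (hc.toSchwartzMap hd) (by simpa using! hc)
  simpa [Complex.real_smul] using this

theorem locallyIntegrable_continuous_mul {m f : ℝ → ℂ} (hm : Continuous m)
    (hf : LocallyIntegrable f volume) : LocallyIntegrable (fun x => m x * f x) volume := by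
  rw [← locallyIntegrableOn_univ] at hf ⊢
  exact hf.continuousOn_mul hm.continuousOn isOpen_univ.isLocallyClosed

theorem _root_.MeasureTheory.MemLp.locallyIntegrable_two {f : ℝ → ℂ} (hf : MemLp f 2 volume) :
    LocallyIntegrable f volume := hf.locallyIntegrable (by norm_num)

/-- On `L¹ ∩ L²` the `L²` Fourier transform is the Fourier integral. -/
theorem fhat_eq_fourier {f : ℝ → ℂ} (hf1 : Integrable f) (hf : MemLp f 2 volume) :
    fhat f =ᵐ[volume] 𝓕 f := by
  have hcont : Continuous (𝓕 f) :=
    VectorFourier.fourierIntegral_continuous Real.continuous_fourierChar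
      (by exact continuous_inner) hf1
  refine ae_eq_of_forall_integral (memLp_fhat f).locallyIntegrable_two
    hcont.locallyIntegrable fun φ _ => ?_
  rw [integral_mul_fhat hf φ]
  have h := VectorFourier.integral_fourierIntegral_smul_eq_flip (μ := volume) (ν := volume)
    (L := innerₗ ℝ) (f := φ) (g := f) Real.continuous_fourierChar continuous_inner
    φ.integrable hf1
  simp only [flip_innerₗ, smul_eq_mul] at h
  exact h

theorem integral_mul_finv {f : ℝ → ℂ} (hf : MemLp f 2 volume) (φ : SchwartzMap ℝ ℂ) :
    ∫ ξ, φ ξ * finv f ξ = ∫ x, (𝓕⁻ φ : SchwartzMap ℝ ℂ) x * f x := by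
  have h := congrArg (fun T : TemperedDistribution ℝ ℂ => T φ)
    (Lp.fourierInv_toTemperedDistribution_eq (toL2 f))
  simp only [TemperedDistribution.fourierInv_apply, Lp.toTemperedDistribution_apply] at h
  simp only [smul_eq_mul] at h
  rw [finv, ← h]
  refine integral_congr_ae ?_
  filter_upwards [coeFn_toL2 hf] with x hx
  rw [hx]

theorem continuous_fourier {f : ℝ → ℂ} (hf : Integrable f) : Continuous (𝓕 f) :=
  VectorFourier.fourierIntegral_continuous Real.continuous_fourierChar
    (by exact continuous_inner) hf

theorem continuous_fourierInv {f : ℝ → ℂ} (hf : Integrable f) : Continuous (𝓕⁻ f) :=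
  VectorFourier.fourierIntegral_continuous Real.continuous_fourierChar
    (by exact (continuous_inner.neg : Continuous fun p : ℝ × ℝ => -inner ℝ p.1 p.2)) hf

theorem finv_eq_fourierInv {f : ℝ → ℂ} (hf1 : Integrable f) (hf : MemLp f 2 volume) :
    finv f =ᵐ[volume] 𝓕⁻ f := by
  refine ae_eq_of_forall_integral (memLp_finv f).locallyIntegrable_two
    (continuous_fourierInv hf1).locallyIntegrable fun φ _ => ?_
  rw [integral_mul_finv hf φ]
  have h := VectorFourier.integral_fourierIntegral_smul_eq_flip (μ := volume) (ν := volume)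
    (L := -innerₗ ℝ) (f := φ) (g := f) Real.continuous_fourierChar
    (by exact (continuous_inner.neg : Continuous fun p : ℝ × ℝ => -inner ℝ p.1 p.2))
    φ.integrable hf1
  have hflip : (-innerₗ ℝ : ℝ →ₗ[ℝ] ℝ →ₗ[ℝ] ℝ).flip = -innerₗ ℝ := by
    ext; simp
  rw [hflip] at h
  simp only [smul_eq_mul] at h
  rw [SchwartzMap.fourierInv_coe]
  exact h

/-! ### Derivatives and translations -/

/-- The symbol `2πiξ` of `∂ₓ`. -/
noncomputable def dsym (ξ : ℝ) : ℂ := 2 * Real.pi * Complex.I * ξ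

/-- If `f` and `f'` are square integrable, then `∂ₓ` acts as multiplication by `2πiξ`. -/
theorem fhat_deriv {f f' : ℝ → ℂ} (hd : ∀ x, HasDerivAt f (f' x) x) (hf : MemLp f 2 volume)
    (hf' : MemLp f' 2 volume) : fhat f' =ᵐ[volume] fun ξ => dsym ξ * fhat f ξ := by
  have hloc : LocallyIntegrable (fun ξ => dsym ξ * fhat f ξ) volume := by
    have hc : Continuous dsym := by unfold dsym; fun_prop
    exact locallyIntegrable_continuous_mul hc (memLp_fhat f).locallyIntegrable_two
  refine ae_eq_of_forall_integral (memLp_fhat f').locallyIntegrable_two hloc fun φ hφ => ?_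
  have hψc : HasCompactSupport fun ξ => dsym ξ * φ ξ := hφ.mul_left
  have hψd : ContDiff ℝ (⊤ : ℕ∞) fun ξ => dsym ξ * φ ξ := by
    refine ContDiff.mul ?_ (φ.smooth _)
    unfold dsym
    exact contDiff_const.mul Complex.ofRealCLM.contDiff
  set ψ := hψc.toSchwartzMap hψd
  have hψ : ∀ ξ, ψ ξ = dsym ξ * φ ξ := fun _ => rfl
  have hder : ∀ x, HasDerivAt (𝓕 φ : SchwartzMap ℝ ℂ) (-(𝓕 ψ : SchwartzMap ℝ ℂ) x) x := by
    intro x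
    have hi : Integrable (fun y : ℝ => y • φ y) := by
      have : Integrable (fun y : ℝ => ‖y‖ ^ 1 * ‖φ y‖) := φ.integrable_pow_mul volume 1
      refine this.mono (by fun_prop) (.of_forall fun y => ?_)
      simp
    have := Real.hasDerivAt_fourier φ.integrable hi x
    rw [SchwartzMap.fourier_coe, SchwartzMap.fourier_coe]
    convert! this using 1
    rw [Real.fourier_eq, Real.fourier_eq, ← integral_neg]
    refine integral_congr_ae (.of_forall fun y => ?_)
    simp only [hψ, dsym, Circle.smul_def, smul_eq_mul]
    ring
  calc ∫ x, φ x * fhat f' x = ∫ x, (𝓕 φ : SchwartzMap ℝ ℂ) x * f' x := integral_mul_fhat hf' φ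
    _ = -∫ x, (-(𝓕 ψ : SchwartzMap ℝ ℂ) x) * f x := by
        refine integral_mul_deriv_eq_deriv_mul_of_integrable
          (fun x _ => hder x) (fun x _ => hd x) ?_ ?_ ?_
        · exact MemLp.integrable_mul ((𝓕 φ : SchwartzMap ℝ ℂ).memLp 2 volume) hf'
        · exact MemLp.integrable_mul ((𝓕 ψ : SchwartzMap ℝ ℂ).memLp 2 volume).neg hf
        · exact MemLp.integrable_mul ((𝓕 φ : SchwartzMap ℝ ℂ).memLp 2 volume) hf
    _ = ∫ x, (𝓕 ψ : SchwartzMap ℝ ℂ) x * f x := by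
        simp only [neg_mul, integral_neg, neg_neg]
    _ = ∫ ξ, ψ ξ * fhat f ξ := (integral_mul_fhat hf ψ).symm
    _ = _ := by
        refine integral_congr_ae (.of_forall fun y => ?_)
        simp only [hψ]; ring

/-- The symbol `e^{2πihξ}` of the translation `f ↦ f(· + h)`. -/
noncomputable def tsym (h ξ : ℝ) : ℂ := Complex.exp (2 * Real.pi * h * ξ * Complex.I)

theorem _root_.MeasureTheory.MemLp.comp_add_right {f : ℝ → ℂ} (hf : MemLp f 2 volume) (h : ℝ) :
    MemLp (fun x => f (x + h)) 2 volume :=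
  hf.comp_measurePreserving (measurePreserving_add_right volume h)

theorem fhat_comp_add {f : ℝ → ℂ} (hf : MemLp f 2 volume) (h : ℝ) :
    fhat (fun x => f (x + h)) =ᵐ[volume] fun ξ => tsym h ξ * fhat f ξ := by
  have hloc : LocallyIntegrable (fun ξ => tsym h ξ * fhat f ξ) volume := by
    have hc : Continuous (tsym h) := by unfold tsym; fun_prop
    exact locallyIntegrable_continuous_mul hc (memLp_fhat f).locallyIntegrable_two
  refine ae_eq_of_forall_integral (memLp_fhat _).locallyIntegrable_two hloc fun φ hφ => ?_
  have hψc : HasCompactSupport fun ξ => tsym h ξ * φ ξ := hφ.mul_left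
  have hψd : ContDiff ℝ (⊤ : ℕ∞) fun ξ => tsym h ξ * φ ξ := by
    refine ContDiff.mul ?_ (φ.smooth _)
    unfold tsym
    exact ((contDiff_const.mul Complex.ofRealCLM.contDiff).mul contDiff_const).cexp
  set ψ := hψc.toSchwartzMap hψd
  have hψ : ∀ ξ, ψ ξ = tsym h ξ * φ ξ := fun _ => rfl
  rw [integral_mul_fhat (hf.comp_add_right h) φ]
  have e : ∫ ξ, φ ξ * (tsym h ξ * fhat f ξ) = ∫ ξ, ψ ξ * fhat f ξ := by
    refine integral_congr_ae (.of_forall fun y => ?_)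
    simp only [hψ]; ring
  rw [e, integral_mul_fhat hf ψ,
    ← integral_add_right_eq_self (fun x => (𝓕 ψ : SchwartzMap ℝ ℂ) x * f x) h]
  refine integral_congr_ae (.of_forall fun x => ?_)
  simp only
  congr 1
  rw [SchwartzMap.fourier_coe, SchwartzMap.fourier_coe, Real.fourier_real_eq_integral_exp_smul,
    Real.fourier_real_eq_integral_exp_smul]
  refine integral_congr_ae (.of_forall fun y => ?_)
  simp only [hψ, tsym, smul_eq_mul]
  rw [← mul_assoc, ← Complex.exp_add]
  congr 2
  push_cast; ring

/-- A bound for the derivative, on the Fourier side, controls difference quotients. -/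
theorem L2Bound.translate_sub {f : ℝ → ℂ} {B : ℝ} (hf : MemLp f 2 volume)
    (h : L2Bound (fun ξ => dsym ξ * DNLS.fhat f ξ) B) (r : ℝ) :
    L2Bound (fun x => f (x + r) - f x) (|r| * B) := by
  refine L2Bound.of_fhat ((hf.comp_add_right r).sub hf) ?_
  refine h.of_norm_le (abs_nonneg r) (memLp_fhat _).1 ?_
  filter_upwards [fhat_sub (hf.comp_add_right r) hf, fhat_comp_add hf r] with ξ h1 h2
  rw [h1, h2]
  have e : tsym r ξ * DNLS.fhat f ξ - DNLS.fhat f ξ = (tsym r ξ - 1) * DNLS.fhat f ξ := by ring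
  rw [e, norm_mul, norm_mul, ← mul_assoc]
  gcongr
  have h3 := Real.norm_exp_I_mul_ofReal_sub_one_le (x := 2 * Real.pi * r * ξ)
  have e2 : tsym r ξ = Complex.exp (Complex.I * ((2 * Real.pi * r * ξ : ℝ) : ℂ)) := by
    rw [tsym]; push_cast; ring_nf
  rw [e2]
  refine h3.trans ?_
  simp only [dsym, norm_mul, Complex.norm_I, Complex.norm_real, Real.norm_eq_abs,
    Complex.norm_ofNat, abs_two]
  apply le_of_eq; ring

/-- Conversely, bounded difference quotients give a bound for the derivative on the Fourier
side. -/
theorem L2Bound.dsym_mul_fhat {f : ℝ → ℂ} {B : ℝ} (hf : MemLp f 2 volume) (hB : 0 ≤ B)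
    (h : ∀ r : ℝ, L2Bound (fun x => f (x + r) - f x) (|r| * B)) :
    L2Bound (fun ξ => dsym ξ * DNLS.fhat f ξ) B := by
  have hm : Measurable fun ξ => dsym ξ * DNLS.fhat f ξ := by
    refine Measurable.mul ?_ (measurable_fhat f)
    unfold dsym; fun_prop
  refine L2Bound.of_lintegral_le hB hm.aestronglyMeasurable ?_
  let F : ℕ → ℝ → ℂ := fun n ξ => ((n : ℂ) + 1) * (tsym (1 / ((n : ℝ) + 1)) ξ - 1) * DNLS.fhat f ξ
  have hF : ∀ n, ∫⁻ ξ, ‖F n ξ‖ₑ ^ 2 ≤ ENNReal.ofReal (B ^ 2) := by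
    intro n
    have h0 := ((h (1 / ((n : ℝ) + 1))).fhat).const_mul ((n : ℂ) + 1)
    have h1 : ‖(n : ℂ) + 1‖ * (|1 / ((n : ℝ) + 1)| * B) = B := by
      have : (n : ℂ) + 1 = ((n + 1 : ℝ) : ℂ) := by push_cast; rfl
      rw [this, Complex.norm_real, Real.norm_eq_abs, abs_of_pos (by positivity),
        abs_of_pos (by positivity)]
      field_simp
    rw [h1] at h0
    refine (h0.congr_ae ?_).lintegral_le
    filter_upwards [fhat_sub (hf.comp_add_right (1 / ((n : ℝ) + 1))) hf,
      fhat_comp_add hf (1 / ((n : ℝ) + 1))] with ξ e1 e2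
    rw [e1, e2]
    simp only [F]; ring
  have hFm : ∀ n, Measurable (F n) := by
    intro n
    refine Measurable.mul ?_ (measurable_fhat f)
    unfold tsym; fun_prop
  have hlim : ∀ ξ, Filter.Tendsto (fun n => F n ξ) Filter.atTop (nhds (dsym ξ * DNLS.fhat f ξ)) := by
    intro ξ
    refine Filter.Tendsto.mul_const _ ?_
    have hd : HasDerivAt (fun r : ℝ => tsym r ξ) (dsym ξ) 0 := by
      have h1 : HasDerivAt (fun r : ℝ => (2 * Real.pi * (r : ℂ) * ξ * Complex.I))
          (2 * Real.pi * 1 * ξ * Complex.I) 0 :=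
        ((((hasDerivAt_id (0 : ℝ)).ofReal_comp).const_mul (2 * Real.pi : ℂ)).mul_const
          (ξ : ℂ)).mul_const Complex.I
      have h2 := h1.cexp
      convert! h2 using 1
      simp [dsym]; ring
    have h3 := hd.tendsto_slope_zero
    have h4 : Filter.Tendsto (fun n : ℕ => 1 / ((n : ℝ) + 1)) Filter.atTop (nhdsWithin 0 {0}ᶜ) :=
      tendsto_nhdsWithin_iff.2 ⟨tendsto_one_div_add_atTop_nhds_zero_nat,
        .of_forall fun n => by
          have : (0 : ℝ) < 1 / ((n : ℝ) + 1) := by positivity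
          exact this.ne'⟩
    refine (h3.comp h4).congr fun n => ?_
    simp [tsym, Complex.real_smul]
  calc ∫⁻ ξ, ‖dsym ξ * DNLS.fhat f ξ‖ₑ ^ 2
      = ∫⁻ ξ, Filter.liminf (fun n => ‖F n ξ‖ₑ ^ 2) Filter.atTop := by
        refine lintegral_congr fun ξ => ?_
        have := (ENNReal.continuous_pow 2).continuousAt.tendsto.comp (hlim ξ).enorm
        exact this.liminf_eq.symm
    _ ≤ Filter.liminf (fun n => ∫⁻ ξ, ‖F n ξ‖ₑ ^ 2) Filter.atTop :=
        lintegral_liminf_le fun n => (hFm n).enorm.pow_const 2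
    _ ≤ ENNReal.ofReal (B ^ 2) := by
        refine Filter.liminf_le_of_frequently_le' (.of_forall hF)

end DNLS

namespace DNLS

/-! ### Cauchy–Schwarz inequalities and integrability of weighted functions -/

theorem lintegral_mul_sq_le {α : Type*} [MeasurableSpace α] {μ : Measure α} {f g : α → ℝ≥0∞}
    (hf : AEMeasurable f μ) (hg : AEMeasurable g μ) :
    (∫⁻ x, f x * g x ∂μ) ^ 2 ≤ (∫⁻ x, f x ^ 2 ∂μ) * ∫⁻ x, g x ^ 2 ∂μ := by
  have h := ENNReal.lintegral_mul_le_Lp_mul_Lq μ Real.HolderConjugate.two_two hf hg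
  simp only [Pi.mul_apply, ENNReal.rpow_ofNat] at h
  have h2 := pow_le_pow_left' h 2
  rw [mul_pow] at h2
  refine h2.trans_eq ?_
  congr 1 <;>
  · rw [← ENNReal.rpow_ofNat, ← ENNReal.rpow_mul]
    norm_num

theorem L2Bound.integral_norm_mul_le {f g : ℝ → ℂ} {c d : ℝ} (hf : L2Bound f c)
    (hg : L2Bound g d) :
    Integrable (fun x => f x * g x) ∧ ∫ x, ‖f x * g x‖ ≤ c * d := by
  have h1 : Integrable (fun x => f x * g x) := MemLp.integrable_mul hf.memLp hg.memLp
  refine ⟨h1, ?_⟩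
  have h2 : (∫⁻ x, ‖f x‖ₑ * ‖g x‖ₑ) ^ 2 ≤ ENNReal.ofReal (c * d) ^ 2 := by
    refine (lintegral_mul_sq_le hf.meas.enorm hg.meas.enorm).trans ?_
    rw [← ENNReal.ofReal_pow (mul_nonneg hf.nonneg hg.nonneg), mul_pow,
      ENNReal.ofReal_mul (sq_nonneg _)]
    gcongr
    · exact hf.lintegral_le
    · exact hg.lintegral_le
  have h3 : ∫⁻ x, ‖f x‖ₑ * ‖g x‖ₑ ≤ ENNReal.ofReal (c * d) :=
    (ENNReal.pow_le_pow_left_iff two_ne_zero).1 h2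
  rw [integral_norm_eq_lintegral_enorm h1.1]
  refine ENNReal.toReal_le_of_le_ofReal (mul_nonneg hf.nonneg hg.nonneg) ?_
  simpa only [enorm_mul] using h3

/-- A square-integrable function with square-integrable derivative has an integrable Fourier
transform. The free parameter `r` makes this an interpolation inequality. -/
theorem integrable_of_weight {A : ℝ → ℂ} {c r : ℝ} (hr : 0 < r)
    (h : L2Bound (fun ξ => ((1 + r * |ξ| : ℝ) : ℂ) * A ξ) c) :
    Integrable A ∧ ∫ ξ, ‖A ξ‖ ≤ 2 / √r * c := by
  have hw : ∀ ξ : ℝ, 0 < 1 + r * |ξ| := fun ξ => by positivity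
  have hm : Continuous fun ξ : ℝ => (((1 + r * |ξ|)⁻¹ : ℝ) : ℂ) := by
    refine Complex.continuous_ofReal.comp ?_
    exact Continuous.inv₀ (by fun_prop) fun ξ => (hw ξ).ne'
  have h1 : L2Bound (fun ξ : ℝ => (((1 + r * |ξ|)⁻¹ : ℝ) : ℂ)) (2 / √r) := by
    refine L2Bound.of_lintegral_le (by positivity) hm.aestronglyMeasurable ?_
    have hI : Integrable (fun ξ : ℝ => (1 + (r * ξ) ^ 2)⁻¹) :=
      integrable_inv_one_add_sq.comp_mul_left' hr.ne'
    calc ∫⁻ ξ : ℝ, ‖(((1 + r * |ξ|)⁻¹ : ℝ) : ℂ)‖ₑ ^ 2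
        ≤ ∫⁻ ξ : ℝ, ENNReal.ofReal ((1 + (r * ξ) ^ 2)⁻¹) := by
          refine lintegral_mono fun ξ => ?_
          rw [← ofReal_norm, ← ENNReal.ofReal_pow (norm_nonneg _)]
          refine ENNReal.ofReal_le_ofReal ?_
          rw [Complex.norm_real, Real.norm_of_nonneg (inv_nonneg.2 (hw ξ).le), inv_pow]
          refine inv_anti₀ (by positivity) ?_
          rw [mul_pow, ← sq_abs ξ]
          have h0 : 0 ≤ r * |ξ| := by positivity
          nlinarith
      _ = ENNReal.ofReal (∫ ξ : ℝ, (1 + (r * ξ) ^ 2)⁻¹) :=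
          (ofReal_integral_eq_lintegral_ofReal hI (.of_forall fun ξ => by positivity)).symm
      _ ≤ ENNReal.ofReal ((2 / √r) ^ 2) := by
          refine ENNReal.ofReal_le_ofReal ?_
          rw [Measure.integral_comp_mul_left (fun x : ℝ => (1 + x ^ 2)⁻¹) r,
            integral_univ_inv_one_add_sq, div_pow, Real.sq_sqrt hr.le, abs_of_pos (by positivity),
            smul_eq_mul, inv_mul_eq_div]
          gcongr
          linarith [Real.pi_le_four]
  obtain ⟨h2, h3⟩ := h1.integral_norm_mul_le h
  have e : (fun ξ : ℝ => (((1 + r * |ξ|)⁻¹ : ℝ) : ℂ) * (((1 + r * |ξ| : ℝ) : ℂ) * A ξ)) = A := by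
    ext ξ
    rw [← mul_assoc, ← Complex.ofReal_mul, inv_mul_cancel₀ (hw ξ).ne']
    simp
  rw [e] at h2
  refine ⟨h2, ?_⟩
  have e2 : ∀ ξ, _ := congrFun e
  simp only [e2] at h3
  exact h3

theorem norm_fourierInv_le {A : ℝ → ℂ} (x : ℝ) : ‖𝓕⁻ A x‖ ≤ ∫ ξ, ‖A ξ‖ := by
  rw [Real.fourierInv_eq]
  refine (norm_integral_le_integral_norm _).trans_eq ?_
  simp

/-- An interpolation inequality for the sup norm. For `r` of the order of the time step, an error of
size `r²` in `L²` and of size `1` in `H¹` becomes small in `L^∞`. -/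
theorem ae_norm_le_of_dsym {f : ℝ → ℂ} {α B r : ℝ} (hr : 0 < r) (hf : L2Bound f α)
    (hB : L2Bound (fun ξ => dsym ξ * fhat f ξ) B) :
    ∀ᵐ x, ‖f x‖ ≤ 2 / √r * (α + r * B) := by
  have h : L2Bound (fun ξ => ((1 + r * |ξ| : ℝ) : ℂ) * fhat f ξ) (1 * α + r * B) := by
    refine L2Bound.of_norm_le_add zero_le_one hr.le hf.fhat hB ?_ (.of_forall fun ξ => ?_)
    · refine AEStronglyMeasurable.mul ?_ (memLp_fhat f).1
      exact Continuous.aestronglyMeasurable (by fun_prop)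
    · rw [norm_mul, norm_mul, Complex.norm_real, Real.norm_of_nonneg (by positivity)]
      have : |ξ| ≤ ‖dsym ξ‖ := by
        simp only [dsym, norm_mul, Complex.norm_I, Complex.norm_real, Real.norm_eq_abs,
          Complex.norm_ofNat, abs_of_pos Real.pi_pos]
        nlinarith [abs_nonneg ξ, Real.pi_gt_three]
      have h2 := mul_le_mul_of_nonneg_left
        (mul_le_mul_of_nonneg_right this (norm_nonneg (fhat f ξ))) hr.le
      nlinarith
  obtain ⟨hi, hle⟩ := integrable_of_weight hr h
  filter_upwards [finv_fhat hf.memLp, finv_eq_fourierInv hi (memLp_fhat f)] with x h1 h2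
  rw [← h1, h2]
  refine (norm_fourierInv_le x).trans (hle.trans_eq ?_)
  ring

/-! ### A mean value inequality in `L²` -/

/-- If `s ↦ g s ξ` is differentiable for every `ξ` and the derivative is bounded by `B` in
`L²(dξ)`, then the increment of `g` is bounded by `B (b - a)` in `L²(dξ)`. -/
theorem L2Bound.mean_value {g g' : ℝ → ℝ → ℂ} {a b B : ℝ} (hab : a ≤ b) (hB : 0 ≤ B)
    (hm : ∀ s ∈ Icc a b, Measurable (g s))
    (hc : ∀ ξ, ContinuousOn (fun s => g s ξ) (Icc a b))
    (hd : ∀ ξ, ∀ s ∈ Ioo a b, HasDerivAt (fun s => g s ξ) (g' s ξ) s)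
    (hg' : ∀ s ∈ Ioo a b, L2Bound (g' s) B) :
    L2Bound (fun ξ => g b ξ - g a ξ) (B * (b - a)) := by
  have hBab : 0 ≤ B * (b - a) := mul_nonneg hB (sub_nonneg.2 hab)
  refine L2Bound.of_lintegral_le hBab
    ((hm b ⟨hab, le_rfl⟩).sub (hm a ⟨le_rfl, hab⟩)).aestronglyMeasurable ?_
  rcases hab.eq_or_lt with rfl | hlt
  · simp
  -- extend `g` beyond `[a, b]` to see that its derivative is jointly measurable
  let G : ℝ → ℝ → ℂ := fun s ξ => g (projIcc a b hab s) ξ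
  have hG : Measurable (Function.uncurry G) := by
    refine measurable_uncurry_of_continuous_of_measurable (fun ξ => ?_)
      fun s => hm _ (projIcc a b hab s).2
    exact (continuousOn_iff_continuous_domRestrict.1 (hc ξ)).comp continuous_projIcc
  let H : ℝ → ℝ → ℂ := fun s ξ => (Ioo a b).indicator (fun s => g' s ξ) s
  have hH : Measurable (Function.uncurry H) := by
    let D : ℕ → ℝ × ℝ → ℂ := fun n => (Ioo a b ×ˢ univ).indicator fun p =>
      ((n : ℂ) + 1) * (G (p.1 + 1 / ((n : ℝ) + 1)) p.2 - G p.1 p.2)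
    have hD : ∀ n, Measurable (D n) := by
      intro n
      refine Measurable.indicator ?_ (measurableSet_Ioo.prod MeasurableSet.univ)
      refine Measurable.const_mul (Measurable.sub ?_ hG) _
      exact hG.comp (f := fun p : ℝ × ℝ => (p.1 + 1 / ((n : ℝ) + 1), p.2)) (by fun_prop)
    refine measurable_of_tendsto_metrizable hD (tendsto_pi_nhds.2 fun p => ?_)
    obtain ⟨s, ξ⟩ := p
    by_cases hs : s ∈ Ioo a b
    · have h4 : Filter.Tendsto (fun n : ℕ => 1 / ((n : ℝ) + 1)) Filter.atTop
          (nhdsWithin 0 {0}ᶜ) :=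
        tendsto_nhdsWithin_iff.2 ⟨tendsto_one_div_add_atTop_nhds_zero_nat,
          .of_forall fun n => by
            have : (0 : ℝ) < 1 / ((n : ℝ) + 1) := by positivity
            exact this.ne'⟩
      have hGd : HasDerivAt (fun s => G s ξ) (g' s ξ) s := by
        refine (hd ξ s hs).congr_of_eventuallyEq ?_
        filter_upwards [Ioo_mem_nhds hs.1 hs.2] with r hr
        simp only [G, projIcc_of_mem hab (Ioo_subset_Icc_self hr)]
      have h3 := hGd.tendsto_slope_zero.comp h4
      have e : Function.uncurry H (s, ξ) = g' s ξ := by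
        simp [H, Function.uncurry, hs]
      rw [e]
      refine h3.congr fun n => ?_
      simp only [D, Function.comp_apply]
      rw [indicator_of_mem (by exact ⟨hs, trivial⟩)]
      simp [Complex.real_smul]
    · have e : Function.uncurry H (s, ξ) = 0 := by
        simp [H, Function.uncurry, hs]
      rw [e]
      refine tendsto_const_nhds.congr fun n => ?_
      simp only [D]
      rw [indicator_of_notMem (by simp [hs])]
  have hHs : ∀ ξ, Measurable fun s => H s ξ := fun ξ =>
    hH.comp (f := fun s => (s, ξ)) (by fun_prop)
  have hpt : ∀ ξ, ‖g b ξ - g a ξ‖ₑ ^ 2 ≤ ENNReal.ofReal (b - a) * ∫⁻ s, ‖H s ξ‖ₑ ^ 2 := by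
    intro ξ
    by_cases htop : ∫⁻ s, ‖H s ξ‖ₑ ^ 2 = ⊤
    · rw [htop, ENNReal.mul_top (by simpa using hlt)]
      exact le_top
    have hvol : (∫⁻ s, (Ioo a b).indicator (1 : ℝ → ℝ≥0∞) s ^ 2) = ENNReal.ofReal (b - a) := by
      have : ∀ s, (Ioo a b).indicator (1 : ℝ → ℝ≥0∞) s ^ 2 = (Ioo a b).indicator 1 s := by
        intro s; by_cases hs : s ∈ Ioo a b <;> simp [hs]
      simp only [this]
      rw [lintegral_indicator_one measurableSet_Ioo, Real.volume_Ioo]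
    have hone : ∀ s, (Ioo a b).indicator (1 : ℝ → ℝ≥0∞) s * ‖H s ξ‖ₑ = ‖H s ξ‖ₑ := by
      intro s; by_cases hs : s ∈ Ioo a b <;> simp [H, hs]
    have hCS : (∫⁻ s, ‖H s ξ‖ₑ) ^ 2 ≤ ENNReal.ofReal (b - a) * ∫⁻ s, ‖H s ξ‖ₑ ^ 2 := by
      have := lintegral_mul_sq_le (μ := volume) (f := (Ioo a b).indicator (1 : ℝ → ℝ≥0∞))
        (g := fun s => ‖H s ξ‖ₑ) (measurable_one.indicator measurableSet_Ioo).aemeasurable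
        (hHs ξ).enorm.aemeasurable
      simpa only [hone, hvol] using this
    have hint : Integrable fun s => H s ξ := by
      refine ⟨(hHs ξ).aestronglyMeasurable, ?_⟩
      rw [hasFiniteIntegral_iff_enorm]
      by_contra hcon
      rw [not_lt, top_le_iff] at hcon
      rw [hcon] at hCS
      exact (ENNReal.mul_lt_top ENNReal.ofReal_lt_top (lt_top_iff_ne_top.2 htop)).not_ge
        (by simpa using hCS)
    have hFTC : ∫ s in a..b, H s ξ = g b ξ - g a ξ := by
      refine intervalIntegral.integral_eq_sub_of_hasDerivAt_of_le hab (hc ξ) (fun s hs => ?_)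
        hint.intervalIntegrable
      have : H s ξ = g' s ξ := by simp [H, hs]
      rw [this]
      exact hd ξ s hs
    refine le_trans (pow_le_pow_left' ?_ 2) hCS
    rw [← hFTC, intervalIntegral.integral_of_le hab]
    exact (enorm_integral_le_lintegral_enorm _).trans (setLIntegral_le_lintegral _ _)
  calc ∫⁻ ξ, ‖g b ξ - g a ξ‖ₑ ^ 2
      ≤ ∫⁻ ξ, ENNReal.ofReal (b - a) * ∫⁻ s, ‖H s ξ‖ₑ ^ 2 := lintegral_mono hpt
    _ = ENNReal.ofReal (b - a) * ∫⁻ ξ, ∫⁻ s, ‖H s ξ‖ₑ ^ 2 :=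
        lintegral_const_mul' _ _ ENNReal.ofReal_ne_top
    _ = ENNReal.ofReal (b - a) * ∫⁻ s, ∫⁻ ξ, ‖H s ξ‖ₑ ^ 2 := by
        rw [lintegral_lintegral_swap]
        exact ((hH.comp measurable_swap).enorm.pow_const 2).aemeasurable
    _ ≤ ENNReal.ofReal (b - a) *
          ∫⁻ s, (Ioo a b).indicator (fun _ => ENNReal.ofReal (B ^ 2)) s := by
        gcongr with s
        by_cases hs : s ∈ Ioo a b
        · simpa [H, hs] using (hg' s hs).lintegral_le
        · simp [H, hs]
    _ = ENNReal.ofReal ((B * (b - a)) ^ 2) := by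
        rw [lintegral_indicator measurableSet_Ioo, lintegral_const, Measure.restrict_apply_univ,
          Real.volume_Ioo, ← ENNReal.ofReal_mul (sq_nonneg _), ← ENNReal.ofReal_mul (by linarith)]
        congr 1; ring

end DNLS

namespace DNLS

/-! ### Weighted bounds on the Fourier side -/

/-- The weight `1 + |ξ|`. -/
noncomputable def wt (ξ : ℝ) : ℝ := 1 + |ξ|

theorem one_le_wt (ξ : ℝ) : 1 ≤ wt ξ := by simp [wt]

theorem wt_pos (ξ : ℝ) : 0 < wt ξ := zero_lt_one.trans_le (one_le_wt ξ)

theorem continuous_wt : Continuous wt := by unfold wt; fun_prop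

/-- `A` is measurable with `‖(1 + |ξ|)^q A‖_{L²} ≤ α`. If `A` is the Fourier transform of `f`, this
bounds the `H^q`-norm of `f`. -/
structure FBound (q : ℕ) (A : ℝ → ℂ) (α : ℝ) : Prop where
  meas : Measurable A
  bound : L2Bound (fun ξ => ((wt ξ ^ q : ℝ) : ℂ) * A ξ) α

namespace FBound

variable {q : ℕ} {A B : ℝ → ℂ} {α β : ℝ}

theorem nonneg (h : FBound q A α) : 0 ≤ α := h.bound.nonneg

theorem mono_le (h : FBound q A α) (hαβ : α ≤ β) : FBound q A β := ⟨h.meas, h.bound.mono hαβ⟩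

theorem of_norm_le {K : ℝ} (hK : 0 ≤ K) (h : FBound q A α) (hB : Measurable B)
    (hle : ∀ ξ, ‖B ξ‖ ≤ K * ‖A ξ‖) : FBound q B (K * α) := by
  refine ⟨hB, h.bound.of_norm_le hK ?_ (.of_forall fun ξ => ?_)⟩
  · exact ((Complex.continuous_ofReal.comp (continuous_wt.pow q)).measurable.mul
      hB).aestronglyMeasurable
  · rw [norm_mul, norm_mul]
    have := mul_le_mul_of_nonneg_left (hle ξ) (norm_nonneg ((wt ξ ^ q : ℝ) : ℂ))
    linarith

theorem mono_weight {p : ℕ} (h : FBound q A α) (hp : p ≤ q) : FBound p A α := by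
  refine ⟨h.meas, h.bound.of_norm_le_one ?_ (.of_forall fun ξ => ?_)⟩
  · exact ((Complex.continuous_ofReal.comp (continuous_wt.pow p)).measurable.mul
      h.meas).aestronglyMeasurable
  · rw [norm_mul, norm_mul]
    gcongr
    rw [Complex.norm_real, Complex.norm_real, Real.norm_of_nonneg (pow_nonneg (wt_pos ξ).le _),
      Real.norm_of_nonneg (pow_nonneg (wt_pos ξ).le _)]
    exact pow_le_pow_right₀ (one_le_wt ξ) hp

theorem l2Bound (h : FBound q A α) : L2Bound A α := by
  have := (h.mono_weight (Nat.zero_le q)).bound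
  simpa using this

theorem of_l2Bound (hm : Measurable A) (h : L2Bound A α) : FBound 0 A α :=
  ⟨hm, by simpa using h⟩

theorem sub (h : FBound q A α) (h' : FBound q B β) : FBound q (fun ξ => A ξ - B ξ) (α + β) :=
  ⟨h.meas.sub h'.meas, (h.bound.sub h'.bound).congr_ae (.of_forall fun ξ => by simp only; ring)⟩

theorem integrable (hq : 1 ≤ q) (h : FBound q A α) : Integrable A ∧ ∫ ξ, ‖A ξ‖ ≤ 2 * α := by
  have := (h.mono_weight hq).bound
  have h2 := integrable_of_weight (r := 1) (A := A) one_pos (by simpa [wt] using this)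
  simpa using h2

end FBound

/-- `ξ ↦ conj (B (-ξ))`, the Fourier transform of `f̄` if `B` is the one of `f`. -/
noncomputable def refl (B : ℝ → ℂ) (ξ : ℝ) : ℂ := conj (B (-ξ))

theorem FBound.refl {q : ℕ} {B : ℝ → ℂ} {β : ℝ} (h : FBound q B β) : FBound q (refl B) β := by
  refine ⟨Complex.continuous_conj.measurable.comp (h.meas.comp measurable_neg), ?_⟩
  refine L2Bound.of_lintegral_le h.nonneg ?_ ?_
  · exact ((Complex.continuous_ofReal.comp (continuous_wt.pow q)).measurable.mul
      (Complex.continuous_conj.measurable.comp (h.meas.comp measurable_neg))).aestronglyMeasurable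
  · refine le_trans (le_of_eq ?_) h.bound.lintegral_le
    rw [← lintegral_neg_eq_self]
    refine lintegral_congr fun ξ => ?_
    simp only [DNLS.refl, enorm_mul, neg_neg, RCLike.enorm_conj, wt, abs_neg]

/-! ### Trilinear convolution estimates -/

/-- The threefold convolution of nonnegative functions. -/
noncomputable def conv3 (a b c : ℝ → ℝ≥0∞) (ξ : ℝ) : ℝ≥0∞ :=
  ∫⁻ z : ℝ × ℝ, a z.1 * b z.2 * c (ξ - z.1 - z.2)

section conv3

variable {a b c : ℝ → ℝ≥0∞}

theorem conv3_comm_right (ha : Measurable a) (hb : Measurable b) (hc : Measurable c) (ξ : ℝ) :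
    conv3 a b c ξ = conv3 a c b ξ := by
  unfold conv3
  rw [Measure.volume_eq_prod, lintegral_prod _ (by fun_prop), lintegral_prod _ (by fun_prop)]
  refine lintegral_congr fun x => ?_
  rw [← lintegral_sub_left_eq_self _ (ξ - x)]
  refine lintegral_congr fun y => ?_
  simp only [sub_sub_cancel]
  ring

theorem conv3_comm_left (ha : Measurable a) (hb : Measurable b) (hc : Measurable c) (ξ : ℝ) :
    conv3 a b c ξ = conv3 b a c ξ := by
  unfold conv3
  rw [Measure.volume_eq_prod, lintegral_prod _ (by fun_prop), lintegral_prod_symm _ (by fun_prop)]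
  refine lintegral_congr fun x => lintegral_congr fun y => ?_
  simp only
  rw [mul_comm (a x), sub_right_comm]

/-- Young's inequality `‖a * b * c‖_{L²} ≤ ‖a‖_{L¹} ‖b‖_{L¹} ‖c‖_{L²}`. -/
theorem lintegral_conv3_sq_le (ha : Measurable a) (hb : Measurable b) (hc : Measurable c) :
    ∫⁻ ξ, conv3 a b c ξ ^ 2 ≤ (∫⁻ x, a x) ^ 2 * (∫⁻ x, b x) ^ 2 * ∫⁻ x, c x ^ 2 := by
  have hF : ∫⁻ z : ℝ × ℝ, a z.1 * b z.2 = (∫⁻ x, a x) * ∫⁻ x, b x := by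
    rw [Measure.volume_eq_prod, lintegral_prod_mul ha.aemeasurable hb.aemeasurable]
  have hpt : ∀ ξ, conv3 a b c ξ ^ 2 ≤ ((∫⁻ x, a x) * ∫⁻ x, b x) *
      ∫⁻ z : ℝ × ℝ, a z.1 * b z.2 * c (ξ - z.1 - z.2) ^ 2 := by
    intro ξ
    have h := lintegral_mul_sq_le (μ := (volume : Measure (ℝ × ℝ)))
      (f := fun z => (a z.1 * b z.2) ^ (1 / 2 : ℝ))
      (g := fun z => (a z.1 * b z.2) ^ (1 / 2 : ℝ) * c (ξ - z.1 - z.2))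
      (by fun_prop) (by fun_prop)
    have e0 : ∀ r : ℝ≥0∞, r ^ (1 / 2 : ℝ) * r ^ (1 / 2 : ℝ) = r := by
      intro r
      rw [← ENNReal.rpow_add_of_nonneg _ _ (by norm_num) (by norm_num)]
      norm_num
    simp only [mul_pow, ← mul_assoc, e0] at h
    simp only [sq ((_ : ℝ≥0∞) ^ (1 / 2 : ℝ)), e0] at h
    rw [← hF]
    exact h
  calc ∫⁻ ξ, conv3 a b c ξ ^ 2
      ≤ ∫⁻ ξ, ((∫⁻ x, a x) * ∫⁻ x, b x) *
          ∫⁻ z : ℝ × ℝ, a z.1 * b z.2 * c (ξ - z.1 - z.2) ^ 2 := lintegral_mono hpt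
    _ = ((∫⁻ x, a x) * ∫⁻ x, b x) *
          ∫⁻ ξ, ∫⁻ z : ℝ × ℝ, a z.1 * b z.2 * c (ξ - z.1 - z.2) ^ 2 := by
        rw [lintegral_const_mul]
        exact Measurable.lintegral_prod_right' (f := fun p : ℝ × (ℝ × ℝ) =>
          a p.2.1 * b p.2.2 * c (p.1 - p.2.1 - p.2.2) ^ 2) (by fun_prop)
    _ = ((∫⁻ x, a x) * ∫⁻ x, b x) *
          ∫⁻ z : ℝ × ℝ, ∫⁻ ξ, a z.1 * b z.2 * c (ξ - z.1 - z.2) ^ 2 := by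
        rw [lintegral_lintegral_swap]
        exact Measurable.aemeasurable (f := fun p : ℝ × (ℝ × ℝ) =>
          a p.2.1 * b p.2.2 * c (p.1 - p.2.1 - p.2.2) ^ 2) (by fun_prop)
    _ = ((∫⁻ x, a x) * ∫⁻ x, b x) * ∫⁻ z : ℝ × ℝ, a z.1 * b z.2 * ∫⁻ x, c x ^ 2 := by
        congr 1
        refine lintegral_congr fun z => ?_
        rw [lintegral_const_mul _ (by fun_prop)]
        congr 1
        simp only [sub_sub]
        exact lintegral_sub_right_eq_self (fun x => c x ^ 2) (z.1 + z.2)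
    _ = _ := by
        rw [lintegral_mul_const _ (by fun_prop), hF]
        ring

end conv3

/-- `ξ ↦ ∫ κ(ξ, ξ₁, ξ₂) A(ξ₁) B(ξ₂) C(ξ - ξ₁ - ξ₂) dξ₁ dξ₂`. -/
noncomputable def kernelOp (κ : ℝ → ℝ → ℝ → ℂ) (A B C : ℝ → ℂ) (ξ : ℝ) : ℂ :=
  ∫ z : ℝ × ℝ, κ ξ z.1 z.2 * (A z.1 * B z.2 * C (ξ - z.1 - z.2))

/-- Joint measurability of a kernel of three variables. -/
def MeasKernel (κ : ℝ → ℝ → ℝ → ℂ) : Prop :=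
  Measurable fun p : ℝ × (ℝ × ℝ) => κ p.1 p.2.1 p.2.2

section kernelOp

variable {κ κ' : ℝ → ℝ → ℝ → ℂ} {A B C A' B' C' : ℝ → ℂ} {q : ℕ} {k α β γ : ℝ}

theorem measurable_kernelOp_integrand (hκ : MeasKernel κ) (hA : Measurable A) (hB : Measurable B)
    (hC : Measurable C) : Measurable fun p : ℝ × (ℝ × ℝ) =>
      κ p.1 p.2.1 p.2.2 * (A p.2.1 * B p.2.2 * C (p.1 - p.2.1 - p.2.2)) := by
  have := hκ
  unfold MeasKernel at this
  fun_prop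

theorem measurable_kernelOp (hκ : MeasKernel κ) (hA : Measurable A) (hB : Measurable B)
    (hC : Measurable C) : Measurable (kernelOp κ A B C) :=
  ((measurable_kernelOp_integrand hκ hA hB hC).stronglyMeasurable.integral_prod_right').measurable

/-- The basic `L²` estimate for the integral of the absolute values. -/
theorem lintegral_kernelOp_majorant (hq : 1 ≤ q) (hk : 0 ≤ k)
    (hle : ∀ ξ x y, ‖κ ξ x y‖ ≤ k * (wt x ^ q + wt y ^ q + wt (ξ - x - y) ^ q))
    (hA : FBound q A α) (hB : FBound q B β) (hC : FBound q C γ) :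
    ∫⁻ ξ, (∫⁻ z : ℝ × ℝ, ‖κ ξ z.1 z.2 * (A z.1 * B z.2 * C (ξ - z.1 - z.2))‖ₑ) ^ 2
      ≤ ENNReal.ofReal ((12 * k * α * β * γ) ^ 2) := by
  let a : ℝ → ℝ≥0∞ := fun ξ => ‖A ξ‖ₑ
  let b : ℝ → ℝ≥0∞ := fun ξ => ‖B ξ‖ₑ
  let c : ℝ → ℝ≥0∞ := fun ξ => ‖C ξ‖ₑ
  let w : (ℝ → ℝ≥0∞) → ℝ → ℝ≥0∞ := fun f ξ => ENNReal.ofReal (wt ξ ^ q) * f ξ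
  have ha : Measurable a := hA.meas.enorm
  have hb : Measurable b := hB.meas.enorm
  have hc : Measurable c := hC.meas.enorm
  have hwm : ∀ {f : ℝ → ℝ≥0∞}, Measurable f → Measurable (w f) := fun hf =>
    (ENNReal.measurable_ofReal.comp (continuous_wt.pow q).measurable).mul hf
  have h1 : ∀ {f : ℝ → ℂ} {r : ℝ}, FBound q f r → ∫⁻ ξ, ‖f ξ‖ₑ ≤ ENNReal.ofReal (2 * r) := by
    intro f r hf
    obtain ⟨hi, hle⟩ := hf.integrable hq
    rw [← ofReal_integral_norm_eq_lintegral_enorm hi]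
    exact ENNReal.ofReal_le_ofReal hle
  have h2 : ∀ {f : ℝ → ℂ} {r : ℝ}, FBound q f r →
      ∫⁻ ξ, w (fun ξ => ‖f ξ‖ₑ) ξ ^ 2 ≤ ENNReal.ofReal (r ^ 2) := by
    intro f r hf
    refine le_trans (le_of_eq ?_) hf.bound.lintegral_le
    refine lintegral_congr fun ξ => ?_
    simp only [w, enorm_mul]
    rw [← ofReal_norm (((wt ξ ^ q : ℝ) : ℂ)), Complex.norm_real,
      Real.norm_of_nonneg (pow_nonneg (wt_pos ξ).le _)]
  -- each of the three terms of the weight goes with one factor, which is then taken in `L²`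
  have hY : ∀ {f g h : ℝ → ℂ} {r s t : ℝ}, FBound q f r → FBound q g s → FBound q h t →
      ∫⁻ ξ, conv3 (fun ξ => ‖f ξ‖ₑ) (fun ξ => ‖g ξ‖ₑ) (w fun ξ => ‖h ξ‖ₑ) ξ ^ 2
        ≤ ENNReal.ofReal ((4 * (r * s * t)) ^ 2) := by
    intro f g h r s t hf hg hh
    refine (lintegral_conv3_sq_le hf.meas.enorm hg.meas.enorm (hwm hh.meas.enorm)).trans ?_
    have e : (4 * (r * s * t)) ^ 2 = (2 * r) ^ 2 * (2 * s) ^ 2 * t ^ 2 := by ring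
    rw [e, ENNReal.ofReal_mul (by positivity), ENNReal.ofReal_mul (by positivity),
      ENNReal.ofReal_pow (by linarith [hf.nonneg]), ENNReal.ofReal_pow (by linarith [hg.nonneg])]
    gcongr
    · exact h1 hf
    · exact h1 hg
    · exact h2 hh
  have hpt : ∀ ξ, (∫⁻ z : ℝ × ℝ, ‖κ ξ z.1 z.2 * (A z.1 * B z.2 * C (ξ - z.1 - z.2))‖ₑ) ≤
      ENNReal.ofReal k * (conv3 b c (w a) ξ + conv3 a c (w b) ξ + conv3 a b (w c) ξ) := by
    intro ξ
    have e1 : conv3 b c (w a) ξ = conv3 (w a) b c ξ := by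
      rw [conv3_comm_right hb hc (hwm ha), conv3_comm_left hb (hwm ha) hc]
    have e2 : conv3 a c (w b) ξ = conv3 a (w b) c ξ := conv3_comm_right ha hc (hwm hb) ξ
    have := hwm ha
    have := hwm hb
    have := hwm hc
    rw [e1, e2]
    unfold conv3
    rw [← lintegral_add_left (by fun_prop), ← lintegral_add_left (by fun_prop),
      ← lintegral_const_mul _ (by fun_prop)]
    refine lintegral_mono fun z => ?_
    have hk2 : ‖κ ξ z.1 z.2‖ₑ ≤ ENNReal.ofReal k * (ENNReal.ofReal (wt z.1 ^ q) +
        ENNReal.ofReal (wt z.2 ^ q) + ENNReal.ofReal (wt (ξ - z.1 - z.2) ^ q)) := by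
      have p1 := pow_nonneg (wt_pos z.1).le q
      have p2 := pow_nonneg (wt_pos z.2).le q
      have p3 := pow_nonneg (wt_pos (ξ - z.1 - z.2)).le q
      rw [← ofReal_norm, ← ENNReal.ofReal_add p1 p2, ← ENNReal.ofReal_add (add_nonneg p1 p2) p3,
        ← ENNReal.ofReal_mul hk]
      exact ENNReal.ofReal_le_ofReal (hle ξ z.1 z.2)
    simp only [enorm_mul]
    refine (mul_le_mul_left hk2 _).trans_eq ?_
    simp only [w, a, b, c]
    ring
  have hsq : ∀ x y z : ℝ≥0∞, (x + y + z) ^ 2 ≤ 3 * (x ^ 2 + y ^ 2 + z ^ 2) := by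
    intro x y z
    induction x using ENNReal.recTopCoe with
    | top => simp
    | coe x =>
      induction y using ENNReal.recTopCoe with
      | top => simp
      | coe y =>
        induction z using ENNReal.recTopCoe with
        | top => simp
        | coe z =>
          norm_cast
          rw [← NNReal.coe_le_coe]
          push_cast
          nlinarith [sq_nonneg ((x : ℝ) - y), sq_nonneg ((y : ℝ) - z), sq_nonneg ((x : ℝ) - z)]
  calc _ ≤ ∫⁻ ξ, ENNReal.ofReal k ^ 2 * (3 * (conv3 b c (w a) ξ ^ 2 + conv3 a c (w b) ξ ^ 2 +
            conv3 a b (w c) ξ ^ 2)) := by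
        refine lintegral_mono fun ξ => (pow_le_pow_left' (hpt ξ) 2).trans ?_
        rw [mul_pow]
        gcongr
        exact hsq _ _ _
    _ = ENNReal.ofReal k ^ 2 * (3 * ((∫⁻ ξ, conv3 b c (w a) ξ ^ 2) +
          (∫⁻ ξ, conv3 a c (w b) ξ ^ 2) + ∫⁻ ξ, conv3 a b (w c) ξ ^ 2)) := by
        have hm : ∀ {f g h : ℝ → ℝ≥0∞}, Measurable f → Measurable g → Measurable h →
            Measurable (conv3 f g h) := fun {f g h} hf hg hh =>
          Measurable.lintegral_prod_right' (f := fun p : ℝ × (ℝ × ℝ) =>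
            f p.2.1 * g p.2.2 * h (p.1 - p.2.1 - p.2.2)) (by fun_prop)
        have m1 := hm hb hc (hwm ha)
        have m2 := hm ha hc (hwm hb)
        have m3 := hm ha hb (hwm hc)
        rw [lintegral_const_mul _ (by fun_prop), lintegral_const_mul _ (by fun_prop),
          lintegral_add_left (by fun_prop), lintegral_add_left (by fun_prop)]
    _ ≤ ENNReal.ofReal k ^ 2 * (3 * (ENNReal.ofReal ((4 * (β * γ * α)) ^ 2) +
          ENNReal.ofReal ((4 * (α * γ * β)) ^ 2) + ENNReal.ofReal ((4 * (α * β * γ)) ^ 2))) := by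
        gcongr
        · exact hY hB hC hA
        · exact hY hA hC hB
        · exact hY hA hB hC
    _ = _ := by
        rw [← ENNReal.ofReal_pow hk, ← ENNReal.ofReal_add (sq_nonneg _) (sq_nonneg _),
          ← ENNReal.ofReal_add (by positivity) (sq_nonneg _),
          show (3 : ℝ≥0∞) = ENNReal.ofReal 3 by norm_num, ← ENNReal.ofReal_mul (by norm_num),
          ← ENNReal.ofReal_mul (by positivity)]
        congr 1; ring

theorem ae_integrable_kernelOp (hκ : MeasKernel κ) (hq : 1 ≤ q) (hk : 0 ≤ k)
    (hle : ∀ ξ x y, ‖κ ξ x y‖ ≤ k * (wt x ^ q + wt y ^ q + wt (ξ - x - y) ^ q))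
    (hA : FBound q A α) (hB : FBound q B β) (hC : FBound q C γ) :
    ∀ᵐ ξ, Integrable fun z : ℝ × ℝ => κ ξ z.1 z.2 * (A z.1 * B z.2 * C (ξ - z.1 - z.2)) := by
  have hm := measurable_kernelOp_integrand hκ hA.meas hB.meas hC.meas
  have h := lintegral_kernelOp_majorant hq hk hle hA hB hC
  have hm2 : Measurable fun ξ =>
      (∫⁻ z : ℝ × ℝ, ‖κ ξ z.1 z.2 * (A z.1 * B z.2 * C (ξ - z.1 - z.2))‖ₑ) ^ 2 :=
    (Measurable.lintegral_prod_right' hm.enorm).pow_const 2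
  filter_upwards [ae_lt_top hm2 (h.trans_lt ENNReal.ofReal_lt_top).ne] with ξ hξ
  refine ⟨(hm.comp (f := fun z : ℝ × ℝ => (ξ, z)) (by fun_prop)).aestronglyMeasurable, ?_⟩
  rw [hasFiniteIntegral_iff_enorm]
  exact (ENNReal.pow_lt_top_iff.1 hξ).resolve_right two_ne_zero

/-- A trilinear estimate: a kernel bounded by the sum of the weights of the three frequencies is
compensated by weights on the three factors. -/
theorem l2Bound_kernelOp (hκ : MeasKernel κ) (hq : 1 ≤ q) (hk : 0 ≤ k)
    (hle : ∀ ξ x y, ‖κ ξ x y‖ ≤ k * (wt x ^ q + wt y ^ q + wt (ξ - x - y) ^ q))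
    (hA : FBound q A α) (hB : FBound q B β) (hC : FBound q C γ) :
    L2Bound (kernelOp κ A B C) (12 * k * α * β * γ) := by
  have := hA.nonneg
  have := hB.nonneg
  have := hC.nonneg
  refine L2Bound.of_lintegral_le (by positivity)
    (measurable_kernelOp hκ hA.meas hB.meas hC.meas).aestronglyMeasurable
    (le_trans (lintegral_mono fun ξ => ?_) (lintegral_kernelOp_majorant hq hk hle hA hB hC))
  exact pow_le_pow_left' (enorm_integral_le_lintegral_enorm _) 2

/-- The `H^q` version of the trilinear estimate, for bounded kernels. -/
theorem fBound_kernelOp (hκ : MeasKernel κ) (hq : 1 ≤ q) (hle : ∀ ξ x y, ‖κ ξ x y‖ ≤ 1)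
    (hA : FBound q A α) (hB : FBound q B β) (hC : FBound q C γ) :
    FBound q (kernelOp κ A B C) (12 * 3 ^ q * α * β * γ) := by
  refine ⟨measurable_kernelOp hκ hA.meas hB.meas hC.meas, ?_⟩
  have hκ2 : MeasKernel fun ξ x y => ((wt ξ ^ q : ℝ) : ℂ) * κ ξ x y := by
    have h1 := (Complex.continuous_ofReal.comp (continuous_wt.pow q)).measurable
    exact (h1.comp measurable_fst).mul hκ
  have := l2Bound_kernelOp (k := 3 ^ q) hκ2 hq (by positivity) (fun ξ x y => ?_) hA hB hC
  · refine this.congr_ae (.of_forall fun ξ => ?_)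
    simp only [kernelOp, mul_assoc, integral_const_mul]
  · rw [norm_mul, Complex.norm_real, Real.norm_of_nonneg (pow_nonneg (wt_pos ξ).le _)]
    refine (mul_le_of_le_one_right (pow_nonneg (wt_pos ξ).le _) (hle ξ x y)).trans ?_
    have h1 : wt ξ ≤ wt x + wt y + wt (ξ - x - y) := by
      have := abs_add_three x y (ξ - x - y)
      have e : x + y + (ξ - x - y) = ξ := by ring
      rw [e] at this
      simp only [wt]; linarith
    have hmax : wt ξ ≤ 3 * max (max (wt x) (wt y)) (wt (ξ - x - y)) := by
      have := le_max_left (max (wt x) (wt y)) (wt (ξ - x - y))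
      have := le_max_right (max (wt x) (wt y)) (wt (ξ - x - y))
      have := le_max_left (wt x) (wt y)
      have := le_max_right (wt x) (wt y)
      linarith
    refine (pow_le_pow_left₀ (wt_pos ξ).le hmax q).trans ?_
    rw [mul_pow]
    gcongr
    have p1 := pow_nonneg (wt_pos x).le q
    have p2 := pow_nonneg (wt_pos y).le q
    have p3 := pow_nonneg (wt_pos (ξ - x - y)).le q
    rcases max_choice (max (wt x) (wt y)) (wt (ξ - x - y)) with h | h
    · rw [h]
      rcases max_choice (wt x) (wt y) with h | h <;> rw [h] <;> linarith
    · rw [h]; linarith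

theorem kernelOp_sub_kernel (h1 : ∀ᵐ ξ, Integrable fun z : ℝ × ℝ =>
      κ ξ z.1 z.2 * (A z.1 * B z.2 * C (ξ - z.1 - z.2)))
    (h2 : ∀ᵐ ξ, Integrable fun z : ℝ × ℝ =>
      κ' ξ z.1 z.2 * (A z.1 * B z.2 * C (ξ - z.1 - z.2))) :
    (fun ξ => kernelOp κ A B C ξ - kernelOp κ' A B C ξ) =ᵐ[volume]
      kernelOp (fun ξ x y => κ ξ x y - κ' ξ x y) A B C := by
  filter_upwards [h1, h2] with ξ i1 i2
  rw [kernelOp, kernelOp, ← integral_sub i1 i2]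
  refine integral_congr_ae (.of_forall fun z => ?_)
  simp only; ring

/-- Lipschitz dependence of the trilinear expression on its arguments. -/
theorem l2Bound_kernelOp_sub {d R : ℝ} (hκ : MeasKernel κ) (hq : 1 ≤ q) (hk : 0 ≤ k)
    (hle : ∀ ξ x y, ‖κ ξ x y‖ ≤ k * (wt x ^ q + wt y ^ q + wt (ξ - x - y) ^ q))
    (hA : FBound q A R) (hB : FBound q B R) (hC : FBound q C R)
    (hA' : FBound q A' R) (hB' : FBound q B' R) (hC' : FBound q C' R)
    (dA : FBound q (fun ξ => A ξ - A' ξ) d) (dB : FBound q (fun ξ => B ξ - B' ξ) d)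
    (dC : FBound q (fun ξ => C ξ - C' ξ) d) :
    L2Bound (fun ξ => kernelOp κ A B C ξ - kernelOp κ A' B' C' ξ) (36 * k * R ^ 2 * d) := by
  have s1 := l2Bound_kernelOp hκ hq hk hle dA hB hC
  have s2 := l2Bound_kernelOp hκ hq hk hle hA' dB hC
  have s3 := l2Bound_kernelOp hκ hq hk hle hA' hB' dC
  refine (((s1.add s2).add s3).congr_ae ?_).mono (le_of_eq (by ring))
  filter_upwards [ae_integrable_kernelOp hκ hq hk hle dA hB hC,
    ae_integrable_kernelOp hκ hq hk hle hA' dB hC,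
    ae_integrable_kernelOp hκ hq hk hle hA' hB' dC,
    ae_integrable_kernelOp hκ hq hk hle hA hB hC,
    ae_integrable_kernelOp hκ hq hk hle hA' hB' hC'] with ξ i1 i2 i3 i4 i5
  have i12 := i1.add i2
  simp only [Pi.add_def] at i12
  simp only [kernelOp]
  rw [← integral_add i1 i2, ← integral_add i12 i3, ← integral_sub i4 i5]
  refine integral_congr_ae (.of_forall fun z => ?_)
  simp only; ring

theorem norm_one_le_wt (ξ x y : ℝ) :
    ‖(1 : ℂ)‖ ≤ 1 * (wt x ^ 1 + wt y ^ 1 + wt (ξ - x - y) ^ 1) := by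
  have := one_le_wt x
  have := wt_pos y
  have := wt_pos (ξ - x - y)
  simp only [norm_one, pow_one, one_mul]; linarith

/-- The convolution theorem: on the Fourier side a product of three functions is the threefold
convolution. -/
theorem fourierInv_kernelOp_one (hA : FBound 1 A α) (hB : FBound 1 B β) (hC : FBound 1 C γ) :
    Integrable (kernelOp (fun _ _ _ => 1) A B C) ∧
      ∀ x, 𝓕⁻ (kernelOp (fun _ _ _ => 1) A B C) x = 𝓕⁻ A x * 𝓕⁻ B x * 𝓕⁻ C x := by
  have iA := (hA.integrable le_rfl).1
  have iB := (hB.integrable le_rfl).1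
  have iC := (hC.integrable le_rfl).1
  have hle := norm_one_le_wt
  have e : kernelOp (fun _ _ _ => 1) A B C =ᵐ[volume]
      convolution A (convolution B C (ContinuousLinearMap.mul ℂ ℂ) volume)
        (ContinuousLinearMap.mul ℂ ℂ) volume := by
    filter_upwards [ae_integrable_kernelOp (κ := fun _ _ _ => 1) measurable_const le_rfl
      zero_le_one hle hA hB hC] with ξ hξ
    rw [kernelOp, Measure.volume_eq_prod, integral_prod _ (by
      rw [← Measure.volume_eq_prod]; simpa using hξ)]
    refine integral_congr_ae (.of_forall fun x => ?_)
    simp only [convolution, ContinuousLinearMap.mul_apply', one_mul, mul_assoc, integral_const_mul]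
  have iBC := iB.integrable_convolution (ContinuousLinearMap.mul ℂ ℂ) iC
  refine ⟨(iA.integrable_convolution (ContinuousLinearMap.mul ℂ ℂ) iBC).congr e.symm, fun x => ?_⟩
  rw [Real.fourierInv_congr_ae e, Real.fourierInv_eq_fourier_neg,
    Real.fourier_mul_convolution_eq iA iBC, Real.fourier_mul_convolution_eq iB iC,
    ← Real.fourierInv_eq_fourier_neg, ← Real.fourierInv_eq_fourier_neg,
    ← Real.fourierInv_eq_fourier_neg, mul_assoc]

end kernelOp

theorem fourierInv_refl (B : ℝ → ℂ) (x : ℝ) : 𝓕⁻ (refl B) x = conj (𝓕⁻ B x) := by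
  rw [Real.fourierInv_eq', Real.fourierInv_eq', ← integral_conj, ← integral_neg_eq_self]
  refine integral_congr_ae (.of_forall fun ξ => ?_)
  simp only [refl, neg_neg, smul_eq_mul, map_mul, ← Complex.exp_conj]
  congr 2
  simp [Complex.conj_ofReal, map_ofNat]

/-- The trilinear product `f ḡ h` in terms of the Fourier transforms `A`, `B`, `C`. -/
theorem fhat_mul_conj_mul {A B C : ℝ → ℂ} {α β γ : ℝ} (hA : FBound 1 A α) (hB : FBound 1 B β)
    (hC : FBound 1 C γ) {f g h : ℝ → ℂ} (hf : f =ᵐ[volume] finv A) (hg : g =ᵐ[volume] finv B)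
    (hh : h =ᵐ[volume] finv C) :
    MemLp (fun x => f x * conj (g x) * h x) 2 volume ∧
    fhat (fun x => f x * conj (g x) * h x) =ᵐ[volume] kernelOp (fun _ _ _ => 1) A (refl B) C := by
  have hle := norm_one_le_wt
  obtain ⟨hi, he⟩ := fourierInv_kernelOp_one hA hB.refl hC
  have h2 := (l2Bound_kernelOp (κ := fun _ _ _ => 1) measurable_const le_rfl zero_le_one hle hA
    hB.refl hC).memLp
  have key : (fun x => f x * conj (g x) * h x) =ᵐ[volume]
      finv (kernelOp (fun _ _ _ => 1) A (refl B) C) := by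
    filter_upwards [hf, hg, hh, finv_eq_fourierInv hi h2,
      finv_eq_fourierInv (hA.integrable le_rfl).1 hA.l2Bound.memLp,
      finv_eq_fourierInv (hB.integrable le_rfl).1 hB.l2Bound.memLp,
      finv_eq_fourierInv (hC.integrable le_rfl).1 hC.l2Bound.memLp] with x e1 e2 e3 e4 e5 e6 e7
    rw [e1, e2, e3, e4, e5, e6, e7, he, fourierInv_refl]
  refine ⟨(memLp_congr_ae key).2 (memLp_finv _), ?_⟩
  rw [fhat_congr key]
  exact fhat_finv h2

/-! ### The resonance phase of the twisted equation -/

theorem norm_freeSymbol (t ξ : ℝ) : ‖freeSymbol t ξ‖ = 1 := by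
  rw [freeSymbol, ← mul_neg, ← Complex.ofReal_neg, mul_comm, Complex.norm_exp_ofReal_mul_I]

theorem continuous_freeSymbol (t : ℝ) : Continuous (freeSymbol t) := by
  unfold freeSymbol; fun_prop

theorem freeSymbol_add (s t ξ : ℝ) : freeSymbol (s + t) ξ = freeSymbol s ξ * freeSymbol t ξ := by
  rw [freeSymbol, freeSymbol, freeSymbol, ← Complex.exp_add]
  congr 1; push_cast; ring

theorem freeSymbol_zero (ξ : ℝ) : freeSymbol 0 ξ = 1 := by simp [freeSymbol]

theorem freeSymbol_neg_mul_self (t ξ : ℝ) : freeSymbol (-t) ξ * freeSymbol t ξ = 1 := by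
  rw [← freeSymbol_add, neg_add_cancel, freeSymbol_zero]

theorem freeSymbol_mul_neg_self (t ξ : ℝ) : freeSymbol t ξ * freeSymbol (-t) ξ = 1 := by
  rw [mul_comm, freeSymbol_neg_mul_self]

/-- The phase `ξ² - ξ₁² + ξ₂² - ξ₃²`, with `ξ₃ = ξ - ξ₁ - ξ₂`, each frequency multiplied by `2π`. -/
noncomputable def phase (ξ x y : ℝ) : ℝ :=
  (2 * Real.pi) ^ 2 * (ξ ^ 2 - x ^ 2 + y ^ 2 - (ξ - x - y) ^ 2)

/-- The oscillating kernel `e^{isφ}`. -/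
noncomputable def osc (s ξ x y : ℝ) : ℂ := Complex.exp (Complex.I * ((s * phase ξ x y : ℝ) : ℂ))

/-- The derivative `iφe^{isφ}` of the oscillating kernel with respect to `s`. -/
noncomputable def osc' (s ξ x y : ℝ) : ℂ := Complex.I * (phase ξ x y : ℂ) * osc s ξ x y

theorem norm_osc (s ξ x y : ℝ) : ‖osc s ξ x y‖ = 1 := by
  rw [osc, mul_comm, Complex.norm_exp_ofReal_mul_I]

theorem measKernel_osc (s : ℝ) : MeasKernel (osc s) := by
  unfold MeasKernel osc phase; fun_prop

theorem measKernel_osc' (s : ℝ) : MeasKernel (osc' s) := by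
  unfold MeasKernel osc' osc phase; fun_prop

theorem abs_phase_le (ξ x y : ℝ) :
    |phase ξ x y| ≤ 160 * (wt x ^ 2 + wt y ^ 2 + wt (ξ - x - y) ^ 2) := by
  have hw : ∀ r : ℝ, r ^ 2 ≤ wt r ^ 2 := by
    intro r
    rw [wt, ← sq_abs r]
    nlinarith [abs_nonneg r]
  have h1 := hw x
  have h2 := hw y
  have h3 := hw (ξ - x - y)
  have hpi : (2 * Real.pi) ^ 2 ≤ 40 := by nlinarith [Real.pi_lt_d2, Real.pi_pos]
  have hξ : ξ ^ 2 ≤ 3 * (x ^ 2 + y ^ 2 + (ξ - x - y) ^ 2) := by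
    nlinarith [sq_nonneg (x - y), sq_nonneg (x - (ξ - x - y)), sq_nonneg (y - (ξ - x - y))]
  have h4 : |ξ ^ 2 - x ^ 2 + y ^ 2 - (ξ - x - y) ^ 2| ≤
      4 * (wt x ^ 2 + wt y ^ 2 + wt (ξ - x - y) ^ 2) := by
    rw [abs_le]
    constructor <;> nlinarith [sq_nonneg ξ, sq_nonneg x, sq_nonneg y, sq_nonneg (ξ - x - y)]
  rw [phase, abs_mul, abs_of_nonneg (sq_nonneg _)]
  have := mul_le_mul hpi h4 (abs_nonneg _) (by norm_num)
  linarith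

theorem phase_sq_le (ξ x y : ℝ) :
    phase ξ x y ^ 2 ≤ 76800 * (wt x ^ 4 + wt y ^ 4 + wt (ξ - x - y) ^ 4) := by
  have h := abs_phase_le ξ x y
  have h2 := pow_le_pow_left₀ (abs_nonneg _) h 2
  rw [sq_abs] at h2
  refine h2.trans ?_
  nlinarith [sq_nonneg (wt x ^ 2 - wt y ^ 2), sq_nonneg (wt x ^ 2 - wt (ξ - x - y) ^ 2),
    sq_nonneg (wt y ^ 2 - wt (ξ - x - y) ^ 2)]

theorem norm_osc'_le (s ξ x y : ℝ) :
    ‖osc' s ξ x y‖ ≤ 160 * (wt x ^ 2 + wt y ^ 2 + wt (ξ - x - y) ^ 2) := by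
  rw [osc', norm_mul, norm_mul, norm_osc, Complex.norm_I, Complex.norm_real, one_mul, mul_one]
  exact abs_phase_le ξ x y

theorem osc_eq (s m ξ x y : ℝ) : osc s ξ x y =
    osc m ξ x y * Complex.exp (Complex.I * (((s - m) * phase ξ x y : ℝ) : ℂ)) := by
  rw [osc, osc, ← Complex.exp_add]
  congr 1; push_cast; ring

theorem norm_osc_sub_le (s m ξ x y : ℝ) : ‖osc s ξ x y - osc m ξ x y‖ ≤
    (160 * |s - m|) * (wt x ^ 2 + wt y ^ 2 + wt (ξ - x - y) ^ 2) := by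
  rw [osc_eq s m]
  have h := Real.norm_exp_I_mul_ofReal_sub_one_le (x := (s - m) * phase ξ x y)
  have e : ∀ a b : ℂ, a * b - a = a * (b - 1) := fun a b => by ring
  rw [e, norm_mul, norm_osc, one_mul]
  refine h.trans ?_
  rw [Real.norm_eq_abs, abs_mul]
  nlinarith [mul_le_mul_of_nonneg_left (abs_phase_le ξ x y) (abs_nonneg (s - m))]

theorem norm_exp_I_mul_sub_one_sub_le (r : ℝ) :
    ‖Complex.exp (Complex.I * r) - 1 - Complex.I * r‖ ≤ 2 * r ^ 2 := by
  have hn : ‖Complex.I * (r : ℂ)‖ = |r| := by simp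
  rcases le_or_gt |r| 1 with h | h
  · have := Complex.norm_exp_sub_one_sub_id_le (x := Complex.I * r) (by rw [hn]; exact h)
    rw [hn, sq_abs] at this
    nlinarith [sq_nonneg r]
  · have h1 := Real.norm_exp_I_mul_ofReal_sub_one_le (x := r)
    have h2 := norm_sub_le (Complex.exp (Complex.I * r) - 1) (Complex.I * r)
    rw [hn] at h2
    rw [Real.norm_eq_abs] at h1
    rw [← sq_abs r]
    nlinarith

theorem norm_osc_sub_sub_le (s m ξ x y : ℝ) :
    ‖osc s ξ x y - osc m ξ x y - (s - m : ℝ) * osc' m ξ x y‖ ≤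
    (153600 * |s - m| ^ 2) * (wt x ^ 4 + wt y ^ 4 + wt (ξ - x - y) ^ 4) := by
  rw [osc_eq s m]
  have h := norm_exp_I_mul_sub_one_sub_le ((s - m) * phase ξ x y)
  have e : osc m ξ x y * Complex.exp (Complex.I * (((s - m) * phase ξ x y : ℝ) : ℂ)) - osc m ξ x y -
      (s - m : ℝ) * osc' m ξ x y = osc m ξ x y *
      (Complex.exp (Complex.I * (((s - m) * phase ξ x y : ℝ) : ℂ)) - 1 -
        Complex.I * (((s - m) * phase ξ x y : ℝ) : ℂ)) := by
    rw [osc']; push_cast; ring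
  rw [e, norm_mul, norm_osc, one_mul]
  refine h.trans ?_
  rw [mul_pow, sq_abs]
  nlinarith [mul_le_mul_of_nonneg_left (phase_sq_le ξ x y) (sq_nonneg (s - m))]

/-- The free flow turns the plain convolution into the one with oscillating kernel. -/
theorem kernelOp_one_freeSymbol (s : ℝ) (A B C : ℝ → ℂ) (ξ : ℝ) :
    kernelOp (fun _ _ _ => 1) (fun ξ => freeSymbol s ξ * A ξ)
      (refl fun ξ => freeSymbol s ξ * B ξ) (fun ξ => freeSymbol s ξ * C ξ) ξ =
    freeSymbol s ξ * kernelOp (osc s) A (refl B) C ξ := by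
  rw [kernelOp, kernelOp, ← integral_const_mul]
  refine integral_congr_ae (.of_forall fun z => ?_)
  have h : conj (freeSymbol s (-z.2)) = freeSymbol (-s) z.2 := by
    rw [freeSymbol, freeSymbol, ← Complex.exp_conj]
    congr 1
    simp only [map_neg, map_mul, Complex.conj_I, Complex.conj_ofReal]
    push_cast; ring
  have h2 : freeSymbol s z.1 * freeSymbol (-s) z.2 * freeSymbol s (ξ - z.1 - z.2) =
      freeSymbol s ξ * osc s ξ z.1 z.2 := by
    simp only [freeSymbol, osc, phase, ← Complex.exp_add]
    congr 1; push_cast; ring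
  simp only [refl, map_mul, h]
  linear_combination (A z.1 * conj (B (-z.2)) * C (ξ - z.1 - z.2)) * h2

end DNLS

namespace DNLS

/-! ### The nonlinear flow, pointwise -/

/-- The first component of the nonlinear flow at a point; the second one is `nlFlow (-δ) s q p`. -/
noncomputable def nlFlow (δ s : ℝ) (p q : ℂ) : ℂ := Complex.exp (-(2 * δ * s * (p * conj q))) * p

theorem nonlinearFlow_snd (δ s : ℝ) (w : (ℝ → ℂ) × (ℝ → ℂ)) (x : ℝ) :
    (nonlinearFlow δ s w).2 x = nlFlow (-δ) s (w.2 x) (w.1 x) := by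
  simp only [nonlinearFlow, nlFlow]
  congr 2; push_cast; ring

/-- A growth constant of the nonlinear flow on the ball of radius `R`, for times at most `2`. -/
noncomputable def growth (δ R : ℝ) : ℝ := Real.exp (12 * |δ| * R ^ 2)

theorem growth_pos (δ R : ℝ) : 0 < growth δ R := Real.exp_pos _

theorem one_le_growth (δ R : ℝ) : 1 ≤ growth δ R := Real.one_le_exp (by positivity)

theorem growth_neg (δ R : ℝ) : growth (-δ) R = growth δ R := by simp [growth]

theorem norm_exp_sub_exp_le {a b : ℂ} {k : ℝ} (ha : ‖a‖ ≤ k) (hb : ‖b‖ ≤ k) :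
    ‖Complex.exp a - Complex.exp b‖ ≤ Real.exp (3 * k) * ‖a - b‖ := by
  have h1 : ‖Complex.exp (a - b) - 1‖ ≤ ‖a - b‖ * Real.exp (2 * k) := by
    have := Complex.norm_exp_sub_sum_le_norm_mul_exp (a - b) 1
    simp only [Finset.range_one, Finset.sum_singleton, pow_zero, Nat.factorial_zero, Nat.cast_one,
      div_one, pow_one] at this
    refine this.trans ?_
    gcongr
    linarith [norm_sub_le a b]
  have h2 : ‖Complex.exp b‖ ≤ Real.exp k := (Complex.norm_exp_le_exp_norm b).trans (by gcongr)
  have e : Complex.exp a - Complex.exp b = Complex.exp b * (Complex.exp (a - b) - 1) := by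
    rw [mul_sub, ← Complex.exp_add, mul_one]; congr 2; ring
  rw [e, norm_mul]
  calc _ ≤ Real.exp k * (‖a - b‖ * Real.exp (2 * k)) := by gcongr
    _ = _ := by
        rw [show 3 * k = k + 2 * k by ring, Real.exp_add]; ring

section pointwise

variable {δ s R : ℝ} {p q p' q' : ℂ}

theorem norm_exponent_le (hs : |s| ≤ 2) (hp : ‖p‖ ≤ R) (hq : ‖q‖ ≤ R) :
    ‖-(2 * δ * s * (p * conj q))‖ ≤ 4 * |δ| * R ^ 2 := by
  have hR : 0 ≤ R := (norm_nonneg p).trans hp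
  simp only [norm_neg, norm_mul, Complex.norm_ofNat, Complex.norm_real, Real.norm_eq_abs,
    RCLike.norm_conj]
  have h1 : ‖p‖ * ‖q‖ ≤ R * R := mul_le_mul hp hq (norm_nonneg _) hR
  have h2 : |s| * (‖p‖ * ‖q‖) ≤ 2 * (R * R) := mul_le_mul hs h1 (by positivity) (by norm_num)
  nlinarith [mul_le_mul_of_nonneg_left h2 (abs_nonneg δ)]

theorem norm_exp_exponent_sub_le (hs : |s| ≤ 2) (hp : ‖p‖ ≤ R) (hq : ‖q‖ ≤ R) (hp' : ‖p'‖ ≤ R)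
    (hq' : ‖q'‖ ≤ R) :
    ‖Complex.exp (-(2 * δ * s * (p * conj q))) - Complex.exp (-(2 * δ * s * (p' * conj q')))‖ ≤
      2 * |δ| * growth δ R * |s| * ‖p * conj q - p' * conj q'‖ := by
  refine (norm_exp_sub_exp_le (norm_exponent_le hs hp hq) (norm_exponent_le hs hp' hq')).trans ?_
  have e : -(2 * (δ : ℂ) * s * (p * conj q)) - -(2 * δ * s * (p' * conj q')) =
      -(2 * δ * s) * (p * conj q - p' * conj q') := by ring
  rw [e, norm_mul, show 3 * (4 * |δ| * R ^ 2) = 12 * |δ| * R ^ 2 by ring, ← growth]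
  simp only [norm_neg, norm_mul, Complex.norm_ofNat, Complex.norm_real, Real.norm_eq_abs]
  apply le_of_eq; ring

theorem norm_exp_exponent_sub_one_le (hs : |s| ≤ 2) (hp : ‖p‖ ≤ R) (hq : ‖q‖ ≤ R) :
    ‖Complex.exp (-(2 * δ * s * (p * conj q))) - 1‖ ≤ 2 * |δ| * R ^ 2 * growth δ R * |s| := by
  have hR : 0 ≤ R := (norm_nonneg p).trans hp
  have h := norm_exp_exponent_sub_le (δ := δ) hs hp hq (p' := 0) (q' := 0) (by simpa) (by simpa)
  simp only [zero_mul, mul_zero, neg_zero, Complex.exp_zero, sub_zero, norm_mul,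
    RCLike.norm_conj] at h
  refine h.trans ?_
  have h1 : ‖p‖ * ‖q‖ ≤ R ^ 2 := by rw [sq]; exact mul_le_mul hp hq (norm_nonneg _) hR
  have := growth_pos δ R
  calc _ ≤ 2 * |δ| * growth δ R * |s| * R ^ 2 := by gcongr
    _ = _ := by ring

theorem norm_nlFlow_le (hs : |s| ≤ 2) (hp : ‖p‖ ≤ R) (hq : ‖q‖ ≤ R) :
    ‖nlFlow δ s p q‖ ≤ growth δ R * ‖p‖ := by
  rw [nlFlow, norm_mul]
  gcongr
  refine (Complex.norm_exp_le_exp_norm _).trans (Real.exp_le_exp.2 ?_)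
  refine (norm_exponent_le hs hp hq).trans ?_
  nlinarith [mul_nonneg (abs_nonneg δ) (sq_nonneg R)]

theorem norm_nlFlow_sub_self_le (hs : |s| ≤ 2) (hp : ‖p‖ ≤ R) (hq : ‖q‖ ≤ R) :
    ‖nlFlow δ s p q - p‖ ≤ (2 * |δ| * R ^ 2 * growth δ R * |s|) * ‖p‖ := by
  have e : nlFlow δ s p q - p = (Complex.exp (-(2 * δ * s * (p * conj q))) - 1) * p := by
    rw [nlFlow]; ring
  rw [e, norm_mul]
  gcongr
  exact norm_exp_exponent_sub_one_le hs hp hq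

/-- The nonlinear flow on a ball is Lipschitz with constant `1 + O(s)`. -/
theorem norm_nlFlow_sub_le (hs : |s| ≤ 2) (hp : ‖p‖ ≤ R) (hq : ‖q‖ ≤ R) (hp' : ‖p'‖ ≤ R)
    (hq' : ‖q'‖ ≤ R) :
    ‖nlFlow δ s p q - nlFlow δ s p' q'‖ ≤ (1 + 4 * |δ| * R ^ 2 * growth δ R * |s|) * ‖p - p'‖ +
      (4 * |δ| * R ^ 2 * growth δ R * |s|) * ‖q - q'‖ := by
  have hR : 0 ≤ R := (norm_nonneg p).trans hp
  have hG := growth_pos δ R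
  have e : nlFlow δ s p q - nlFlow δ s p' q' = (p - p') +
      (Complex.exp (-(2 * δ * s * (p * conj q))) - 1) * (p - p') +
      (Complex.exp (-(2 * δ * s * (p * conj q))) - Complex.exp (-(2 * δ * s * (p' * conj q')))) *
        p' := by
    rw [nlFlow, nlFlow]; ring
  have h1 := norm_exp_exponent_sub_one_le (δ := δ) hs hp hq
  have h2 := norm_exp_exponent_sub_le (δ := δ) hs hp hq hp' hq'
  have h3 : ‖p * conj q - p' * conj q'‖ ≤ R * (‖p - p'‖ + ‖q - q'‖) := by
    have e : p * conj q - p' * conj q' = (p - p') * conj q + p' * conj (q - q') := by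
      rw [map_sub]; ring
    rw [e]
    refine (norm_add_le _ _).trans ?_
    rw [norm_mul, norm_mul, RCLike.norm_conj, RCLike.norm_conj]
    nlinarith [mul_le_mul_of_nonneg_left hq (norm_nonneg (p - p')),
      mul_le_mul_of_nonneg_right hp' (norm_nonneg (q - q'))]
  have h4 : ‖Complex.exp (-(2 * δ * s * (p * conj q))) -
      Complex.exp (-(2 * δ * s * (p' * conj q')))‖ * ‖p'‖ ≤
      (2 * |δ| * growth δ R * |s| * (R * (‖p - p'‖ + ‖q - q'‖))) * R := by
    refine mul_le_mul (h2.trans ?_) hp' (norm_nonneg _) (by positivity)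
    gcongr
  rw [e]
  refine (norm_add_le _ _).trans ?_
  rw [norm_mul _ p']
  have h5 := norm_add_le (p - p') ((Complex.exp (-(2 * δ * s * (p * conj q))) - 1) * (p - p'))
  rw [norm_mul] at h5
  have h6 := mul_le_mul_of_nonneg_right h1 (norm_nonneg (p - p'))
  have h7 : 0 ≤ 2 * |δ| * R ^ 2 * growth δ R * |s| * ‖q - q'‖ := by positivity
  nlinarith

theorem hasDerivAt_nlFlow (δ s : ℝ) (p q : ℂ) : HasDerivAt (fun s => nlFlow δ s p q)
    (-2 * δ * (nlFlow δ s p q * conj (nlFlow (-δ) s q p) * nlFlow δ s p q)) s := by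
  have h1 : HasDerivAt (fun s : ℝ => -(2 * (δ : ℂ) * (s : ℂ) * (p * conj q)))
      (-(2 * (δ : ℂ) * 1 * (p * conj q))) s :=
    ((((hasDerivAt_id s).ofReal_comp).const_mul (2 * (δ : ℂ))).mul_const (p * conj q)).neg
  have h2 := h1.cexp.mul_const p
  refine h2.congr_deriv ?_
  have e : conj (nlFlow (-δ) s q p) = Complex.exp (2 * δ * s * (p * conj q)) * conj q := by
    rw [nlFlow, map_mul, ← Complex.exp_conj]
    congr 2
    simp only [map_neg, map_mul, Complex.conj_ofReal, map_ofNat, Complex.conj_conj]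
    push_cast; ring
  have e2 : Complex.exp (-(2 * δ * s * (p * conj q))) * Complex.exp (2 * δ * s * (p * conj q)) =
      1 := by
    rw [← Complex.exp_add]; simp
  rw [e]
  simp only [nlFlow]
  linear_combination (2 * δ * Complex.exp (-(2 * δ * s * (p * conj q))) * p * conj q * p) * e2

theorem norm_tri_sub_le (hp : ‖p‖ ≤ R) (hq : ‖q‖ ≤ R) (hp' : ‖p'‖ ≤ R) :
    ‖p * conj q * p - p' * conj q' * p'‖ ≤ 2 * R ^ 2 * ‖p - p'‖ + R ^ 2 * ‖q - q'‖ := by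
  have hR : 0 ≤ R := (norm_nonneg p).trans hp
  have e : p * conj q * p - p' * conj q' * p' = (p - p') * conj q * p + p' * conj q * (p - p') +
      p' * conj (q - q') * p' := by
    rw [map_sub]; ring
  rw [e]
  refine (norm_add₃_le).trans ?_
  simp only [norm_mul, RCLike.norm_conj]
  have h1 : ‖p - p'‖ * ‖q‖ * ‖p‖ ≤ ‖p - p'‖ * R * R := by gcongr
  have h2 : ‖p'‖ * ‖q‖ * ‖p - p'‖ ≤ R * R * ‖p - p'‖ := by gcongr
  have h3 : ‖p'‖ * ‖q - q'‖ * ‖p'‖ ≤ R * ‖q - q'‖ * R := by gcongr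
  nlinarith

theorem continuous_nlFlow (δ s : ℝ) : Continuous fun z : ℂ × ℂ => nlFlow δ s z.1 z.2 := by
  unfold nlFlow; fun_prop

theorem nlFlow_zero (δ : ℝ) (p q : ℂ) : nlFlow δ 0 p q = p := by simp [nlFlow]

end pointwise

end DNLS

namespace DNLS

/-! ### Regular solutions of the coupled system -/

/-- The Fourier transforms `a`, `b` of a solution `u`, `v` of
`∂ₜu = i∂ₓ²u - 2δu²v̄`, `∂ₜv = i∂ₓ²v + 2δv²ū` on `[0, T]` which is bounded by `K` in `H⁴`. The
equation is required frequency by frequency. -/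
structure Curve (δ T K : ℝ) (u v a b : ℝ → ℝ → ℂ) : Prop where
  memLp_left : ∀ t ∈ Icc 0 T, MemLp (u t) 2 volume
  memLp_right : ∀ t ∈ Icc 0 T, MemLp (v t) 2 volume
  fhat_left : ∀ t ∈ Icc 0 T, fhat (u t) =ᵐ[volume] a t
  fhat_right : ∀ t ∈ Icc 0 T, fhat (v t) =ᵐ[volume] b t
  bound_left : ∀ t ∈ Icc 0 T, FBound 4 (a t) K
  bound_right : ∀ t ∈ Icc 0 T, FBound 4 (b t) K
  cont_left : ∀ ξ, ContinuousOn (fun t => a t ξ) (Icc 0 T)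
  cont_right : ∀ ξ, ContinuousOn (fun t => b t ξ) (Icc 0 T)
  deriv_left : ∀ ξ, ∀ t ∈ Ioo 0 T, HasDerivAt (fun t => a t ξ)
    (-(Complex.I * (((2 * Real.pi * ξ) ^ 2 : ℝ) : ℂ)) * a t ξ +
      -2 * δ * 𝓕 (fun x => u t x * conj (v t x) * u t x) ξ) t
  deriv_right : ∀ ξ, ∀ t ∈ Ioo 0 T, HasDerivAt (fun t => b t ξ)
    (-(Complex.I * (((2 * Real.pi * ξ) ^ 2 : ℝ) : ℂ)) * b t ξ +
      -2 * (-δ) * 𝓕 (fun x => v t x * conj (u t x) * v t x) ξ) t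

theorem Curve.symm {δ T K : ℝ} {u v a b : ℝ → ℝ → ℂ} (h : Curve δ T K u v a b) :
    Curve (-δ) T K v u b a where
  memLp_left := h.memLp_right
  memLp_right := h.memLp_left
  fhat_left := h.fhat_right
  fhat_right := h.fhat_left
  bound_left := h.bound_right
  bound_right := h.bound_left
  cont_left := h.cont_right
  cont_right := h.cont_left
  deriv_left := fun ξ t ht => by simpa using! h.deriv_right ξ t ht
  deriv_right := fun ξ t ht => by simpa using! h.deriv_left ξ t ht

theorem FBound.ae_norm_finv_le {q : ℕ} {A : ℝ → ℂ} {α : ℝ} (hq : 1 ≤ q) (h : FBound q A α) :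
    ∀ᵐ x, ‖finv A x‖ ≤ 2 * α := by
  filter_upwards [finv_eq_fourierInv (h.integrable hq).1 h.l2Bound.memLp] with x hx
  rw [hx]
  exact (norm_fourierInv_le x).trans (h.integrable hq).2

theorem FBound.freeSymbol_mul {q : ℕ} {A : ℝ → ℂ} {α : ℝ} (h : FBound q A α) (t : ℝ) :
    FBound q (fun ξ => freeSymbol t ξ * A ξ) α := by
  have := h.of_norm_le (B := fun ξ => freeSymbol t ξ * A ξ) zero_le_one
    ((continuous_freeSymbol t).measurable.mul h.meas)
    (fun ξ => by rw [norm_mul, norm_freeSymbol])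
  simpa using this

theorem L2Bound.freeSymbol_mul {A : ℝ → ℂ} {α : ℝ} (h : L2Bound A α) (t : ℝ) :
    L2Bound (fun ξ => freeSymbol t ξ * A ξ) α :=
  h.of_norm_le_one ((continuous_freeSymbol t).aestronglyMeasurable.mul h.meas)
    (.of_forall fun ξ => by rw [norm_mul, norm_freeSymbol, one_mul])

theorem FBound.sub_comm {q : ℕ} {A B : ℝ → ℂ} {α : ℝ} (h : FBound q (fun ξ => A ξ - B ξ) α) :
    FBound q (fun ξ => B ξ - A ξ) α := by
  have := h.of_norm_le (B := fun ξ => B ξ - A ξ) zero_le_one (by simpa [Pi.neg_def] using h.meas.neg)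
    (fun ξ => by rw [one_mul, norm_sub_rev])
  simpa using this

theorem integrable_mul_conj_mul {p q : ℝ → ℂ} {R : ℝ} (hp : MemLp p 2 volume)
    (hq : MemLp q 2 volume) (hR : ∀ᵐ x, ‖p x‖ ≤ R) :
    Integrable fun x => p x * conj (q x) * p x := by
  have h1 : Integrable fun x => q x * p x := MemLp.integrable_mul hq hp
  have hm : AEStronglyMeasurable (fun x => p x * conj (q x) * p x) volume :=
    (hp.1.mul (Complex.continuous_conj.comp_aestronglyMeasurable hq.1)).mul hp.1
  refine (h1.norm.const_mul R).mono hm ?_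
  filter_upwards [hR] with x hx
  rw [norm_mul, norm_mul, RCLike.norm_conj, norm_mul, norm_norm, norm_mul, mul_assoc]
  gcongr
  exact hx.trans (Real.le_norm_self R)

/-- The mean value inequality in weighted `L²`. -/
theorem FBound.mean_value {q : ℕ} {g g' : ℝ → ℝ → ℂ} {a b B : ℝ} (hab : a ≤ b) (hB : 0 ≤ B)
    (hm : ∀ s ∈ Icc a b, Measurable (g s))
    (hc : ∀ ξ, ContinuousOn (fun s => g s ξ) (Icc a b))
    (hd : ∀ ξ, ∀ s ∈ Ioo a b, HasDerivAt (fun s => g s ξ) (g' s ξ) s)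
    (hg' : ∀ s ∈ Ioo a b, L2Bound (fun ξ => ((wt ξ ^ q : ℝ) : ℂ) * g' s ξ) B) :
    FBound q (fun ξ => g b ξ - g a ξ) (B * (b - a)) := by
  refine ⟨(hm b ⟨hab, le_rfl⟩).sub (hm a ⟨le_rfl, hab⟩), ?_⟩
  have := L2Bound.mean_value (g := fun s ξ => ((wt ξ ^ q : ℝ) : ℂ) * g s ξ)
    (g' := fun s ξ => ((wt ξ ^ q : ℝ) : ℂ) * g' s ξ) hab hB
    (fun s hs => (Complex.continuous_ofReal.comp (continuous_wt.pow q)).measurable.mul (hm s hs))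
    (fun ξ => continuousOn_const.mul (hc ξ)) (fun ξ s hs => (hd ξ s hs).const_mul _) hg'
  exact this.congr_ae (.of_forall fun ξ => by simp only; ring)

/-! ### The twisted variable and the frozen flow -/

/-- The twisted variable `e^{-is∂ₓ²}u(t₀ + s)`, on the Fourier side. -/
noncomputable def twist (a : ℝ → ℝ → ℂ) (t₀ s ξ : ℝ) : ℂ := freeSymbol (-s) ξ * a (t₀ + s) ξ

/-- The function `e^{im∂ₓ²}` applied to the twisted variable at time `s`. -/
noncomputable def half (a : ℝ → ℝ → ℂ) (t₀ m s : ℝ) : ℝ → ℂ :=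
  finv fun ξ => freeSymbol m ξ * twist a t₀ s ξ

/-- The first component of the nonlinear flow at time `s`, started from `e^{im∂ₓ²}(u, v)(t₀)`. -/
noncomputable def frozen (δ : ℝ) (a b : ℝ → ℝ → ℂ) (t₀ m s x : ℝ) : ℂ :=
  nlFlow δ s (half a t₀ m 0 x) (half b t₀ m 0 x)

/-- The Fourier transform of `frozen`, with `e^{im∂ₓ²}` undone. It solves the equation of `twist` with
the phase factor taken at time `m` throughout; for `m = τ / 2` and `s = τ` it is the result of a
Strang step, up to `e^{iτ∂ₓ²}`. The difference `frozen - half` is integrable, so that the Fourier integral is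
defined at every `ξ` and can be differentiated in `s`. -/
noncomputable def frozenTwist (δ : ℝ) (a b : ℝ → ℝ → ℂ) (t₀ m s ξ : ℝ) : ℂ :=
  twist a t₀ 0 ξ + freeSymbol (-m) ξ *
    𝓕 (fun x => frozen δ a b t₀ m s x - half a t₀ m 0 x) ξ

namespace Curve

variable {δ T K : ℝ} {u v a b : ℝ → ℝ → ℂ}

theorem ae_eq_finv (h : Curve δ T K u v a b) {t : ℝ} (ht : t ∈ Icc 0 T) :
    u t =ᵐ[volume] finv (a t) := by
  rw [← finv_congr (h.fhat_left t ht)]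
  exact (finv_fhat (h.memLp_left t ht)).symm

theorem ae_norm_le (h : Curve δ T K u v a b) {t : ℝ} (ht : t ∈ Icc 0 T) :
    ∀ᵐ x, ‖u t x‖ ≤ 2 * K := by
  filter_upwards [h.ae_eq_finv ht, (h.bound_left t ht).ae_norm_finv_le (by norm_num)] with x h1 h2
  rw [h1]; exact h2

theorem bound_twist (h : Curve δ T K u v a b) {t₀ s : ℝ} (hs : t₀ + s ∈ Icc 0 T) :
    FBound 4 (twist a t₀ s) K := (h.bound_left _ hs).freeSymbol_mul (-s)

theorem freeSymbol_mul_fourier (h : Curve δ T K u v a b) {t₀ s : ℝ} (hs : t₀ + s ∈ Icc 0 T) :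
    (fun ξ => freeSymbol (-s) ξ *
      𝓕 (fun x => u (t₀ + s) x * conj (v (t₀ + s) x) * u (t₀ + s) x) ξ) =ᵐ[volume]
    kernelOp (osc s) (twist a t₀ s) (refl (twist b t₀ s)) (twist a t₀ s) := by
  have hA := (h.bound_left _ hs).mono_weight (p := 1) (by norm_num)
  have hB := (h.bound_right _ hs).mono_weight (p := 1) (by norm_num)
  obtain ⟨h1, h2⟩ := fhat_mul_conj_mul hA hB hA (h.ae_eq_finv hs) (h.symm.ae_eq_finv hs)
    (h.ae_eq_finv hs)
  have h3 := fhat_eq_fourier (integrable_mul_conj_mul (h.memLp_left _ hs) (h.memLp_right _ hs)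
    (h.ae_norm_le hs)) h1
  have e : ∀ c : ℝ → ℝ → ℂ, (fun ξ => freeSymbol s ξ * twist c t₀ s ξ) = c (t₀ + s) := by
    intro c; ext ξ
    rw [twist, ← mul_assoc, freeSymbol_mul_neg_self, one_mul]
  filter_upwards [h2, h3] with ξ e2 e3
  have h4 := kernelOp_one_freeSymbol s (twist a t₀ s) (twist b t₀ s) (twist a t₀ s) ξ
  rw [e a, e b] at h4
  rw [← e3, e2, h4, ← mul_assoc, freeSymbol_neg_mul_self, one_mul]

theorem hasDerivAt_twist (h : Curve δ T K u v a b) {t₀ s : ℝ} (hs : t₀ + s ∈ Ioo 0 T) (ξ : ℝ) :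
    HasDerivAt (fun s => twist a t₀ s ξ) (-2 * δ * (freeSymbol (-s) ξ *
      𝓕 (fun x => u (t₀ + s) x * conj (v (t₀ + s) x) * u (t₀ + s) x) ξ)) s := by
  have h1 : HasDerivAt (fun s : ℝ => freeSymbol (-s) ξ)
      (freeSymbol (-s) ξ * (Complex.I * (((2 * Real.pi * ξ) ^ 2 : ℝ) : ℂ))) s := by
    have h0 : HasDerivAt (fun s : ℝ => -(Complex.I * ((-s * (2 * Real.pi * ξ) ^ 2 : ℝ) : ℂ)))
        (-(Complex.I * ((-1 * (2 * Real.pi * ξ) ^ 2 : ℝ) : ℂ))) s :=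
      ((((hasDerivAt_id s).neg.mul_const _).ofReal_comp).const_mul Complex.I).neg
    refine h0.cexp.congr_deriv ?_
    simp only [freeSymbol]; push_cast; ring
  have h2 : HasDerivAt (fun s => a (t₀ + s) ξ) _ s := (h.deriv_left ξ _ hs).comp_const_add t₀ s
  refine (h1.mul h2).congr_deriv ?_
  ring

theorem continuousOn_twist (h : Curve δ T K u v a b) {t₀ τ : ℝ} (h₀ : 0 ≤ t₀) (hT : t₀ + τ ≤ T)
    (ξ : ℝ) : ContinuousOn (fun s => twist a t₀ s ξ) (Icc 0 τ) := by
  refine ContinuousOn.mul (Continuous.continuousOn ?_) ?_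
  · unfold freeSymbol; fun_prop
  · refine (h.cont_left ξ).comp (by fun_prop) fun s hs => ?_
    exact ⟨by linarith [hs.1], by linarith [hs.2]⟩

/-- In `H²` the twisted variable is Lipschitz continuous in time. -/
theorem twist_sub (h : Curve δ T K u v a b) {t₀ τ : ℝ} (h₀ : 0 ≤ t₀) (hT : t₀ + τ ≤ T)
    {s s' : ℝ} (hs : s ∈ Icc 0 τ) (hs' : s' ∈ Icc 0 τ) (hss : s ≤ s') :
    FBound 2 (fun ξ => twist a t₀ s' ξ - twist a t₀ s ξ) (216 * |δ| * K ^ 3 * (s' - s)) := by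
  have hK : 0 ≤ K := (h.bound_left (t₀ + s) ⟨by linarith [hs.1], by linarith [hs.2]⟩).nonneg
  have hmem : ∀ r ∈ Icc s s', t₀ + r ∈ Icc 0 T := fun r hr =>
    ⟨by linarith [hs.1, hr.1], by linarith [hs'.2, hr.2]⟩
  have hmem' : ∀ r ∈ Ioo s s', t₀ + r ∈ Ioo 0 T := fun r hr =>
    ⟨by linarith [hs.1, hr.1], by linarith [hs'.2, hr.2]⟩
  refine FBound.mean_value hss (by positivity) (fun r hr => (h.bound_twist (hmem r hr)).meas)
    (fun ξ => (h.continuousOn_twist h₀ hT ξ).mono (Icc_subset_Icc hs.1 hs'.2))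
    (fun ξ r hr => h.hasDerivAt_twist (hmem' r hr) ξ) fun r hr => ?_
  have hr' := hmem r (Ioo_subset_Icc_self hr)
  have hA := (h.bound_twist hr').mono_weight (p := 2) (by norm_num)
  have hB := (h.symm.bound_twist hr').mono_weight (p := 2) (by norm_num)
  have hk := fBound_kernelOp (measKernel_osc r) (by norm_num) (fun ξ x y => (norm_osc r ξ x y).le)
    hA hB.refl hA
  have h2 := (hk.bound.const_mul (-2 * δ)).mono (d := 216 * |δ| * K ^ 3) (le_of_eq (by
    simp only [norm_mul, norm_neg, Complex.norm_ofNat, Complex.norm_real, Real.norm_eq_abs]; ring))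
  refine h2.congr_ae ?_
  filter_upwards [h.freeSymbol_mul_fourier hr'] with ξ e
  rw [e]; ring

theorem twist_sub_abs (h : Curve δ T K u v a b) {t₀ τ : ℝ} (h₀ : 0 ≤ t₀) (hT : t₀ + τ ≤ T)
    {s s' : ℝ} (hs : s ∈ Icc 0 τ) (hs' : s' ∈ Icc 0 τ) :
    FBound 2 (fun ξ => twist a t₀ s' ξ - twist a t₀ s ξ) (216 * |δ| * K ^ 3 * |s' - s|) := by
  rcases le_total s s' with hss | hss
  · rw [abs_of_nonneg (sub_nonneg.2 hss)]
    exact h.twist_sub h₀ hT hs hs' hss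
  · rw [abs_sub_comm, abs_of_nonneg (sub_nonneg.2 hss)]
    exact (h.twist_sub h₀ hT hs' hs hss).sub_comm

theorem half_zero_eq (h : Curve δ T K u v a b) {t₀ : ℝ} (ht : t₀ ∈ Icc 0 T) (m : ℝ) :
    freeFlow m (u t₀) = half a t₀ m 0 := by
  change finv (fun ξ => freeSymbol m ξ * fhat (u t₀) ξ) = _
  refine finv_congr ?_
  filter_upwards [h.fhat_left t₀ ht] with ξ e
  rw [e, twist, neg_zero, freeSymbol_zero, one_mul, add_zero]

theorem fhat_half (h : Curve δ T K u v a b) {t₀ s : ℝ} (hs : t₀ + s ∈ Icc 0 T) (m : ℝ) :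
    fhat (half a t₀ m s) =ᵐ[volume] fun ξ => freeSymbol m ξ * twist a t₀ s ξ :=
  fhat_finv ((h.bound_twist hs).freeSymbol_mul m).l2Bound.memLp

theorem ae_norm_half_le (h : Curve δ T K u v a b) {t₀ s : ℝ} (hs : t₀ + s ∈ Icc 0 T) (m : ℝ) :
    ∀ᵐ x, ‖half a t₀ m s x‖ ≤ 2 * K :=
  ((h.bound_twist hs).freeSymbol_mul m).ae_norm_finv_le (by norm_num)

theorem l2Bound_half (h : Curve δ T K u v a b) {t₀ s : ℝ} (hs : t₀ + s ∈ Icc 0 T) (m : ℝ) :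
    L2Bound (half a t₀ m s) K := ((h.bound_twist hs).freeSymbol_mul m).l2Bound.finv

theorem fhat_half_tri (h : Curve δ T K u v a b) {t₀ s : ℝ} (hs : t₀ + s ∈ Icc 0 T) (m : ℝ) :
    MemLp (fun x => half a t₀ m s x * conj (half b t₀ m s x) * half a t₀ m s x) 2 volume ∧
    fhat (fun x => half a t₀ m s x * conj (half b t₀ m s x) * half a t₀ m s x) =ᵐ[volume]
      fun ξ => freeSymbol m ξ *
        kernelOp (osc m) (twist a t₀ s) (refl (twist b t₀ s)) (twist a t₀ s) ξ := by
  have hA := ((h.bound_twist hs).freeSymbol_mul m).mono_weight (p := 1) (by norm_num)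
  have hB := ((h.symm.bound_twist hs).freeSymbol_mul m).mono_weight (p := 1) (by norm_num)
  obtain ⟨h1, h2⟩ := fhat_mul_conj_mul hA hB hA (f := half a t₀ m s) (g := half b t₀ m s)
    (h := half a t₀ m s) (by rfl) (by rfl) (by rfl)
  refine ⟨h1, h2.trans (.of_forall fun ξ => ?_)⟩
  exact kernelOp_one_freeSymbol m _ _ _ ξ

/-! ### The frozen flow -/

variable {t₀ m s : ℝ}

theorem aesm_frozen (h : Curve δ T K u v a b) (ht : t₀ + 0 ∈ Icc 0 T) :
    AEStronglyMeasurable (frozen δ a b t₀ m s) volume := by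
  have h1 := (h.l2Bound_half ht m).meas
  have h2 := (h.symm.l2Bound_half ht m).meas
  exact Continuous.comp_aestronglyMeasurable (g := fun z : ℂ × ℂ => nlFlow δ s z.1 z.2)
    (f := fun x => (half a t₀ m 0 x, half b t₀ m 0 x)) (continuous_nlFlow δ s) (h1.prodMk h2)

theorem ae_norm_frozen_le (h : Curve δ T K u v a b) (ht : t₀ + 0 ∈ Icc 0 T) :
    ∀ᵐ x, ∀ s, |s| ≤ 2 → ‖frozen δ a b t₀ m s x‖ ≤ growth δ (2 * K) * ‖half a t₀ m 0 x‖ := by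
  filter_upwards [h.ae_norm_half_le ht m, h.symm.ae_norm_half_le ht m] with x h1 h2 s hs
  exact norm_nlFlow_le hs h1 h2

theorem memLp_frozen (h : Curve δ T K u v a b) (ht : t₀ + 0 ∈ Icc 0 T) (hs : |s| ≤ 2) :
    MemLp (frozen δ a b t₀ m s) 2 volume := by
  have := (h.l2Bound_half ht m).of_norm_le (growth_pos δ (2 * K)).le
    (h.aesm_frozen (m := m) (s := s) ht) (by
      filter_upwards [h.ae_norm_frozen_le (m := m) ht] with x hx
      exact hx s hs)
  exact this.memLp

theorem frozen_sub (h : Curve δ T K u v a b) (ht : t₀ + 0 ∈ Icc 0 T) (hs : |s| ≤ 2) :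
    L2Bound (fun x => frozen δ a b t₀ m s x - half a t₀ m 0 x)
      (2 * |δ| * (2 * K) ^ 2 * growth δ (2 * K) * |s| * K) := by
  have := growth_pos δ (2 * K)
  refine (h.l2Bound_half ht m).of_norm_le (by positivity)
    ((h.aesm_frozen ht).sub (h.l2Bound_half ht m).meas) ?_
  filter_upwards [h.ae_norm_half_le ht m, h.symm.ae_norm_half_le ht m] with x h1 h2
  exact norm_nlFlow_sub_self_le hs h1 h2

end Curve

end DNLS

namespace DNLS

/-! ### The local error of the splitting -/

/-- Differentiation of a Fourier integral with respect to a parameter. -/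
theorem hasDerivAt_fourier_param {F F' : ℝ → ℝ → ℂ} {s₀ ε : ℝ} {bd : ℝ → ℝ} (hε : 0 < ε)
    (hm : ∀ s ∈ Metric.ball s₀ ε, AEStronglyMeasurable (F s) volume) (hi : Integrable (F s₀))
    (hm' : AEStronglyMeasurable (F' s₀) volume)
    (hb : ∀ᵐ x, ∀ s ∈ Metric.ball s₀ ε, ‖F' s x‖ ≤ bd x) (hbd : Integrable bd)
    (hd : ∀ᵐ x, ∀ s ∈ Metric.ball s₀ ε, HasDerivAt (fun s => F s x) (F' s x) s) (ξ : ℝ) :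
    HasDerivAt (fun s => 𝓕 (F s) ξ) (𝓕 (F' s₀) ξ) s₀ := by
  have hc : Continuous fun x : ℝ => (Real.fourierChar (-(x * ξ)) : ℂ) := by
    have := Real.continuous_fourierChar
    fun_prop
  simp only [Real.fourier_real_eq, Circle.smul_def]
  refine (hasDerivAt_integral_of_dominated_loc_of_deriv_le
    (F := fun s x => (Real.fourierChar (-(x * ξ)) : ℂ) • F s x)
    (F' := fun s x => (Real.fourierChar (-(x * ξ)) : ℂ) • F' s x)
    (Metric.ball_mem_nhds s₀ hε) ?_ ?_
    (hc.aestronglyMeasurable.smul hm') (bound := bd) ?_ hbd ?_).2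
  · filter_upwards [Metric.ball_mem_nhds s₀ hε] with s hs
    exact hc.aestronglyMeasurable.smul (hm s hs)
  · refine hi.mono (hc.aestronglyMeasurable.smul hi.1) (.of_forall fun x => ?_)
    rw [norm_smul, Circle.norm_coe, one_mul]
  · filter_upwards [hb] with x hx s hs
    rw [norm_smul, Circle.norm_coe, one_mul]
    exact hx s hs
  · filter_upwards [hd] with x hx s hs
    exact (hx s hs).const_mul _

namespace Curve

variable {δ T K : ℝ} {u v a b : ℝ → ℝ → ℂ} {t₀ m s τ : ℝ}

theorem integrable_frozen_sub (h : Curve δ T K u v a b) (ht : t₀ + 0 ∈ Icc 0 T) (hs : |s| ≤ 2) :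
    Integrable fun x => frozen δ a b t₀ m s x - half a t₀ m 0 x := by
  have hi : Integrable fun x => half b t₀ m 0 x * half a t₀ m 0 x :=
    MemLp.integrable_mul (h.symm.l2Bound_half ht m).memLp (h.l2Bound_half ht m).memLp
  have hG := growth_pos δ (2 * K)
  have hK : 0 ≤ K := (h.l2Bound_half ht m).nonneg
  refine (hi.norm.const_mul (2 * |δ| * growth δ (2 * K) * |s| * (2 * K))).mono
    ((h.aesm_frozen ht).sub (h.l2Bound_half ht m).meas) ?_
  filter_upwards [h.ae_norm_half_le ht m, h.symm.ae_norm_half_le ht m] with x h1 h2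
  have h3 := norm_exp_exponent_sub_le (δ := δ) hs h1 h2 (p' := 0) (q' := 0) (by simpa) (by simpa)
  simp only [zero_mul, mul_zero, neg_zero, Complex.exp_zero, sub_zero, norm_mul,
    RCLike.norm_conj] at h3
  rw [frozen, nlFlow, Real.norm_of_nonneg (by positivity)]
  have e : ∀ c p : ℂ, c * p - p = (c - 1) * p := fun c p => by ring
  rw [e, norm_mul, norm_mul]
  calc _ ≤ (2 * |δ| * growth δ (2 * K) * |s| * (‖half a t₀ m 0 x‖ * ‖half b t₀ m 0 x‖)) *
        (2 * K) := by gcongr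
    _ = _ := by ring

theorem ae_norm_frozen_le' (h : Curve δ T K u v a b) (ht : t₀ + 0 ∈ Icc 0 T) :
    ∀ᵐ x, ∀ s, |s| ≤ 2 → ‖frozen δ a b t₀ m s x‖ ≤ growth δ (2 * K) * (2 * K) := by
  filter_upwards [h.ae_norm_frozen_le (m := m) ht, h.ae_norm_half_le ht m] with x h1 h2 s hs
  refine (h1 s hs).trans ?_
  have := growth_pos δ (2 * K)
  gcongr

theorem hasDerivAt_frozenTwist (h : Curve δ T K u v a b) (ht : t₀ + 0 ∈ Icc 0 T) (hs : |s| ≤ 1)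
    (ξ : ℝ) : HasDerivAt (fun s => frozenTwist δ a b t₀ m s ξ)
      (-2 * δ * (freeSymbol (-m) ξ * 𝓕 (fun x => frozen δ a b t₀ m s x *
        conj (frozen (-δ) b a t₀ m s x) * frozen δ a b t₀ m s x) ξ)) s := by
  have hball : ∀ r ∈ Metric.ball s 1, |r| ≤ 2 := by
    intro r hr
    rw [Metric.mem_ball, Real.dist_eq] at hr
    have := abs_sub_abs_le_abs_sub r s
    linarith
  have hG := growth_pos δ (2 * K)
  have hK : 0 ≤ K := (h.l2Bound_half ht m).nonneg
  have hi : Integrable fun x => half b t₀ m 0 x * half a t₀ m 0 x :=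
    MemLp.integrable_mul (h.symm.l2Bound_half ht m).memLp (h.l2Bound_half ht m).memLp
  have key := hasDerivAt_fourier_param (s₀ := s) (ε := 1)
    (F := fun s x => frozen δ a b t₀ m s x - half a t₀ m 0 x)
    (F' := fun s x => -2 * δ * (frozen δ a b t₀ m s x *
        conj (frozen (-δ) b a t₀ m s x) * frozen δ a b t₀ m s x))
    (bd := fun x => 2 * |δ| * (growth δ (2 * K) ^ 3 * (2 * K)) *
      ‖half b t₀ m 0 x * half a t₀ m 0 x‖) one_pos
    (fun r _ => (h.aesm_frozen ht).sub (h.l2Bound_half ht m).meas)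
    (h.integrable_frozen_sub ht (hs.trans (by norm_num)))
    ?_ ?_ (hi.norm.const_mul _) (.of_forall fun x r _ => ?_) ξ
  · refine ((key.const_mul (freeSymbol (-m) ξ)).const_add (twist a t₀ 0 ξ)).congr_deriv ?_
    have : 𝓕 (fun x => -2 * (δ : ℂ) * (frozen δ a b t₀ m s x *
        conj (frozen (-δ) b a t₀ m s x) * frozen δ a b t₀ m s x)) ξ = -2 * δ *
        𝓕 (fun x => frozen δ a b t₀ m s x *
        conj (frozen (-δ) b a t₀ m s x) * frozen δ a b t₀ m s x) ξ := by
      rw [Real.fourier_real_eq, Real.fourier_real_eq, ← integral_const_mul]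
      refine integral_congr_ae (.of_forall fun x => ?_)
      simp only [Circle.smul_def, smul_eq_mul]; ring
    rw [this]; ring
  · have h1 := h.aesm_frozen (m := m) (s := s) ht
    have h2 := h.symm.aesm_frozen (m := m) (s := s) ht
    exact ((h1.mul (Complex.continuous_conj.comp_aestronglyMeasurable h2)).mul h1).const_mul _
  · filter_upwards [h.ae_norm_frozen_le (m := m) ht, h.symm.ae_norm_frozen_le (m := m) ht,
      h.ae_norm_half_le ht m] with x h1 h2 h3 r hr
    have e1 := h1 r (hball r hr)
    have e2 := h2 r (hball r hr)
    rw [growth_neg] at e2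
    simp only [norm_mul, RCLike.norm_conj, norm_neg, Complex.norm_ofNat, Complex.norm_real,
      Real.norm_eq_abs]
    calc _ ≤ 2 * |δ| * ((growth δ (2 * K) * ‖half a t₀ m 0 x‖) *
          (growth δ (2 * K) * ‖half b t₀ m 0 x‖) * (growth δ (2 * K) * (2 * K))) := by
          gcongr
          exact e1.trans (by gcongr)
      _ = _ := by ring
  · have := (hasDerivAt_nlFlow δ r (half a t₀ m 0 x) (half b t₀ m 0 x)).sub_const (half a t₀ m 0 x)
    exact this

theorem frozenTwist_zero (δ : ℝ) (a b : ℝ → ℝ → ℂ) (t₀ m ξ : ℝ) :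
    frozenTwist δ a b t₀ m 0 ξ = twist a t₀ 0 ξ := by
  simp [frozenTwist, frozen, nlFlow_zero, Real.fourier_real_eq]

theorem measurable_frozenTwist (h : Curve δ T K u v a b) (ht : t₀ + 0 ∈ Icc 0 T)
    (hs : |s| ≤ 2) : Measurable (frozenTwist δ a b t₀ m s) :=
  (h.bound_twist ht).meas.add ((continuous_freeSymbol _).measurable.mul
    (continuous_fourier (h.integrable_frozen_sub ht hs)).measurable)

theorem fhat_frozen (h : Curve δ T K u v a b) (ht : t₀ + 0 ∈ Icc 0 T) (hs : |s| ≤ 2) :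
    fhat (frozen δ a b t₀ m s) =ᵐ[volume]
      fun ξ => freeSymbol m ξ * frozenTwist δ a b t₀ m s ξ := by
  have h1 := h.memLp_frozen (m := m) ht hs
  have h2 := (h.l2Bound_half ht m).memLp
  filter_upwards [fhat_sub h1 h2, fhat_eq_fourier (h.integrable_frozen_sub ht hs) (h1.sub h2),
    h.fhat_half ht m] with ξ e1 e2 e3
  have e4 : fhat (frozen δ a b t₀ m s) ξ = fhat (half a t₀ m 0) ξ +
      𝓕 (fun x => frozen δ a b t₀ m s x - half a t₀ m 0 x) ξ := by
    rw [← e2, e1]; ring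
  rw [e4, e3, frozenTwist]
  linear_combination (-𝓕 (fun x => frozen δ a b t₀ m s x - half a t₀ m 0 x) ξ) *
    freeSymbol_mul_neg_self m ξ

/-- Distances in physical space in terms of the twisted variables. -/
theorem half_sub_frozen (h : Curve δ T K u v a b) (ht : t₀ + 0 ∈ Icc 0 T)
    (hts : t₀ + s ∈ Icc 0 T) (hs : |s| ≤ 2) {d : ℝ}
    (hd : L2Bound (fun ξ => twist a t₀ s ξ - frozenTwist δ a b t₀ m s ξ) d) :
    L2Bound (fun x => half a t₀ m s x - frozen δ a b t₀ m s x) d := by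
  have h1 := h.memLp_frozen (m := m) ht hs
  have h2 := (h.l2Bound_half hts m).memLp
  refine L2Bound.of_fhat (h2.sub h1) ((hd.freeSymbol_mul m).congr_ae ?_)
  filter_upwards [fhat_sub h2 h1, h.fhat_half hts m, h.fhat_frozen (m := m) ht hs] with ξ e1 e2 e3
  rw [e1, e2, e3]; ring

theorem half_sub_half (h : Curve δ T K u v a b) (h₀ : 0 ≤ t₀) (hT : t₀ + τ ≤ T)
    (hs : s ∈ Icc 0 τ) :
    L2Bound (fun x => half a t₀ m s x - half a t₀ m 0 x) (216 * |δ| * K ^ 3 * s) := by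
  have ht : t₀ + 0 ∈ Icc 0 T := ⟨by linarith, by linarith [hs.1, hs.2]⟩
  have hts : t₀ + s ∈ Icc 0 T := ⟨by linarith [hs.1], by linarith [hs.2]⟩
  have h1 := (h.l2Bound_half ht m).memLp
  have h2 := (h.l2Bound_half hts m).memLp
  have h3 := (h.twist_sub h₀ hT (s := 0) ⟨le_rfl, hs.1.trans hs.2⟩ hs hs.1).l2Bound
  rw [sub_zero] at h3
  refine L2Bound.of_fhat (h2.sub h1) ((h3.freeSymbol_mul m).congr_ae ?_)
  filter_upwards [fhat_sub h2 h1, h.fhat_half hts m, h.fhat_half ht m] with ξ e1 e2 e3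
  rw [e1, e2, e3]; ring

/-- The nonlinear terms of the twisted equation and of the frozen flow are as close as the
solutions. -/
theorem frozen_tri_sub (h : Curve δ T K u v a b) (ht : t₀ + 0 ∈ Icc 0 T)
    (hts : t₀ + s ∈ Icc 0 T) (hs : |s| ≤ 2) {d : ℝ}
    (hd : L2Bound (fun x => half a t₀ m s x - frozen δ a b t₀ m s x) d)
    (hd' : L2Bound (fun x => half b t₀ m s x - frozen (-δ) b a t₀ m s x) d) :
    L2Bound (fun ξ => kernelOp (osc m) (twist a t₀ s) (refl (twist b t₀ s)) (twist a t₀ s) ξ -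
      freeSymbol (-m) ξ * 𝓕 (fun x => frozen δ a b t₀ m s x *
        conj (frozen (-δ) b a t₀ m s x) * frozen δ a b t₀ m s x) ξ)
      (3 * (growth δ (2 * K) * (2 * K)) ^ 2 * d) := by
  have hK : 0 ≤ K := (h.l2Bound_half ht m).nonneg
  set R := growth δ (2 * K) * (2 * K) with hR
  have hRK : 2 * K ≤ R := le_mul_of_one_le_left (by linarith) (one_le_growth _ _)
  obtain ⟨m1, e1⟩ := h.fhat_half_tri hts m
  have n1 := h.memLp_frozen (m := m) ht hs
  have n2 := h.symm.memLp_frozen (m := m) ht hs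
  have i2 := integrable_mul_conj_mul n1 n2 (by
    filter_upwards [h.ae_norm_frozen_le' (m := m) ht] with x hx
    exact hx s hs)
  have hm2 : AEStronglyMeasurable (fun x => half a t₀ m s x * conj (half b t₀ m s x) *
      half a t₀ m s x - frozen δ a b t₀ m s x * conj (frozen (-δ) b a t₀ m s x) *
        frozen δ a b t₀ m s x) volume := m1.1.sub i2.1
  have hdiff := L2Bound.of_norm_le_add (K := 2 * R ^ 2) (L := R ^ 2) (by positivity)
    (by positivity) hd hd' hm2 (by
      filter_upwards [h.ae_norm_half_le hts m, h.symm.ae_norm_half_le hts m,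
        h.ae_norm_frozen_le' (m := m) ht] with x b1 b2 b3
      exact norm_tri_sub_le (b1.trans hRK) (b2.trans hRK) (b3 s hs))
  have m2 : MemLp (fun x => frozen δ a b t₀ m s x * conj (frozen (-δ) b a t₀ m s x) *
      frozen δ a b t₀ m s x) 2 volume := by
    refine (memLp_congr_ae (.of_forall fun x => ?_)).1 (m1.sub hdiff.memLp)
    simp
  have hfin := (hdiff.fhat.freeSymbol_mul (-m)).mono (d := 3 * R ^ 2 * d) (le_of_eq (by ring))
  refine hfin.congr_ae ?_
  filter_upwards [fhat_sub m1 m2, e1, fhat_eq_fourier i2 m2] with ξ f1 f2 f3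
  rw [f1, f2, f3, mul_sub, ← mul_assoc, freeSymbol_neg_mul_self, one_mul]

/-- The difference between the twisted solution and the frozen flow is `O(τ²)`. -/
theorem twist_sub_frozenTwist (h : Curve δ T K u v a b) (h₀ : 0 ≤ t₀) (hτ : τ ≤ 1)
    (hT : t₀ + τ ≤ T) (hm : m ∈ Icc 0 τ) (hs : s ∈ Icc 0 τ) :
    L2Bound (fun ξ => twist a t₀ s ξ - frozenTwist δ a b t₀ m s ξ)
      (2 * |δ| * (1920 * K ^ 3 + 3 * (growth δ (2 * K) * (2 * K)) ^ 2 *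
        (216 * |δ| * K ^ 3 + 2 * |δ| * (2 * K) ^ 2 * growth δ (2 * K) * K)) * τ ^ 2) := by
  have hτ0 : 0 ≤ τ := hs.1.trans hs.2
  have ht : t₀ + 0 ∈ Icc 0 T := ⟨by linarith, by linarith⟩
  have hmem : ∀ r ∈ Icc 0 τ, t₀ + r ∈ Icc 0 T := fun r hr =>
    ⟨by linarith [hr.1], by linarith [hr.2]⟩
  have hK : 0 ≤ K := (h.l2Bound_half ht m).nonneg
  have hG := growth_pos δ (2 * K)
  have habs : ∀ r ∈ Icc (0 : ℝ) τ, |r| ≤ 1 := fun r hr => by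
    rw [abs_of_nonneg hr.1]; exact hr.2.trans hτ
  set c₀ := 216 * |δ| * K ^ 3 + 2 * |δ| * (2 * K) ^ 2 * growth δ (2 * K) * K with hc₀
  set C := 2 * |δ| * (1920 * K ^ 3 + 3 * (growth δ (2 * K) * (2 * K)) ^ 2 * c₀) with hC
  have hC0 : 0 ≤ C := by positivity
  -- both flows start at the same point and have moved by at most `O(τ)`
  have hclose : ∀ {δ : ℝ} {u v a b : ℝ → ℝ → ℂ}, Curve δ T K u v a b → ∀ r ∈ Icc 0 τ,
      L2Bound (fun x => half a t₀ m r x - frozen δ a b t₀ m r x)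
        ((216 * |δ| * K ^ 3 + 2 * |δ| * (2 * K) ^ 2 * growth δ (2 * K) * K) * τ) := by
    intro δ u v a b h r hr
    have hG := growth_pos δ (2 * K)
    have h1 := h.half_sub_half (m := m) h₀ hT hr
    have h2 := h.frozen_sub (m := m) ht ((habs r hr).trans (by norm_num))
    refine ((h1.sub h2).mono ?_).congr_ae (.of_forall fun x => by simp only; ring)
    rw [abs_of_nonneg hr.1]
    have e1 : 216 * |δ| * K ^ 3 * r ≤ 216 * |δ| * K ^ 3 * τ := by gcongr; exact hr.2
    have e2 : 2 * |δ| * (2 * K) ^ 2 * growth δ (2 * K) * r * K ≤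
      2 * |δ| * (2 * K) ^ 2 * growth δ (2 * K) * τ * K := by gcongr; exact hr.2
    linarith
  have key := L2Bound.mean_value (B := C * τ)
    (g := fun r ξ => twist a t₀ r ξ - frozenTwist δ a b t₀ m r ξ) hs.1 (by positivity)
    (fun (r : ℝ) (hr : r ∈ Icc 0 s) => (h.bound_twist (hmem r ⟨hr.1, hr.2.trans hs.2⟩)).meas.sub
      (h.measurable_frozenTwist ht ((habs r ⟨hr.1, hr.2.trans hs.2⟩).trans (by norm_num))))
    (fun ξ => ((h.continuousOn_twist h₀ hT ξ).mono (Icc_subset_Icc le_rfl hs.2)).sub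
      fun r hr => (h.hasDerivAt_frozenTwist ht
        (habs r ⟨hr.1, hr.2.trans hs.2⟩) ξ).continuousAt.continuousWithinAt)
    (fun ξ r hr => (h.hasDerivAt_twist ⟨by linarith [hr.1], by linarith [hr.2, hs.2]⟩ ξ).sub
      (h.hasDerivAt_frozenTwist ht (habs r ⟨hr.1.le, hr.2.le.trans hs.2⟩) ξ)) ?_
  · refine (key.mono (d := C * τ ^ 2) ?_).congr_ae (.of_forall fun ξ => ?_)
    · rw [sub_zero, mul_assoc, sq]
      gcongr
      exact hs.2
    · simp only [frozenTwist_zero]; ring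
  intro r hr
  have hr' : r ∈ Icc 0 τ := ⟨hr.1.le, hr.2.le.trans hs.2⟩
  have hA := (h.bound_twist (hmem r hr')).mono_weight (p := 2) (by norm_num)
  have hB := (h.symm.bound_twist (hmem r hr')).mono_weight (p := 2) (by norm_num)
  have hd' := hclose h.symm r hr'
  rw [abs_neg, growth_neg] at hd'
  have h1 := h.frozen_tri_sub ht (hmem r hr') ((habs r hr').trans (by norm_num))
    (hclose h r hr') hd'
  have h2 := l2Bound_kernelOp (κ := fun ξ x y => osc r ξ x y - osc m ξ x y)
    ((measKernel_osc r).sub (measKernel_osc m)) (by norm_num) (by positivity)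
    (norm_osc_sub_le r m) hA hB.refl hA
  have hrm : |r - m| ≤ τ := abs_le.2 ⟨by linarith [hr'.1, hm.2], by linarith [hr'.2, hm.1]⟩
  refine (((h2.add h1).const_mul (-2 * δ)).mono ?_).congr_ae ?_
  · simp only [norm_mul, norm_neg, Complex.norm_ofNat, Complex.norm_real, Real.norm_eq_abs]
    have : 12 * (160 * |r - m|) * K * K * K ≤ 12 * (160 * τ) * K * K * K := by gcongr
    have e : C * τ = 2 * |δ| *
        ((1920 * K ^ 3 + 3 * (growth δ (2 * K) * (2 * K)) ^ 2 * c₀) * τ) := by rw [hC]; ring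
    rw [e]
    refine mul_le_mul_of_nonneg_left ?_ (mul_nonneg zero_le_two (abs_nonneg δ))
    linarith
  · have hle1 : ∀ r ξ x y, ‖osc r ξ x y‖ ≤ 1 * (wt x ^ 2 + wt y ^ 2 + wt (ξ - x - y) ^ 2) := by
      intro r ξ x y
      rw [norm_osc]
      have := one_le_pow₀ (one_le_wt x) (n := 2)
      have := sq_nonneg (wt y)
      have := sq_nonneg (wt (ξ - x - y))
      linarith
    filter_upwards [h.freeSymbol_mul_fourier (hmem r hr'), kernelOp_sub_kernel
      (ae_integrable_kernelOp (measKernel_osc r) (by norm_num) zero_le_one (hle1 r) hA hB.refl hA)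
      (ae_integrable_kernelOp (measKernel_osc m) (by norm_num) zero_le_one (hle1 m) hA hB.refl hA)]
      with ξ e1 e2
    rw [e1, ← e2]; ring

end Curve

end DNLS

namespace DNLS

/-- The constant of the preliminary estimate `‖w - z‖ ≤ Cτ²` between the twisted solution and the
frozen flow. -/
noncomputable def preConst (δ K : ℝ) : ℝ :=
  2 * |δ| * (1920 * K ^ 3 + 3 * (growth δ (2 * K) * (2 * K)) ^ 2 *
    (216 * |δ| * K ^ 3 + 2 * |δ| * (2 * K) ^ 2 * growth δ (2 * K) * K))

theorem preConst_neg (δ K : ℝ) : preConst (-δ) K = preConst δ K := by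
  simp [preConst, growth_neg]

/-- The constant of the local error estimate. -/
noncomputable def locConst (δ K : ℝ) : ℝ :=
  2 * |δ| * (1843200 * K ^ 3 + 5760 * K ^ 2 * (216 * |δ| * K ^ 3) +
    3 * (growth δ (2 * K) * (2 * K)) ^ 2 * preConst δ K)

theorem locConst_neg (δ K : ℝ) : locConst (-δ) K = locConst δ K := by
  simp [locConst, growth_neg, preConst_neg]

theorem locConst_nonneg (δ : ℝ) {K : ℝ} (hK : 0 ≤ K) : 0 ≤ locConst δ K := by
  have := growth_pos δ (2 * K)
  unfold locConst preConst; positivity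

theorem fhat_freeFlow (t : ℝ) (f : ℝ → ℂ) :
    fhat (freeFlow t f) =ᵐ[volume] fun ξ => freeSymbol t ξ * fhat f ξ :=
  fhat_finv (memLp_freeSymbol_mul t (𝓕 (toL2 f)))

namespace Curve

variable {δ T K : ℝ} {u v a b : ℝ → ℝ → ℂ} {t₀ τ : ℝ}

/-- Freezing the phase in the middle of the step makes the error at its end one order smaller than
inside: the first-order terms cancel by symmetry. -/
theorem twist_sub_frozenTwist_end (h : Curve δ T K u v a b) (h₀ : 0 ≤ t₀) (hτ0 : 0 < τ)
    (hτ : τ ≤ 1) (hT : t₀ + τ ≤ T) :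
    L2Bound (fun ξ => twist a t₀ τ ξ - frozenTwist δ a b t₀ (τ / 2) τ ξ)
      (locConst δ K * τ ^ 3) := by
  set m := τ / 2 with hm
  have hm' : m ∈ Icc 0 τ := ⟨by linarith, by linarith⟩
  have ht : t₀ + 0 ∈ Icc 0 T := ⟨by linarith, by linarith⟩
  have hmem : ∀ r ∈ Icc 0 τ, t₀ + r ∈ Icc 0 T := fun r hr =>
    ⟨by linarith [hr.1], by linarith [hr.2]⟩
  have hK : 0 ≤ K := (h.l2Bound_half ht m).nonneg
  have hG := growth_pos δ (2 * K)
  have habs : ∀ r ∈ Icc (0 : ℝ) τ, |r| ≤ 1 := fun r hr => by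
    rw [abs_of_nonneg hr.1]; exact hr.2.trans hτ
  have hbA : ∀ r ∈ Icc 0 τ, ∀ q ≤ 4, FBound q (twist a t₀ r) K := fun r hr q hq =>
    (h.bound_twist (hmem r hr)).mono_weight hq
  have hbB : ∀ r ∈ Icc 0 τ, ∀ q ≤ 4, FBound q (refl (twist b t₀ r)) K := fun r hr q hq =>
    ((h.symm.bound_twist (hmem r hr)).mono_weight hq).refl
  let D : ℝ → ℂ := kernelOp (osc' m) (twist a t₀ m) (refl (twist b t₀ m)) (twist a t₀ m)
  have hD : Measurable D := measurable_kernelOp (measKernel_osc' m) (hbA m hm' 4 le_rfl).meas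
    (hbB m hm' 4 le_rfl).meas (hbA m hm' 4 le_rfl).meas
  have hpar : ∀ (r : ℝ) (ξ : ℝ), HasDerivAt (fun s : ℝ => (((s - m) ^ 2 : ℝ) : ℂ) * (δ * D ξ))
      (((2 * (r - m) : ℝ) : ℂ) * (δ * D ξ)) r := by
    intro r ξ
    have h1 : HasDerivAt (fun s : ℝ => (s - m) ^ 2) (2 * (r - m)) r := by
      simpa using! ((hasDerivAt_id r).sub_const m).fun_pow 2
    exact h1.ofReal_comp.mul_const _
  -- To first order in `r - m` the derivative of the difference is `-2δ(r - m) D`, which is cancelled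
  -- by the derivative of the parabola. The parabola takes the same value at `0` and at `τ = 2m`.
  have key := L2Bound.mean_value (B := locConst δ K * τ ^ 2)
    (g := fun r ξ => twist a t₀ r ξ - frozenTwist δ a b t₀ m r ξ +
      (((r - m) ^ 2 : ℝ) : ℂ) * (δ * D ξ)) hτ0.le
    (mul_nonneg (locConst_nonneg δ hK) (sq_nonneg _))
    (fun (r : ℝ) (hr : r ∈ Icc 0 τ) => ((hbA r hr 4 le_rfl).meas.sub
      (h.measurable_frozenTwist ht ((habs r hr).trans (by norm_num)))).add
      ((hD.const_mul _).const_mul _))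
    (fun ξ => ((h.continuousOn_twist h₀ hT ξ).sub
      fun r hr => (h.hasDerivAt_frozenTwist ht
        (habs r hr) ξ).continuousAt.continuousWithinAt).add
      fun r _ => (hpar r ξ).continuousAt.continuousWithinAt)
    (fun ξ r hr => ((h.hasDerivAt_twist ⟨by linarith [hr.1], by linarith [hr.2]⟩ ξ).sub
      (h.hasDerivAt_frozenTwist ht (habs r (Ioo_subset_Icc_self hr)) ξ)).add (hpar r ξ)) ?_
  · refine (key.mono (d := locConst δ K * τ ^ 3) (le_of_eq (by ring))).congr_ae
      (.of_forall fun ξ => ?_)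
    have e : (τ - m) ^ 2 = (0 - m) ^ 2 := by rw [hm]; ring
    simp only [frozenTwist_zero, e]; ring
  intro r hr
  have hr' := Ioo_subset_Icc_self hr
  have hrm : |r - m| ≤ τ := abs_le.2 ⟨by linarith [hr'.1, hm'.2], by linarith [hr'.2, hm'.1]⟩
  have hpre : ∀ {δ : ℝ} {u v a b : ℝ → ℝ → ℂ}, Curve δ T K u v a b →
      L2Bound (fun x => half a t₀ m r x - frozen δ a b t₀ m r x) (preConst δ K * τ ^ 2) :=
    fun h => h.half_sub_frozen ht (hmem r hr') ((habs r hr').trans (by norm_num))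
      (h.twist_sub_frozenTwist h₀ hτ hT hm' hr')
  have hpre' := hpre h.symm
  rw [preConst_neg] at hpre'
  -- `b1`: second-order Taylor remainder of the phase factor; `b2`: variation of the twisted
  -- variables in the first-order term; `b3`: difference of the two nonlinearities.
  have b3 := h.frozen_tri_sub ht (hmem r hr') ((habs r hr').trans (by norm_num)) (hpre h) hpre'
  have hκm : MeasKernel fun ξ x y => ((r - m : ℝ) : ℂ) * osc' m ξ x y :=
    (measKernel_osc' m).const_mul _
  have b1 := l2Bound_kernelOp
    (κ := fun ξ x y => osc r ξ x y - osc m ξ x y - (r - m : ℝ) * osc' m ξ x y)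
    (((measKernel_osc r).sub (measKernel_osc m)).sub hκm) (by norm_num) (by positivity)
    (norm_osc_sub_sub_le r m) (hbA r hr' 4 le_rfl) (hbB r hr' 4 le_rfl) (hbA r hr' 4 le_rfl)
  have dA := h.twist_sub_abs h₀ hT hm' hr'
  have dB := h.symm.twist_sub_abs h₀ hT hm' hr'
  rw [abs_neg] at dB
  have dB' : FBound 2 (fun ξ => refl (twist b t₀ r) ξ - refl (twist b t₀ m) ξ)
      (216 * |δ| * K ^ 3 * |r - m|) := by
    have := dB.refl
    have e : refl (fun ξ => twist b t₀ r ξ - twist b t₀ m ξ) =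
        fun ξ => refl (twist b t₀ r) ξ - refl (twist b t₀ m) ξ := by
      ext ξ; simp [refl]
    rwa [e] at this
  have b2 := l2Bound_kernelOp_sub (measKernel_osc' m) (by norm_num) (by norm_num)
    (norm_osc'_le m) (hbA r hr' 2 (by norm_num)) (hbB r hr' 2 (by norm_num))
    (hbA r hr' 2 (by norm_num)) (hbA m hm' 2 (by norm_num)) (hbB m hm' 2 (by norm_num))
    (hbA m hm' 2 (by norm_num)) dA dB' dA
  refine ((((b1.add (b2.const_mul ((r - m : ℝ) : ℂ))).add b3).const_mul (-2 * δ)).mono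
    ?_).congr_ae ?_
  · simp only [norm_mul, norm_neg, Complex.norm_ofNat, Complex.norm_real, Real.norm_eq_abs]
    have e1 : |r - m| ^ 2 ≤ τ ^ 2 := pow_le_pow_left₀ (abs_nonneg _) hrm 2
    have e2 : 12 * (153600 * |r - m| ^ 2) * K * K * K ≤ 12 * (153600 * τ ^ 2) * K * K * K := by
      gcongr
    have e3 : |r - m| * (36 * 160 * K ^ 2 * (216 * |δ| * K ^ 3 * |r - m|)) ≤
        τ * (36 * 160 * K ^ 2 * (216 * |δ| * K ^ 3 * τ)) := by
      gcongr
    have e : locConst δ K * τ ^ 2 = 2 * |δ| * ((1843200 * K ^ 3 +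
        5760 * K ^ 2 * (216 * |δ| * K ^ 3) +
        3 * (growth δ (2 * K) * (2 * K)) ^ 2 * preConst δ K) * τ ^ 2) := by
      rw [locConst]; ring
    rw [e]
    refine mul_le_mul_of_nonneg_left ?_ (mul_nonneg zero_le_two (abs_nonneg δ))
    linarith
  · have hle1 : ∀ r ξ x y, ‖osc r ξ x y‖ ≤ 1 * (wt x ^ 2 + wt y ^ 2 + wt (ξ - x - y) ^ 2) := by
      intro r ξ x y
      rw [norm_osc]
      have := one_le_pow₀ (one_le_wt x) (n := 2)
      have := sq_nonneg (wt y)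
      have := sq_nonneg (wt (ξ - x - y))
      linarith
    have A2 := hbA r hr' 2 (by norm_num)
    have B2 := hbB r hr' 2 (by norm_num)
    have i1 := ae_integrable_kernelOp (measKernel_osc r) (by norm_num) zero_le_one (hle1 r) A2 B2 A2
    have i2 := ae_integrable_kernelOp (measKernel_osc m) (by norm_num) zero_le_one (hle1 m) A2 B2 A2
    have i3 := ae_integrable_kernelOp (measKernel_osc' m) (by norm_num) (by norm_num)
      (norm_osc'_le m) A2 B2 A2
    filter_upwards [h.freeSymbol_mul_fourier (hmem r hr'), i1, i2, i3] with ξ e1 j1 j2 j3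
    have e2 : kernelOp (fun ξ x y => osc r ξ x y - osc m ξ x y - (r - m : ℝ) * osc' m ξ x y)
        (twist a t₀ r) (refl (twist b t₀ r)) (twist a t₀ r) ξ =
        kernelOp (osc r) (twist a t₀ r) (refl (twist b t₀ r)) (twist a t₀ r) ξ -
        kernelOp (osc m) (twist a t₀ r) (refl (twist b t₀ r)) (twist a t₀ r) ξ -
        (r - m : ℝ) * kernelOp (osc' m) (twist a t₀ r) (refl (twist b t₀ r)) (twist a t₀ r) ξ := by
      have j12 := j1.sub j2
      simp only [Pi.sub_def] at j12
      simp only [kernelOp]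
      rw [← integral_const_mul, ← integral_sub j1 j2, ← integral_sub j12 (j3.const_mul _)]
      refine integral_congr_ae (.of_forall fun z => ?_)
      simp only; ring
    rw [e1, e2]
    simp only [D]
    push_cast; ring

/-- The local error of the splitting is `O(τ³)` in `L²`. -/
theorem local_error (h : Curve δ T K u v a b) (h₀ : 0 ≤ t₀) (hτ0 : 0 < τ) (hτ : τ ≤ 1)
    (hT : t₀ + τ ≤ T) :
    L2Bound (fun x => freeFlow (τ / 2) (frozen δ a b t₀ (τ / 2) τ) x - u (t₀ + τ) x)
      (locConst δ K * τ ^ 3) := by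
  have ht : t₀ + 0 ∈ Icc 0 T := ⟨by linarith, by linarith⟩
  have htτ : t₀ + τ ∈ Icc 0 T := ⟨by linarith, by linarith⟩
  have h1 : MemLp (freeFlow (τ / 2) (frozen δ a b t₀ (τ / 2) τ)) 2 volume := memLp_finv _
  have h2 := h.memLp_left _ htτ
  refine L2Bound.of_fhat (h1.sub h2) ?_
  have key := ((h.twist_sub_frozenTwist_end h₀ hτ0 hτ hT).freeSymbol_mul τ).neg
  refine key.congr_ae ?_
  filter_upwards [fhat_sub h1 h2, fhat_freeFlow (τ / 2) (frozen δ a b t₀ (τ / 2) τ),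
    h.fhat_frozen (m := τ / 2) (s := τ) ht (by rw [abs_of_pos hτ0]; linarith),
    h.fhat_left _ htτ] with ξ e1 e2 e3 e4
  rw [e1, e2, e3, e4, twist]
  have e5 : freeSymbol τ ξ = freeSymbol (τ / 2) ξ * freeSymbol (τ / 2) ξ := by
    rw [← freeSymbol_add]; congr 1; ring
  have e6 := freeSymbol_mul_neg_self τ ξ
  linear_combination (-a (t₀ + τ) ξ) * e6 + frozenTwist δ a b t₀ (τ / 2) τ ξ * e5

end Curve

end DNLS

namespace DNLS

/-! ### Stability of the scheme -/

theorem memLp_freeFlow (t : ℝ) (f : ℝ → ℂ) : MemLp (freeFlow t f) 2 volume := memLp_finv _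

theorem L2Bound.freeFlow_sub {f g : ℝ → ℂ} {d : ℝ} (hf : MemLp f 2 volume) (hg : MemLp g 2 volume)
    (h : L2Bound (fun x => f x - g x) d) (t : ℝ) :
    L2Bound (fun x => freeFlow t f x - freeFlow t g x) d := by
  refine L2Bound.of_fhat ((memLp_freeFlow t f).sub (memLp_freeFlow t g)) ?_
  refine (h.fhat.freeSymbol_mul t).congr_ae ?_
  filter_upwards [fhat_sub hf hg, fhat_sub (memLp_freeFlow t f) (memLp_freeFlow t g),
    fhat_freeFlow t f, fhat_freeFlow t g] with ξ e1 e2 e3 e4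
  rw [e2, e1, e3, e4]; ring

theorem L2Bound.dsym_mul_fhat_freeFlow {f : ℝ → ℂ} {B : ℝ}
    (h : L2Bound (fun ξ => dsym ξ * DNLS.fhat f ξ) B) (t : ℝ) :
    L2Bound (fun ξ => dsym ξ * DNLS.fhat (freeFlow t f) ξ) B := by
  refine (h.freeSymbol_mul t).congr_ae ?_
  filter_upwards [fhat_freeFlow t f] with ξ e
  rw [e]; ring

/-- A Lipschitz constant per unit time of the nonlinear flow on the ball of radius `R`. -/
noncomputable def lipConst (δ R : ℝ) : ℝ := 8 * |δ| * R ^ 2 * growth δ R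

theorem lipConst_neg (δ R : ℝ) : lipConst (-δ) R = lipConst δ R := by
  simp [lipConst, growth_neg]

theorem lipConst_nonneg (δ R : ℝ) : 0 ≤ lipConst δ R := by
  have := growth_pos δ R
  unfold lipConst; positivity

theorem aestronglyMeasurable_nlFlow {p q : ℝ → ℂ} (δ s : ℝ) (hp : AEStronglyMeasurable p volume)
    (hq : AEStronglyMeasurable q volume) :
    AEStronglyMeasurable (fun x => nlFlow δ s (p x) (q x)) volume :=
  (continuous_nlFlow δ s).comp_aestronglyMeasurable₂ hp hq

theorem memLp_nlFlow {p q : ℝ → ℂ} {δ s R : ℝ} (hs : |s| ≤ 2) (hp : MemLp p 2 volume)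
    (hq : MemLp q 2 volume) (bp : ∀ᵐ x, ‖p x‖ ≤ R) (bq : ∀ᵐ x, ‖q x‖ ≤ R) :
    MemLp (fun x => nlFlow δ s (p x) (q x)) 2 volume := by
  refine (hp.const_mul ((growth δ R : ℝ) : ℂ)).mono (aestronglyMeasurable_nlFlow δ s hp.1 hq.1) ?_
  filter_upwards [bp, bq] with x h1 h2
  rw [norm_mul, Complex.norm_real, Real.norm_of_nonneg (growth_pos δ R).le]
  exact norm_nlFlow_le hs h1 h2

theorem L2Bound.nlFlow_sub {p q p' q' : ℝ → ℂ} {δ s R d : ℝ} (hs : 0 ≤ s) (hs' : s ≤ 1)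
    (hp : AEStronglyMeasurable p volume) (hq : AEStronglyMeasurable q volume)
    (hp' : AEStronglyMeasurable p' volume) (hq' : AEStronglyMeasurable q' volume)
    (bp : ∀ᵐ x, ‖p x‖ ≤ R) (bq : ∀ᵐ x, ‖q x‖ ≤ R) (bp' : ∀ᵐ x, ‖p' x‖ ≤ R)
    (bq' : ∀ᵐ x, ‖q' x‖ ≤ R) (h1 : L2Bound (fun x => p x - p' x) d)
    (h2 : L2Bound (fun x => q x - q' x) d) :
    L2Bound (fun x => nlFlow δ s (p x) (q x) - nlFlow δ s (p' x) (q' x))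
      ((1 + lipConst δ R * s) * d) := by
  have hG := growth_pos δ R
  have h := L2Bound.of_norm_le_add (K := 1 + 4 * |δ| * R ^ 2 * growth δ R * |s|)
    (L := 4 * |δ| * R ^ 2 * growth δ R * |s|) (by positivity) (by positivity) h1 h2
    (u := fun x => nlFlow δ s (p x) (q x) - nlFlow δ s (p' x) (q' x))
    ((aestronglyMeasurable_nlFlow δ s hp hq).sub (aestronglyMeasurable_nlFlow δ s hp' hq')) ?_
  · refine h.mono (le_of_eq ?_)
    rw [abs_of_nonneg hs, lipConst]; ring
  · filter_upwards [bp, bq, bp', bq'] with x a1 a2 a3 a4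
    exact norm_nlFlow_sub_le (by rw [abs_of_nonneg hs]; linarith) a1 a2 a3 a4

/-- The nonlinear flow increases the `Ḣ¹`-seminorm by a factor `1 + O(s)` only, since translations
commute with it and it is Lipschitz in `L²`. -/
theorem L2Bound.dsym_mul_fhat_nlFlow {p q : ℝ → ℂ} {δ s R H : ℝ} (hs : 0 ≤ s) (hs' : s ≤ 1)
    (hp : MemLp p 2 volume) (hq : MemLp q 2 volume)
    (bp : ∀ᵐ x, ‖p x‖ ≤ R) (bq : ∀ᵐ x, ‖q x‖ ≤ R)
    (h1 : L2Bound (fun ξ => dsym ξ * DNLS.fhat p ξ) H)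
    (h2 : L2Bound (fun ξ => dsym ξ * DNLS.fhat q ξ) H) :
    L2Bound (fun ξ => dsym ξ * DNLS.fhat (fun x => nlFlow δ s (p x) (q x)) ξ)
      ((1 + lipConst δ R * s) * H) := by
  have hL := lipConst_nonneg δ R
  have hH := h1.nonneg
  refine L2Bound.dsym_mul_fhat
    (memLp_nlFlow (by rw [abs_of_nonneg hs]; linarith) hp hq bp bq) (by positivity) fun r => ?_
  have hr := (measurePreserving_add_right (volume : Measure ℝ) r).quasiMeasurePreserving
  have := L2Bound.nlFlow_sub (δ := δ) hs hs' (hp.comp_add_right r).1 (hq.comp_add_right r).1 hp.1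
    hq.1 (hr.ae bp) (hr.ae bq) bp bq (h1.translate_sub hp r) (h2.translate_sub hq r)
  exact this.mono (le_of_eq (by ring))

theorem FBound.dsym_mul {A : ℝ → ℂ} {α : ℝ} {q : ℕ} (hq : 1 ≤ q) (h : FBound q A α) :
    L2Bound (fun ξ => dsym ξ * A ξ) (7 * α) := by
  refine (h.mono_weight hq).bound.of_norm_le (by norm_num) ?_ (.of_forall fun ξ => ?_)
  · refine (Measurable.mul ?_ h.meas).aestronglyMeasurable
    unfold dsym; fun_prop
  · rw [norm_mul, norm_mul, ← mul_assoc]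
    gcongr
    rw [Complex.norm_real, Real.norm_of_nonneg (by have := wt_pos ξ; positivity)]
    simp only [dsym, norm_mul, Complex.norm_ofNat, Complex.norm_real, Complex.norm_I,
      Real.norm_eq_abs, abs_of_pos Real.pi_pos, mul_one, pow_one, wt]
    have := Real.pi_lt_d2
    nlinarith [abs_nonneg ξ, Real.pi_pos]

namespace Curve

variable {δ T K : ℝ} {u v a b : ℝ → ℝ → ℂ} {t₀ τ : ℝ}

/-- A priori control of the sup norm inside a step: the error is small in `L²` and bounded in `H¹`,
hence small in `L^∞`. -/
theorem ae_norm_freeFlow_le (h : Curve δ T K u v a b) (ht : t₀ ∈ Icc 0 T) {p : ℝ → ℂ} {E H : ℝ}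
    (hp : MemLp p 2 volume) (hE : L2Bound (fun x => p x - u t₀ x) E)
    (hH : L2Bound (fun ξ => dsym ξ * fhat p ξ) H) (hτ : 0 < τ)
    (hsmall : 2 / √τ * (E + τ * (H + 7 * K)) ≤ 1) (m : ℝ) :
    ∀ᵐ x, ‖freeFlow m p x‖ ≤ 2 * K + 1 := by
  have hu := h.memLp_left t₀ ht
  have hd : L2Bound (fun ξ => dsym ξ * fhat (fun x => freeFlow m p x - freeFlow m (u t₀) x) ξ)
      (H + 7 * K) := by
    have hH' : L2Bound (fun ξ => dsym ξ * fhat (u t₀) ξ) (7 * K) := by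
      refine ((h.bound_left t₀ ht).dsym_mul (by norm_num)).congr_ae ?_
      filter_upwards [h.fhat_left t₀ ht] with ξ e
      rw [e]
    refine ((hH.dsym_mul_fhat_freeFlow m).sub (hH'.dsym_mul_fhat_freeFlow m)).congr_ae ?_
    filter_upwards [fhat_sub (memLp_freeFlow m p) (memLp_freeFlow m (u t₀))] with ξ e
    rw [e]; ring
  have ht' : t₀ + 0 ∈ Icc 0 T := by simpa using ht
  filter_upwards [ae_norm_le_of_dsym hτ (L2Bound.freeFlow_sub hp hu hE m) hd,
    h.ae_norm_half_le ht' m] with x h1 h2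
  rw [h.half_zero_eq ht m] at h1
  calc ‖freeFlow m p x‖ = ‖(freeFlow m p x - half a t₀ m 0 x) + half a t₀ m 0 x‖ := by ring_nf
    _ ≤ 1 + 2 * K := (norm_add_le _ _).trans (add_le_add (h1.trans hsmall) h2)
    _ = _ := add_comm _ _

/-- One step of the scheme, first component: propagation of the error and of the `H¹`-bound. -/
theorem step (h : Curve δ T K u v a b) (h₀ : 0 ≤ t₀) (hτ0 : 0 < τ) (hτ : τ ≤ 1)
    (hT : t₀ + τ ≤ T) {p q : ℝ → ℂ} {E H : ℝ}
    (hp : MemLp p 2 volume) (hq : MemLp q 2 volume)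
    (hpE : L2Bound (fun x => p x - u t₀ x) E) (hqE : L2Bound (fun x => q x - v t₀ x) E)
    (hpH : L2Bound (fun ξ => dsym ξ * fhat p ξ) H) (hqH : L2Bound (fun ξ => dsym ξ * fhat q ξ) H)
    (hsmall : 2 / √τ * (E + τ * (H + 7 * K)) ≤ 1) :
    L2Bound (fun x => freeFlow (τ / 2) (fun x => nlFlow δ τ (freeFlow (τ / 2) p x)
        (freeFlow (τ / 2) q x)) x - u (t₀ + τ) x)
      ((1 + lipConst δ (2 * K + 1) * τ) * E + locConst δ K * τ ^ 3) ∧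
    L2Bound (fun ξ => dsym ξ * fhat (freeFlow (τ / 2) (fun x => nlFlow δ τ
        (freeFlow (τ / 2) p x) (freeFlow (τ / 2) q x))) ξ)
      ((1 + lipConst δ (2 * K + 1) * τ) * H) := by
  have ht : t₀ ∈ Icc 0 T := ⟨h₀, by linarith⟩
  have ht' : t₀ + 0 ∈ Icc 0 T := by simpa using ht
  have bp := h.ae_norm_freeFlow_le ht hp hpE hpH hτ0 hsmall (τ / 2)
  have bq := h.symm.ae_norm_freeFlow_le ht hq hqE hqH hτ0 hsmall (τ / 2)
  have hs : |τ| ≤ 2 := by rw [abs_of_pos hτ0]; linarith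
  have bp' : ∀ᵐ x, ‖half a t₀ (τ / 2) 0 x‖ ≤ 2 * K + 1 := by
    filter_upwards [h.ae_norm_half_le ht' (τ / 2)] with x hx
    linarith
  have bq' : ∀ᵐ x, ‖half b t₀ (τ / 2) 0 x‖ ≤ 2 * K + 1 := by
    filter_upwards [h.symm.ae_norm_half_le ht' (τ / 2)] with x hx
    linarith
  have mp := memLp_freeFlow (τ / 2) p
  have mq := memLp_freeFlow (τ / 2) q
  constructor
  · have d1 := L2Bound.freeFlow_sub hp (h.memLp_left t₀ ht) hpE (τ / 2)
    have d2 := L2Bound.freeFlow_sub hq (h.memLp_right t₀ ht) hqE (τ / 2)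
    rw [h.half_zero_eq ht] at d1
    rw [h.symm.half_zero_eq ht] at d2
    have m1 := (h.l2Bound_half ht' (τ / 2)).memLp
    have m2 := (h.symm.l2Bound_half ht' (τ / 2)).memLp
    have d3 := L2Bound.nlFlow_sub (δ := δ) hτ0.le hτ mp.1 mq.1 m1.1 m2.1 bp bq bp' bq' d1 d2
    have d4 := L2Bound.freeFlow_sub (memLp_nlFlow hs mp mq bp bq)
      (memLp_nlFlow hs m1 m2 bp' bq') d3 (τ / 2)
    have d5 := h.local_error h₀ hτ0 hτ hT
    refine (d4.add d5).congr_ae (.of_forall fun x => ?_)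
    have e : frozen δ a b t₀ (τ / 2) τ =
      fun x => nlFlow δ τ (half a t₀ (τ / 2) 0 x) (half b t₀ (τ / 2) 0 x) := rfl
    rw [e]
    ring
  · exact (L2Bound.dsym_mul_fhat_nlFlow hτ0.le hτ mp mq bp bq (hpH.dsym_mul_fhat_freeFlow _)
      (hqH.dsym_mul_fhat_freeFlow _)).dsym_mul_fhat_freeFlow _

/-- The second component of a Strang step has the form of the first one. -/
theorem _root_.DNLS.strangStep_eq (δ τ : ℝ) (w : (ℝ → ℂ) × (ℝ → ℂ)) : strangStep δ τ w =
    (freeFlow (τ / 2) (fun x => nlFlow δ τ (freeFlow (τ / 2) w.1 x) (freeFlow (τ / 2) w.2 x)),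
      freeFlow (τ / 2) (fun x => nlFlow (-δ) τ (freeFlow (τ / 2) w.2 x)
        (freeFlow (τ / 2) w.1 x))) := by
  have h1 : (nonlinearFlow δ τ (linearFlow (τ / 2) w)).2 =
      fun x => nlFlow (-δ) τ (freeFlow (τ / 2) w.2 x) (freeFlow (τ / 2) w.1 x) := by
    ext x; rw [nonlinearFlow_snd]; rfl
  rw [strangStep, linearFlow, h1]; rfl

/-- `w` is within `E` of `z` in `L²`, and `‖∂ₓw‖ ≤ H` in `L²`, component by component. These bounds are
propagated along the iteration. -/
structure _root_.DNLS.Near (w z : (ℝ → ℂ) × (ℝ → ℂ)) (E H : ℝ) : Prop where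
  memLp_fst : MemLp w.1 2 volume
  memLp_snd : MemLp w.2 2 volume
  error_fst : L2Bound (fun x => w.1 x - z.1 x) E
  error_snd : L2Bound (fun x => w.2 x - z.2 x) E
  deriv_fst : L2Bound (fun ξ => dsym ξ * fhat w.1 ξ) H
  deriv_snd : L2Bound (fun ξ => dsym ξ * fhat w.2 ξ) H

theorem near_strangStep (h : Curve δ T K u v a b) (h₀ : 0 ≤ t₀) (hτ0 : 0 < τ) (hτ : τ ≤ 1)
    (hT : t₀ + τ ≤ T) {w : (ℝ → ℂ) × (ℝ → ℂ)} {E H : ℝ} (hw : Near w (u t₀, v t₀) E H)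
    (hsmall : 2 / √τ * (E + τ * (H + 7 * K)) ≤ 1) :
    Near (strangStep δ τ w) (u (t₀ + τ), v (t₀ + τ))
      ((1 + lipConst δ (2 * K + 1) * τ) * E + locConst δ K * τ ^ 3)
      ((1 + lipConst δ (2 * K + 1) * τ) * H) := by
  have h1 := h.step h₀ hτ0 hτ hT hw.memLp_fst hw.memLp_snd hw.error_fst hw.error_snd hw.deriv_fst
    hw.deriv_snd hsmall
  have h2 := h.symm.step h₀ hτ0 hτ hT hw.memLp_snd hw.memLp_fst hw.error_snd hw.error_fst
    hw.deriv_snd hw.deriv_fst hsmall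
  rw [lipConst_neg, locConst_neg] at h2
  rw [strangStep_eq]
  exact ⟨memLp_freeFlow _ _, memLp_freeFlow _ _, h1.1, h2.1, h1.2, h2.2⟩

theorem pairMemL2_nonlinearFlow (h : Curve δ T K u v a b) (ht : t₀ ∈ Icc 0 T) (hτ0 : 0 < τ)
    (hτ : τ ≤ 1) {w : (ℝ → ℂ) × (ℝ → ℂ)} {E H : ℝ} (hw : Near w (u t₀, v t₀) E H)
    (hsmall : 2 / √τ * (E + τ * (H + 7 * K)) ≤ 1) :
    PairMemL2 (nonlinearFlow δ τ (linearFlow (τ / 2) w)) := by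
  have bp := h.ae_norm_freeFlow_le ht hw.memLp_fst hw.error_fst hw.deriv_fst hτ0 hsmall (τ / 2)
  have bq := h.symm.ae_norm_freeFlow_le ht hw.memLp_snd hw.error_snd hw.deriv_snd hτ0 hsmall
    (τ / 2)
  have hs : |τ| ≤ 2 := by rw [abs_of_pos hτ0]; linarith
  refine ⟨memLp_nlFlow hs (memLp_freeFlow _ _) (memLp_freeFlow _ _) bp bq, ?_⟩
  have : (nonlinearFlow δ τ (linearFlow (τ / 2) w)).2 =
      fun x => nlFlow (-δ) τ (freeFlow (τ / 2) w.2 x) (freeFlow (τ / 2) w.1 x) := by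
    ext x; rw [nonlinearFlow_snd]; rfl
  rw [this]
  exact memLp_nlFlow hs (memLp_freeFlow _ _) (memLp_freeFlow _ _) bq bp

theorem near_initial (h : Curve δ T K u v a b) (ht : t₀ ∈ Icc 0 T) :
    Near (u t₀, v t₀) (u t₀, v t₀) 0 (7 * K) := by
  have hz : ∀ f : ℝ → ℂ, L2Bound (fun x => f x - f x) 0 := fun f => by
    simp only [sub_self]
    exact ⟨le_rfl, aestronglyMeasurable_const, by simp⟩
  have hd : ∀ {δ : ℝ} {u v a b : ℝ → ℝ → ℂ}, Curve δ T K u v a b →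
      L2Bound (fun ξ => dsym ξ * fhat (u t₀) ξ) (7 * K) := fun h => by
    refine ((h.bound_left t₀ ht).dsym_mul (by norm_num)).congr_ae ?_
    filter_upwards [h.fhat_left t₀ ht] with ξ e
    rw [e]
  exact ⟨h.memLp_left _ ht, h.memLp_right _ ht, hz _, hz _, hd h, hd h.symm⟩

end Curve

/-- Second-order convergence of the splitting scheme for the transformed unknowns. -/
theorem exists_near_iterate (δ T K : ℝ) (hT : 0 < T) (hK : 0 ≤ K) :
    ∃ C : ℝ, 0 ≤ C ∧ ∃ τ₀ : ℝ, 0 < τ₀ ∧ ∀ (u v a b : ℝ → ℝ → ℂ), Curve δ T K u v a b →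
      ∀ ψ₀ : ℝ → ℂ, transform δ ψ₀ = (u 0, v 0) → ∀ τ, 0 < τ → τ < τ₀ → ∀ n : ℕ, n * τ ≤ T →
        PairMemL2 (iterate δ τ ψ₀ n) ∧
        PairMemL2 (nonlinearFlow δ τ (linearFlow (τ / 2) (iterate δ τ ψ₀ n))) ∧
        L2Bound (fun x => (iterate δ τ ψ₀ n).1 x - u (n * τ) x) (C * τ ^ 2) := by
  set L := lipConst δ (2 * K + 1) with hLdef
  set c := locConst δ K with hcdef
  have hL : 0 ≤ L := lipConst_nonneg _ _
  have hc : 0 ≤ c := locConst_nonneg δ hK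
  set C := T * c * Real.exp (L * T) with hC
  set S := 2 * (C + (7 * K * Real.exp (L * T) + 7 * K)) + 1 with hS
  have hC0 : 0 ≤ C := by positivity
  have hS1 : 1 ≤ S := by
    have : 0 ≤ 7 * K * Real.exp (L * T) + 7 * K := by positivity
    linarith
  -- For `√τ S ≤ 1` the interpolated sup norm of the error is at most `1` in every step.
  refine ⟨C, hC0, (S ^ 2)⁻¹, by positivity, fun u v a b h ψ₀ hψ τ hτ0 hττ => ?_⟩
  have hτ1 : τ ≤ 1 := hττ.le.trans (inv_le_one_of_one_le₀ (one_le_pow₀ hS1))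
  have hsq : √τ * S ≤ 1 := by
    have h1 : √τ ≤ S⁻¹ := by
      rw [Real.sqrt_le_left (by positivity), inv_pow]
      exact hττ.le
    calc √τ * S ≤ S⁻¹ * S := by gcongr
      _ = 1 := inv_mul_cancel₀ (by positivity)
  have hEn : ∀ n : ℕ, n * τ ≤ T → n * τ * (c * τ ^ 2) * Real.exp (L * (n * τ)) ≤ C * τ ^ 2 := by
    intro n hn
    have : n * τ * (c * τ ^ 2) * Real.exp (L * (n * τ)) ≤ T * (c * τ ^ 2) * Real.exp (L * T) := by
      gcongr
    refine this.trans (le_of_eq ?_)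
    rw [hC]; ring
  have hsmall : ∀ n : ℕ, n * τ ≤ T → 2 / √τ * (n * τ * (c * τ ^ 2) * Real.exp (L * (n * τ)) +
      τ * (7 * K * Real.exp (L * (n * τ)) + 7 * K)) ≤ 1 := by
    intro n hn
    have h2 : 7 * K * Real.exp (L * (n * τ)) ≤ 7 * K * Real.exp (L * T) := by gcongr
    have h3 : C * τ ^ 2 ≤ C * τ := by
      refine mul_le_mul_of_nonneg_left ?_ hC0
      nlinarith
    have h4 : √τ * √τ = τ := Real.mul_self_sqrt hτ0.le
    have hs0 : 0 < √τ := Real.sqrt_pos.2 hτ0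
    calc _ ≤ 2 / √τ * (C * τ + τ * (7 * K * Real.exp (L * T) + 7 * K)) := by
            refine mul_le_mul_of_nonneg_left (add_le_add ((hEn n hn).trans h3) ?_) (by positivity)
            gcongr
      _ = τ / √τ * (S - 1) := by rw [hS]; ring
      _ = √τ * (S - 1) := by rw [Real.div_sqrt]
      _ ≤ 1 := by nlinarith
  have key : ∀ n : ℕ, n * τ ≤ T → Near (iterate δ τ ψ₀ n) (u (n * τ), v (n * τ))
      (n * τ * (c * τ ^ 2) * Real.exp (L * (n * τ))) (7 * K * Real.exp (L * (n * τ))) := by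
    intro n
    induction n with
    | zero =>
      intro _
      have := h.near_initial (t₀ := 0) ⟨le_rfl, hT.le⟩
      rw [← hψ] at this
      simpa [iterate, hψ] using this
    | succ n ih =>
      intro hn
      have hn' : n * τ ≤ T := by
        refine le_trans ?_ hn
        gcongr; simp
      have e : ((n + 1 : ℕ) : ℝ) * τ = n * τ + τ := by push_cast; ring
      rw [e] at hn ⊢
      have st := h.near_strangStep (by positivity) hτ0 hτ1 hn (ih hn') (hsmall n hn')
      have he : 1 + L * τ ≤ Real.exp (L * τ) := by
        have := Real.add_one_le_exp (L * τ); linarith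
      have hexp : Real.exp (L * (n * τ + τ)) = Real.exp (L * τ) * Real.exp (L * (n * τ)) := by
        rw [← Real.exp_add]; congr 1; ring
      have hge : 1 ≤ Real.exp (L * (n * τ + τ)) := Real.one_le_exp (by positivity)
      have b1 : (1 + L * τ) * (n * τ * (c * τ ^ 2) * Real.exp (L * (n * τ))) + c * τ ^ 3 ≤
          (n * τ + τ) * (c * τ ^ 2) * Real.exp (L * (n * τ + τ)) := by
        have i1 : (1 + L * τ) * (n * τ * (c * τ ^ 2) * Real.exp (L * (n * τ))) ≤
            Real.exp (L * τ) * (n * τ * (c * τ ^ 2) * Real.exp (L * (n * τ))) := by gcongr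
        have i2 : c * τ ^ 3 * 1 ≤ c * τ ^ 3 * Real.exp (L * (n * τ + τ)) := by gcongr
        rw [hexp] at i2 ⊢
        linarith
      have b2 : (1 + L * τ) * (7 * K * Real.exp (L * (n * τ))) ≤
          7 * K * Real.exp (L * (n * τ + τ)) := by
        have : (1 + L * τ) * (7 * K * Real.exp (L * (n * τ))) ≤
            Real.exp (L * τ) * (7 * K * Real.exp (L * (n * τ))) := by gcongr
        rw [hexp]; linarith
      exact ⟨st.memLp_fst, st.memLp_snd, st.error_fst.mono b1, st.error_snd.mono b1,
        st.deriv_fst.mono b2, st.deriv_snd.mono b2⟩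
  intro n hn
  have hk := key n hn
  exact ⟨⟨hk.memLp_fst, hk.memLp_snd⟩, h.pairMemL2_nonlinearFlow ⟨by positivity, hn⟩ hτ0 hτ1 hk
    (hsmall n hn), hk.error_fst.mono (hEn n hn)⟩

end DNLS

namespace DNLS

/-! ### Sobolev regularity -/

/-- `f` is continuous and `‖(1 + |ξ|)^j f̂‖_{L²} ≤ K`. -/
structure Sob (j : ℕ) (f : ℝ → ℂ) (K : ℝ) : Prop where
  cont : Continuous f
  memLp : MemLp f 2 volume
  bound : FBound j (fhat f) K

theorem FBound.congr_ae {q : ℕ} {A B : ℝ → ℂ} {α : ℝ} (h : FBound q A α) (hB : Measurable B)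
    (hAB : A =ᵐ[volume] B) : FBound q B α := by
  refine ⟨hB, h.bound.congr_ae ?_⟩
  filter_upwards [hAB] with ξ e
  rw [e]

theorem abs_le_norm_dsym (ξ : ℝ) : |ξ| ≤ ‖dsym ξ‖ := by
  simp only [dsym, norm_mul, Complex.norm_ofNat, Complex.norm_real, Complex.norm_I,
    Real.norm_eq_abs, abs_of_pos Real.pi_pos, mul_one]
  nlinarith [abs_nonneg ξ, Real.pi_gt_three]

theorem norm_dsym_le (ξ : ℝ) : ‖dsym ξ‖ ≤ 7 * |ξ| := by
  simp only [dsym, norm_mul, Complex.norm_ofNat, Complex.norm_real, Complex.norm_I,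
    Real.norm_eq_abs, abs_of_pos Real.pi_pos, mul_one]
  nlinarith [abs_nonneg ξ, Real.pi_lt_d2]

theorem continuous_dsym : Continuous dsym := by unfold dsym; fun_prop

theorem FBound.dsym_mul_fBound {A : ℝ → ℂ} {α : ℝ} {q : ℕ} (h : FBound (q + 1) A α) :
    FBound q (fun ξ => dsym ξ * A ξ) (7 * α) := by
  have hm : Measurable fun ξ => dsym ξ * A ξ := continuous_dsym.measurable.mul h.meas
  refine ⟨hm, h.bound.of_norm_le (by norm_num) ?_ (.of_forall fun ξ => ?_)⟩
  · exact ((Complex.continuous_ofReal.comp (continuous_wt.pow q)).measurable.mul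
      hm).aestronglyMeasurable
  · have hw := wt_pos ξ
    have hd := norm_dsym_le ξ
    have h3 : |ξ| ≤ wt ξ := by rw [wt]; linarith
    simp only [norm_mul, Complex.norm_real, Real.norm_eq_abs, abs_pow, abs_of_pos hw]
    have h4 : ‖dsym ξ‖ ≤ 7 * wt ξ := by linarith
    calc wt ξ ^ q * (‖dsym ξ‖ * ‖A ξ‖) ≤ wt ξ ^ q * (7 * wt ξ * ‖A ξ‖) := by gcongr
      _ = _ := by ring

theorem hasDerivAt_fourierInv {A : ℝ → ℂ} (hi : Integrable A)
    (hi' : Integrable fun ξ => dsym ξ * A ξ) (x : ℝ) :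
    HasDerivAt (𝓕⁻ A) (𝓕⁻ (fun ξ => dsym ξ * A ξ) x) x := by
  have hg : Integrable (fun ξ => A (-ξ)) := hi.comp_neg
  have hg' : Integrable (fun ξ : ℝ => ξ • A (-ξ)) := by
    have h1 : Integrable fun ξ : ℝ => dsym ξ * A (-ξ) := by
      refine (hi'.comp_neg).neg.congr (.of_forall fun ξ => ?_)
      simp [dsym]
    refine h1.mono ?_ (.of_forall fun ξ => ?_)
    · exact (continuous_id.aestronglyMeasurable.smul hg.1)
    · rw [norm_smul, norm_mul, Real.norm_eq_abs]
      gcongr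
      exact abs_le_norm_dsym ξ
  have h1 := Real.hasDerivAt_fourier hg hg' x
  have e : ∀ A : ℝ → ℂ, 𝓕⁻ A = 𝓕 fun ξ => A (-ξ) := fun A => Real.fourierInv_eq_fourier_comp_neg A
  rw [e, e]
  refine h1.congr_deriv ?_
  refine congrFun (congrArg _ (funext fun ξ => ?_)) x
  simp only [dsym, smul_eq_mul]
  push_cast; ring

namespace Sob

variable {j : ℕ} {f g h : ℝ → ℂ} {α β γ : ℝ}

theorem mono (hf : Sob j f α) (hαβ : α ≤ β) : Sob j f β := ⟨hf.cont, hf.memLp, hf.bound.mono_le hαβ⟩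

theorem mono_weight {i : ℕ} (hf : Sob j f α) (hi : i ≤ j) : Sob i f α :=
  ⟨hf.cont, hf.memLp, hf.bound.mono_weight hi⟩

theorem l2Bound (hf : Sob j f α) : L2Bound f α := L2Bound.of_fhat hf.memLp hf.bound.l2Bound

theorem sub (hf : Sob j f α) (hg : Sob j g β) : Sob j (fun x => f x - g x) (α + β) :=
  ⟨hf.cont.sub hg.cont, hf.memLp.sub hg.memLp, (hf.bound.sub hg.bound).congr_ae
    (measurable_fhat _) (fhat_sub hf.memLp hg.memLp).symm⟩

theorem const_mul (c : ℂ) (hf : Sob j f α) : Sob j (fun x => c * f x) (‖c‖ * α) :=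
  ⟨continuous_const.mul hf.cont, hf.memLp.const_mul c,
    (hf.bound.of_norm_le (norm_nonneg c) ((measurable_fhat f).const_mul c)
      (fun _ => (norm_mul _ _).le)).congr_ae (measurable_fhat _)
      (fhat_const_mul c hf.memLp).symm⟩

/-- Fourier inversion holds at every point. -/
theorem eq_fourierInv (hf : Sob (j + 1) f α) (x : ℝ) : f x = 𝓕⁻ (fhat f) x := by
  have hi := (hf.bound.integrable (by omega)).1
  have h1 : f =ᵐ[volume] 𝓕⁻ (fhat f) :=
    (finv_fhat hf.memLp).symm.trans (finv_eq_fourierInv hi (memLp_fhat f))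
  exact congrFun ((Continuous.ae_eq_iff_eq volume hf.cont (continuous_fourierInv hi)).1 h1) x

theorem norm_le (hf : Sob (j + 1) f α) (x : ℝ) : ‖f x‖ ≤ 2 * α := by
  rw [hf.eq_fourierInv x]
  exact (norm_fourierInv_le x).trans (hf.bound.integrable (by omega)).2

theorem mul_conj_mul (hf : Sob (j + 1) f α) (hg : Sob (j + 1) g β) (hh : Sob (j + 1) h γ) :
    Sob (j + 1) (fun x => f x * conj (g x) * h x) (12 * 3 ^ (j + 1) * α * β * γ) := by
  have key := fhat_mul_conj_mul (hf.bound.mono_weight (by omega)) (hg.bound.mono_weight (by omega))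
    (hh.bound.mono_weight (by omega)) (finv_fhat hf.memLp).symm (finv_fhat hg.memLp).symm
    (finv_fhat hh.memLp).symm
  refine ⟨?_, key.1, ?_⟩
  · exact (hf.cont.mul (Complex.continuous_conj.comp hg.cont)).mul hh.cont
  · exact (fBound_kernelOp (by unfold MeasKernel; fun_prop) (by omega) (fun _ _ _ => by simp)
      hf.bound hg.bound.refl hh.bound).congr_ae (measurable_fhat _) key.2.symm

/-- `2πiξ f̂` is integrable for `f ∈ H²`, so `f' = 𝓕⁻(2πiξ f̂)` at every point. -/
theorem deriv (hf : Sob (j + 2) f α) :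
    (∀ x, HasDerivAt f (deriv f x) x) ∧ Sob (j + 1) (deriv f) (7 * α) := by
  have hB := hf.bound.dsym_mul_fBound
  have hi := (hf.bound.integrable (by omega)).1
  have hi' := (hB.integrable (by omega)).1
  have hd : ∀ x, HasDerivAt f (𝓕⁻ (fun ξ => dsym ξ * fhat f ξ) x) x := by
    intro x
    have hfe : f = 𝓕⁻ (fhat f) := funext fun x => hf.eq_fourierInv x
    have := hasDerivAt_fourierInv hi hi' x
    rwa [← hfe] at this
  have he : _root_.deriv f = 𝓕⁻ (fun ξ => dsym ξ * fhat f ξ) := funext fun x => (hd x).deriv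
  have hm : MemLp (_root_.deriv f) 2 volume := by
    rw [he]
    exact (memLp_congr_ae (finv_eq_fourierInv hi' hB.l2Bound.memLp)).1 (memLp_finv _)
  have hd' : ∀ x, HasDerivAt f (_root_.deriv f x) x := fun x => by rw [he]; exact hd x
  refine ⟨hd', ?_, hm, ?_⟩
  · rw [he]; exact continuous_fourierInv hi'
  · exact hB.congr_ae (measurable_fhat _) (fhat_deriv hd' hf.memLp hm).symm

theorem of_deriv {f' : ℝ → ℂ} (hd : ∀ x, HasDerivAt f (f' x) x) (hf : Sob j f α)
    (hf' : Sob j f' β) : Sob (j + 1) f (α + β) := by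
  refine ⟨hf.cont, hf.memLp, measurable_fhat f, ?_⟩
  have := L2Bound.of_norm_le_add (K := 1) (L := 1) zero_le_one zero_le_one hf.bound.bound
    hf'.bound.bound (u := fun ξ => ((wt ξ ^ (j + 1) : ℝ) : ℂ) * fhat f ξ) ?_ ?_
  · simpa using this
  · exact ((Complex.continuous_ofReal.comp (continuous_wt.pow (j + 1))).measurable.mul
      (measurable_fhat f)).aestronglyMeasurable
  · filter_upwards [fhat_deriv hd hf.memLp hf'.memLp] with ξ e
    rw [e]
    have hw := wt_pos ξ
    simp only [norm_mul, Complex.norm_real, Real.norm_eq_abs, abs_pow, abs_of_pos hw, one_mul]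
    have h2 : wt ξ ^ j * (|ξ| * ‖fhat f ξ‖) ≤ wt ξ ^ j * (‖dsym ξ‖ * ‖fhat f ξ‖) := by
      gcongr
      exact abs_le_norm_dsym ξ
    calc wt ξ ^ (j + 1) * ‖fhat f ξ‖ = wt ξ ^ j * ‖fhat f ξ‖ + wt ξ ^ j * (|ξ| * ‖fhat f ξ‖) := by
          rw [pow_succ, wt]; ring
      _ ≤ _ := by linarith

end Sob

/-- Multiplication by a unimodular `G` with `G' = l|ψ|²G` loses at most one derivative: by
`(Gg)' = G(g' + l|ψ|²g)` the claim for `Gg` in `H^{j+1}` reduces to two instances of the claim in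
`H^j`. The bound does not depend on the functions. -/
theorem exists_sob_gauge_mul (l : ℂ) (j : ℕ) (α β : ℝ) : ∃ K : ℝ, ∀ ψ g G : ℝ → ℂ,
    Sob (j + 1) ψ α → Sob (j + 1) g β → (∀ x, ‖G x‖ = 1) →
    (∀ x, HasDerivAt G (l * (ψ x * conj (ψ x)) * G x) x) → Sob j (fun x => G x * g x) K := by
  induction j generalizing β with
  | zero =>
    refine ⟨β, fun ψ g G hψ hg hG hd => ?_⟩
    have hc : Continuous G := continuous_iff_continuousAt.2 fun x => (hd x).continuousAt
    have hm : L2Bound (fun x => G x * g x) β :=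
      hg.l2Bound.of_norm_le_one (hc.mul hg.cont).aestronglyMeasurable
        (.of_forall fun x => by rw [norm_mul, hG, one_mul])
    exact ⟨hc.mul hg.cont, hm.memLp, .of_l2Bound (measurable_fhat _) hm.fhat⟩
  | succ j ih =>
    obtain ⟨K₁, h₁⟩ := ih β
    obtain ⟨K₂, h₂⟩ := ih (7 * β + ‖-l‖ * (12 * 3 ^ (j + 1) * α * α * β))
    refine ⟨K₁ + K₂, fun ψ g G hψ hg hG hd => ?_⟩
    have hψ' := hψ.mono_weight (i := j + 1) (by omega)
    have hg' := hg.mono_weight (i := j + 1) (by omega)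
    have s1 := h₁ ψ g G hψ' hg' hG hd
    have s2 := h₂ ψ _ G hψ' (hg.deriv.2.sub ((hψ'.mul_conj_mul hψ' hg').const_mul (-l))) hG hd
    refine Sob.of_deriv (fun x => ?_) s1 s2
    refine ((hd x).mul (hg.deriv.1 x)).congr_deriv ?_
    ring

/-! ### Consequences of a bound in `Σᵏ` -/

theorem memLp_of_sigmaNorm_le {k : ℕ} {f : ℝ → ℂ} {M : ℝ≥0} (h : sigmaNorm k f ≤ M) :
    MemLp f 2 volume ∧ sobolevNorm k (toL2 f) ≤ M ∧
      eLpNorm (fun x : ℝ => (|x| ^ k : ℝ) • f x) 2 volume ≤ M := by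
  unfold sigmaNorm at h
  by_cases hf : MemLp f 2 volume
  · rw [if_pos hf] at h
    exact ⟨hf, le_self_add.trans h, le_add_self.trans h⟩
  · rw [if_neg hf] at h
    simp at h

theorem sob_of_sigmaNorm_le {k : ℕ} (hk : 6 ≤ k) {f : ℝ → ℂ} (hc : Continuous f) {M : ℝ≥0}
    (h : sigmaNorm k f ≤ M) : Sob 6 f (8 * M) := by
  obtain ⟨hf, hs, -⟩ := memLp_of_sigmaNorm_le h
  refine ⟨hc, hf, measurable_fhat f, L2Bound.of_lintegral_le (by positivity) ?_ ?_⟩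
  · exact ((Complex.continuous_ofReal.comp (continuous_wt.pow 6)).measurable.mul
      (measurable_fhat f)).aestronglyMeasurable
  have h2 : ∫⁻ ξ : ℝ, ENNReal.ofReal ((1 + (2 * Real.pi * ξ) ^ 2) ^ k) * ‖fhat f ξ‖ₑ ^ 2 ≤
      (M : ℝ≥0∞) ^ 2 := by
    have := ENNReal.rpow_le_rpow hs (z := 2) (by norm_num)
    rw [sobolevNorm, ← ENNReal.rpow_mul] at this
    norm_num at this
    exact this
  have hpt : ∀ ξ : ℝ, ‖((wt ξ ^ 6 : ℝ) : ℂ) * fhat f ξ‖ₑ ^ 2 ≤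
      64 * (ENNReal.ofReal ((1 + (2 * Real.pi * ξ) ^ 2) ^ k) * ‖fhat f ξ‖ₑ ^ 2) := by
    intro ξ
    have hw := wt_pos ξ
    have e1 : ‖((wt ξ ^ 6 : ℝ) : ℂ)‖ₑ ^ 2 = ENNReal.ofReal (wt ξ ^ 12) := by
      rw [← ofReal_norm, Complex.norm_real, Real.norm_of_nonneg (by positivity),
        ← ENNReal.ofReal_pow (by positivity), ← pow_mul]
    rw [enorm_mul, mul_pow, e1, ← mul_assoc]
    gcongr
    rw [show (64 : ℝ≥0∞) = ENNReal.ofReal 64 by norm_num, ← ENNReal.ofReal_mul (by norm_num)]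
    refine ENNReal.ofReal_le_ofReal ?_
    have h1 : wt ξ ^ 2 ≤ 2 * (1 + (2 * Real.pi * ξ) ^ 2) := by
      rw [wt]
      have a1 : (2 * Real.pi * ξ) ^ 2 = (2 * Real.pi) ^ 2 * |ξ| ^ 2 := by rw [sq_abs]; ring
      have a2 : 1 ≤ (2 * Real.pi) ^ 2 := by nlinarith [Real.pi_gt_three]
      rw [a1]
      nlinarith [sq_nonneg (|ξ| - 1), mul_le_mul_of_nonneg_right a2 (sq_nonneg |ξ|)]
    calc wt ξ ^ 12 = (wt ξ ^ 2) ^ 6 := by ring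
      _ ≤ (2 * (1 + (2 * Real.pi * ξ) ^ 2)) ^ 6 := by gcongr
      _ = 64 * (1 + (2 * Real.pi * ξ) ^ 2) ^ 6 := by ring
      _ ≤ 64 * (1 + (2 * Real.pi * ξ) ^ 2) ^ k := by
          gcongr
          exact le_add_of_nonneg_right (sq_nonneg _)
  calc ∫⁻ ξ : ℝ, ‖((wt ξ ^ 6 : ℝ) : ℂ) * fhat f ξ‖ₑ ^ 2
      ≤ ∫⁻ ξ : ℝ, 64 * (ENNReal.ofReal ((1 + (2 * Real.pi * ξ) ^ 2) ^ k) * ‖fhat f ξ‖ₑ ^ 2) :=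
        lintegral_mono hpt
    _ = 64 * ∫⁻ ξ : ℝ, (ENNReal.ofReal ((1 + (2 * Real.pi * ξ) ^ 2) ^ k) * ‖fhat f ξ‖ₑ ^ 2) :=
        lintegral_const_mul' _ _ (by norm_num)
    _ ≤ 64 * (M : ℝ≥0∞) ^ 2 := by gcongr
    _ = ENNReal.ofReal ((8 * (M : ℝ)) ^ 2) := by
        rw [mul_pow, ENNReal.ofReal_mul (by norm_num), ← ENNReal.ofReal_coe_nnreal,
          ENNReal.ofReal_pow M.coe_nonneg]
        norm_num

theorem l2Bound_pow_mul_of_sigmaNorm_le {k : ℕ} (hk : 6 ≤ k) {f : ℝ → ℂ} (hc : Continuous f)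
    {M : ℝ≥0} (h : sigmaNorm k f ≤ M) : L2Bound (fun x => ((|x| ^ 6 : ℝ) : ℂ) * f x) (9 * M) := by
  obtain ⟨hf, -, hs⟩ := memLp_of_sigmaNorm_le h
  have h1 : L2Bound (fun x : ℝ => (|x| ^ k : ℝ) • f x) M :=
    ⟨M.2, (Continuous.aestronglyMeasurable (by fun_prop)), by simpa using hs⟩
  have h2 := (sob_of_sigmaNorm_le hk hc h).l2Bound
  have := L2Bound.of_norm_le_add (K := 1) (L := 1) zero_le_one zero_le_one h2 h1
    (u := fun x => ((|x| ^ 6 : ℝ) : ℂ) * f x) (Continuous.aestronglyMeasurable (by fun_prop))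
    (.of_forall fun x => ?_)
  · exact this.mono (by linarith)
  · rw [norm_mul, norm_smul, Complex.norm_real, Real.norm_of_nonneg (by positivity),
      Real.norm_of_nonneg (by positivity)]
    have h3 : |x| ^ 6 ≤ 1 + |x| ^ k := by
      rcases le_total |x| 1 with h | h
      · have := pow_le_one₀ (n := 6) (abs_nonneg x) h
        have : 0 ≤ |x| ^ k := by positivity
        linarith
      · have := pow_le_pow_right₀ h hk
        linarith
    nlinarith [norm_nonneg (f x)]

end DNLS

namespace DNLS

/-! ### Pointwise decay -/

/-- A Lipschitz function with `|x|⁶ f ∈ L²` decays like `|x|⁻⁴`: near a point where `|f|` equals `m`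
it stays above `m / 2` on an interval of length comparable to `m`. -/
theorem pow_mul_norm_le {f : ℝ → ℂ} {Λ A : ℝ} (hΛ : 0 < Λ)
    (hLip : ∀ x y, ‖f y - f x‖ ≤ Λ * |y - x|)
    (hA : L2Bound (fun x => ((|x| ^ 6 : ℝ) : ℂ) * f x) A) (x : ℝ) :
    x ^ 4 * ‖f x‖ ≤ 1 + 8 * Λ * A ^ 2 := by
  set m := ‖f x‖ with hm
  have hm0 : 0 ≤ m := norm_nonneg _
  set r := m / (2 * Λ) with hr
  have hr0 : 0 ≤ r := by positivity
  have hrm : Λ * r = m / 2 := by rw [hr]; field_simp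
  obtain ⟨I, hI, hIv, hIx⟩ : ∃ I : Set ℝ, MeasurableSet I ∧ volume I = ENNReal.ofReal r ∧
      ∀ y ∈ I, |x| ≤ |y| ∧ |y - x| ≤ r := by
    rcases le_total 0 x with h | h
    · refine ⟨Icc x (x + r), measurableSet_Icc, by rw [Real.volume_Icc]; congr 1; ring,
        fun y hy => ⟨?_, ?_⟩⟩
      · rw [abs_of_nonneg h, abs_of_nonneg (h.trans hy.1)]; exact hy.1
      · rw [abs_of_nonneg (by linarith [hy.1])]; linarith [hy.2]
    · refine ⟨Icc (x - r) x, measurableSet_Icc, by rw [Real.volume_Icc]; congr 1; ring,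
        fun y hy => ⟨?_, ?_⟩⟩
      · rw [abs_of_nonpos h, abs_of_nonpos (hy.2.trans h)]; linarith [hy.2]
      · rw [abs_of_nonpos (by linarith [hy.2])]; linarith [hy.1]
  have h1 : ENNReal.ofReal ((|x| ^ 6 * (m / 2)) ^ 2) * ENNReal.ofReal r ≤
      ENNReal.ofReal (A ^ 2) := by
    refine le_trans ?_ hA.lintegral_le
    refine le_trans ?_ (setLIntegral_le_lintegral I _)
    rw [← hIv, ← setLIntegral_const]
    refine setLIntegral_mono' hI fun y hy => ?_
    rw [← ofReal_norm, ← ENNReal.ofReal_pow (norm_nonneg _)]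
    refine ENNReal.ofReal_le_ofReal (pow_le_pow_left₀ (by positivity) ?_ 2)
    rw [norm_mul, Complex.norm_real, Real.norm_of_nonneg (by positivity)]
    obtain ⟨a1, a2⟩ := hIx y hy
    have a3 : m - ‖f y‖ ≤ m / 2 := by
      have := norm_sub_norm_le (f x) (f y)
      rw [norm_sub_rev] at this
      have h2 := (hLip x y).trans (mul_le_mul_of_nonneg_left a2 hΛ.le)
      linarith
    have a4 : m / 2 ≤ ‖f y‖ := by linarith
    gcongr
  rw [← ENNReal.ofReal_mul (by positivity), ENNReal.ofReal_le_ofReal_iff (by positivity)] at h1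
  have h2 : (x ^ 4 * m) ^ 3 ≤ 8 * Λ * A ^ 2 := by
    have e : (x ^ 4 * m) ^ 3 = 8 * Λ * ((|x| ^ 6 * (m / 2)) ^ 2 * r) := by
      have e1 : (|x| ^ 6) ^ 2 = x ^ 12 := by
        rw [← pow_mul, show 6 * 2 = 2 * 6 by norm_num, pow_mul, sq_abs]; ring
      rw [mul_pow (|x| ^ 6), e1, hr]
      field_simp
      ring
    rw [e]; gcongr
  by_contra! hlt
  have hz : 1 ≤ x ^ 4 * m := by
    have : 0 ≤ 8 * Λ * A ^ 2 := by positivity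
    linarith
  have := le_self_pow₀ hz (n := 3) (by norm_num)
  linarith

theorem norm_le_of_deriv_le {f f' : ℝ → ℂ} {x B : ℝ} {n : ℕ} (hB : 0 ≤ B)
    (hd : ∀ y, HasDerivAt f (f' y) y) (hx : f x = 0) (hle : ∀ y, ‖f' y‖ ≤ B * |y - x| ^ n) (y : ℝ) :
    ‖f y‖ ≤ B * |y - x| ^ (n + 1) := by
  have h := Convex.norm_image_sub_le_of_norm_hasDerivWithin_le (s := uIcc x y) (f := f) (f' := f')
    (C := B * |y - x| ^ n) (fun z _ => (hd z).hasDerivWithinAt) (fun z hz => ?_)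
    (convex_uIcc x y) left_mem_uIcc right_mem_uIcc
  · rw [hx, sub_zero, Real.norm_eq_abs] at h
    rw [pow_succ, ← mul_assoc]; exact h
  · refine (hle z).trans ?_
    have := abs_sub_left_of_mem_uIcc hz
    gcongr

theorem one_add_sq_le {x h : ℝ} (hh : |h| ≤ 1) : 1 + x ^ 2 ≤ 3 * (1 + (x + h) ^ 2) := by
  have : h ^ 2 ≤ 1 := by rw [← sq_abs]; exact pow_le_one₀ (abs_nonneg h) hh
  nlinarith [sq_nonneg (x + 2 * h)]

section landau

variable {f f₁ f₂ f₃ f₄ : ℝ → ℂ} {B C x : ℝ}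

theorem norm_translate_le (hC : ∀ y, ‖f y‖ * (1 + y ^ 2) ^ 2 ≤ C) {h : ℝ} (hh : |h| ≤ 1) :
    ‖f (x + h)‖ * (1 + x ^ 2) ^ 2 ≤ 9 * C := by
  have h1 := pow_le_pow_left₀ (by positivity) (one_add_sq_le (x := x) hh) 2
  have h2 := mul_le_mul_of_nonneg_left h1 (norm_nonneg (f (x + h)))
  have h3 := hC (x + h)
  rw [mul_pow] at h2
  linarith

/-- Decay of a function and a bound on its second derivative give decay of the first derivative. -/
theorem norm_deriv_decay (hB : 0 ≤ B) (h1 : ∀ y, HasDerivAt f (f₁ y) y)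
    (h2 : ∀ y, HasDerivAt f₁ (f₂ y) y) (hb : ∀ y, ‖f₂ y‖ ≤ B)
    (hC : ∀ y, ‖f y‖ * (1 + y ^ 2) ^ 2 ≤ C) (x : ℝ) : ‖f₁ x‖ * (1 + x ^ 2) ≤ 10 * C + B := by
  set w := 1 + x ^ 2 with hw
  have hw0 : 0 < w := by positivity
  have hw1 : 1 ≤ w := by rw [hw]; nlinarith [sq_nonneg x]
  -- The step `1 / w` balances the two contributions `‖f‖ w` and `B / w`.
  have hh : |w⁻¹| ≤ 1 := by rw [abs_of_pos (by positivity)]; exact inv_le_one_of_one_le₀ hw1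
  have r1 : ∀ y, ‖f₁ y - f₁ x‖ ≤ B * |y - x| ^ 1 :=
    norm_le_of_deriv_le (f' := f₂) hB (fun y => (h2 y).sub_const _) (sub_self _)
      (fun y => by simpa using hb y)
  have r2 : ∀ y, ‖f y - f x - ((y - x : ℝ) : ℂ) * f₁ x‖ ≤ B * |y - x| ^ 2 := by
    refine norm_le_of_deriv_le (f' := fun y => f₁ y - f₁ x) hB (fun y => ?_) (by simp) r1
    have e : HasDerivAt (fun y : ℝ => ((y - x : ℝ) : ℂ) * f₁ x) (((1 : ℝ) : ℂ) * f₁ x) y :=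
      (((hasDerivAt_id y).sub_const x).ofReal_comp).mul_const _
    refine (((h1 y).sub_const (f x)).sub e).congr_deriv (by simp)
  have r3 := r2 (x + w⁻¹)
  rw [add_sub_cancel_left, abs_of_pos (inv_pos.2 hw0)] at r3
  have a1 := norm_translate_le (x := x) hC hh
  have a2 := hC x
  rw [← hw] at a1 a2
  have e : ((w⁻¹ : ℝ) : ℂ) * f₁ x =
      f (x + w⁻¹) - f x - (f (x + w⁻¹) - f x - ((w⁻¹ : ℝ) : ℂ) * f₁ x) := by ring
  have r4 : w⁻¹ * ‖f₁ x‖ ≤ ‖f (x + w⁻¹)‖ + ‖f x‖ + B * w⁻¹ ^ 2 := by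
    have := congrArg norm e
    rw [norm_mul, Complex.norm_real, Real.norm_of_nonneg (by positivity)] at this
    rw [this]
    exact (norm_sub_le _ _).trans (add_le_add (norm_sub_le _ _) r3)
  have r5 := mul_le_mul_of_nonneg_right r4 (sq_nonneg w)
  have e2 : w⁻¹ * ‖f₁ x‖ * w ^ 2 = ‖f₁ x‖ * w := by field_simp
  have e3 : B * w⁻¹ ^ 2 * w ^ 2 = B := by field_simp
  nlinarith

/-- Decay of a function and a bound on its fourth derivative give decay of the second derivative. -/
theorem norm_deriv2_decay (hB : 0 ≤ B) (h1 : ∀ y, HasDerivAt f (f₁ y) y)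
    (h2 : ∀ y, HasDerivAt f₁ (f₂ y) y) (h3 : ∀ y, HasDerivAt f₂ (f₃ y) y)
    (h4 : ∀ y, HasDerivAt f₃ (f₄ y) y) (hb : ∀ y, ‖f₄ y‖ ≤ B)
    (hC : ∀ y, ‖f y‖ * (1 + y ^ 2) ^ 2 ≤ C) (x : ℝ) :
    ‖f₂ x‖ * (1 + x ^ 2) ≤ 20 * C + 2 * B := by
  set w := 1 + x ^ 2 with hw
  have hw0 : 0 < w := by positivity
  have hw1 : 1 ≤ w := by rw [hw]; nlinarith [sq_nonneg x]
  -- The step `h = w^{-1/2}` balances the two contributions `‖f‖ / h²` and `B h²`.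
  set h := √w⁻¹ with hh
  have hh0 : 0 ≤ h := Real.sqrt_nonneg _
  have hhw : h ^ 2 = w⁻¹ := Real.sq_sqrt (by positivity)
  have hh1 : |h| ≤ 1 := by
    rw [abs_of_nonneg hh0, hh]
    exact Real.sqrt_le_one.2 (inv_le_one_of_one_le₀ hw1)
  have r1 : ∀ y, ‖f₃ y - f₃ x‖ ≤ B * |y - x| ^ 1 :=
    norm_le_of_deriv_le (f' := f₄) hB (fun y => (h4 y).sub_const _) (sub_self _)
      (fun y => by simpa using hb y)
  have hl : ∀ y, HasDerivAt (fun y : ℝ => ((y - x : ℝ) : ℂ)) 1 y := fun y => by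
    simpa using ((hasDerivAt_id y).sub_const x).ofReal_comp
  have r2 : ∀ y, ‖f₂ y - f₂ x - ((y - x : ℝ) : ℂ) * f₃ x‖ ≤ B * |y - x| ^ 2 := by
    refine norm_le_of_deriv_le (f' := fun y => f₃ y - f₃ x) hB (fun y => ?_) (by simp) r1
    exact (((h3 y).sub_const _).sub ((hl y).mul_const _)).congr_deriv (by simp)
  have r3 : ∀ y, ‖f₁ y - f₁ x - ((y - x : ℝ) : ℂ) * f₂ x - ((y - x : ℝ) : ℂ) ^ 2 * (f₃ x / 2)‖ ≤
      B * |y - x| ^ 3 := by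
    refine norm_le_of_deriv_le (f' := fun y => f₂ y - f₂ x - ((y - x : ℝ) : ℂ) * f₃ x) hB
      (fun y => ?_) (by simp) r2
    refine ((((h2 y).sub_const _).sub ((hl y).mul_const _)).sub
      (((hl y).fun_pow 2).mul_const _)).congr_deriv ?_
    push_cast; ring
  have r4 : ∀ y, ‖f y - f x - ((y - x : ℝ) : ℂ) * f₁ x - ((y - x : ℝ) : ℂ) ^ 2 * (f₂ x / 2) -
      ((y - x : ℝ) : ℂ) ^ 3 * (f₃ x / 6)‖ ≤ B * |y - x| ^ 4 := by
    refine norm_le_of_deriv_le (f' := fun y => f₁ y - f₁ x - ((y - x : ℝ) : ℂ) * f₂ x -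
      ((y - x : ℝ) : ℂ) ^ 2 * (f₃ x / 2)) hB (fun y => ?_) (by simp) r3
    refine (((((h1 y).sub_const _).sub ((hl y).mul_const _)).sub
      (((hl y).fun_pow 2).mul_const _)).sub (((hl y).fun_pow 3).mul_const _)).congr_deriv ?_
    push_cast; ring
  -- The odd terms of the expansions at `x + h` and `x - h` cancel.
  have p := r4 (x + h)
  have q := r4 (x + -h)
  rw [add_sub_cancel_left] at p q
  rw [abs_neg] at q
  have e4 : |h| ^ 4 = w⁻¹ ^ 2 := by rw [abs_of_nonneg hh0, ← hhw]; ring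
  rw [e4] at p q
  have a1 := norm_translate_le (x := x) hC hh1
  have a2 := norm_translate_le (x := x) hC (h := -h) (by rwa [abs_neg])
  have a3 := hC x
  rw [← hw] at a1 a2 a3
  set P := f (x + h) - f x - ((h : ℝ) : ℂ) * f₁ x - ((h : ℝ) : ℂ) ^ 2 * (f₂ x / 2) -
      ((h : ℝ) : ℂ) ^ 3 * (f₃ x / 6)
  set Q := f (x + -h) - f x - ((-h : ℝ) : ℂ) * f₁ x - ((-h : ℝ) : ℂ) ^ 2 * (f₂ x / 2) -
      ((-h : ℝ) : ℂ) ^ 3 * (f₃ x / 6) with hQ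
  have e : ((h ^ 2 : ℝ) : ℂ) * f₂ x = f (x + h) + f (x + -h) - 2 * f x - (P + Q) := by
    simp only [P, hQ]; push_cast; ring
  have r5 : w⁻¹ * ‖f₂ x‖ ≤ ‖f (x + h)‖ + ‖f (x + -h)‖ + 2 * ‖f x‖ +
      (B * w⁻¹ ^ 2 + B * w⁻¹ ^ 2) := by
    have := congrArg norm e
    rw [norm_mul, Complex.norm_real, Real.norm_of_nonneg (by positivity), hhw] at this
    rw [this]
    refine (norm_sub_le _ _).trans (add_le_add ?_ ((norm_add_le _ _).trans (add_le_add p q)))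
    refine (norm_sub_le _ _).trans (add_le_add (norm_add_le _ _) ?_)
    rw [norm_mul, Complex.norm_ofNat]
  have r6 := mul_le_mul_of_nonneg_right r5 (sq_nonneg w)
  have e2 : w⁻¹ * ‖f₂ x‖ * w ^ 2 = ‖f₂ x‖ * w := by field_simp
  have e3 : B * w⁻¹ ^ 2 * w ^ 2 = B := by field_simp
  nlinarith

end landau

/-- `f` is dominated by `C / (1 + x²)`. -/
def Decays (f : ℝ → ℂ) (C : ℝ) : Prop := ∀ x, ‖f x‖ * (1 + x ^ 2) ≤ C

/-- Everything that is used about a function of bounded `Σᵏ`-norm, `k ≥ 6`. -/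
structure Regular (f : ℝ → ℂ) (K : ℝ) : Prop where
  sob : Sob 6 f K
  hasDerivAt : ∀ x, HasDerivAt f (deriv f x) x
  hasDerivAt_deriv : ∀ x, HasDerivAt (deriv f) (deriv (deriv f) x) x
  continuous_deriv2 : Continuous (deriv (deriv f))
  decays : Decays f K
  decays_deriv : Decays (deriv f) K
  decays_deriv2 : Decays (deriv (deriv f)) K

theorem exists_regular (M : ℝ≥0) : ∃ K : ℝ, ∀ k : ℕ, 6 ≤ k → ∀ f : ℝ → ℂ, Continuous f →
    sigmaNorm k f ≤ M → Regular f K := by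
  set K₀ : ℝ := 8 * M
  set Λ : ℝ := 14 * K₀ + 1
  set C : ℝ := 4 * K₀ + 2 * (1 + 8 * Λ * (9 * M) ^ 2)
  set B : ℝ := 2 * (7 * (7 * (7 * (7 * K₀))))
  have hK₀ : 0 ≤ K₀ := by positivity
  have hB : 0 ≤ B := by positivity
  have hC0 : 0 ≤ C := by positivity
  refine ⟨K₀ + 20 * C + 2 * B, fun k hk f hc h => ?_⟩
  have s0 : Sob 6 f K₀ := sob_of_sigmaNorm_le hk hc h
  obtain ⟨d1, s1⟩ := s0.deriv
  obtain ⟨d2, s2⟩ := s1.deriv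
  obtain ⟨d3, s3⟩ := s2.deriv
  obtain ⟨d4, s4⟩ := s3.deriv
  have hLip : ∀ x y, ‖f y - f x‖ ≤ Λ * |y - x| := fun x y => by
    have := norm_le_of_deriv_le (f := fun y => f y - f x) (f' := deriv f) (x := x) (n := 0)
      (B := Λ) (by positivity) (fun y => (d1 y).sub_const _) (sub_self _)
      (fun y => by
        have := s1.norm_le y
        simp only [Λ, pow_zero, mul_one]; linarith) y
    simpa using this
  have hC : ∀ y, ‖f y‖ * (1 + y ^ 2) ^ 2 ≤ C := fun y => by
    have h1 := pow_mul_norm_le (by positivity) hLip (l2Bound_pow_mul_of_sigmaNorm_le hk hc h) y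
    have h2 := s0.norm_le y
    have h3 : (1 + y ^ 2) ^ 2 ≤ 2 + 2 * y ^ 4 := by nlinarith [sq_nonneg (1 - y ^ 2)]
    have h4 := mul_le_mul_of_nonneg_left h3 (norm_nonneg (f y))
    simp only [C]
    linarith
  have hb4 : ∀ y, ‖deriv (deriv (deriv (deriv f))) y‖ ≤ B := s4.norm_le
  have hb2 : ∀ y, ‖deriv (deriv f) y‖ ≤ B := fun y => (s2.norm_le y).trans (by
    simp only [B]; linarith)
  refine ⟨s0.mono (by linarith), d1, d2, s2.cont, fun x => ?_, fun x => ?_, fun x => ?_⟩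
  · have h1 := hC x
    have h2 : 1 + x ^ 2 ≤ (1 + x ^ 2) ^ 2 := by nlinarith [sq_nonneg x]
    have h3 := mul_le_mul_of_nonneg_left h2 (norm_nonneg (f x))
    linarith
  · have := norm_deriv_decay hB d1 d2 hb2 hC x
    linarith
  · have := norm_deriv2_decay hB d1 d2 d3 d4 hb4 hC x
    linarith

end DNLS

namespace DNLS

namespace Decays

variable {f g : ℝ → ℂ} {C D : ℝ}

theorem mono (hf : Decays f C) (h : C ≤ D) : Decays f D := fun x => (hf x).trans h

theorem norm_le (hf : Decays f C) (x : ℝ) : ‖f x‖ ≤ C :=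
  (le_mul_of_one_le_right (norm_nonneg _) (by nlinarith [sq_nonneg x])).trans (hf x)

theorem nonneg (hf : Decays f C) : 0 ≤ C := (norm_nonneg _).trans (hf.norm_le 0)

theorem norm_le_inv (hf : Decays f C) (x : ℝ) : ‖f x‖ ≤ C * (1 + x ^ 2)⁻¹ := by
  rw [← div_eq_mul_inv, le_div_iff₀ (by positivity)]
  exact hf x

theorem of_norm_le (hf : Decays f C) (h : ∀ x, ‖g x‖ ≤ ‖f x‖) : Decays g C := fun x =>
  (mul_le_mul_of_nonneg_right (h x) (by positivity)).trans (hf x)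

theorem add (hf : Decays f C) (hg : Decays g D) : Decays (fun x => f x + g x) (C + D) := fun x => by
  have := mul_le_mul_of_nonneg_right (norm_add_le (f x) (g x)) (by positivity : 0 ≤ 1 + x ^ 2)
  linarith [hf x, hg x]

theorem sub (hf : Decays f C) (hg : Decays g D) : Decays (fun x => f x - g x) (C + D) := fun x => by
  have := mul_le_mul_of_nonneg_right (norm_sub_le (f x) (g x)) (by positivity : 0 ≤ 1 + x ^ 2)
  linarith [hf x, hg x]

theorem mul (hf : Decays f C) (hg : Decays g D) : Decays (fun x => f x * g x) (C * D) := fun x => by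
  rw [norm_mul, mul_right_comm]
  exact mul_le_mul (hf x) (hg.norm_le x) (norm_nonneg _) hf.nonneg

theorem comp_conj (hf : Decays f C) : Decays (fun x => conj (f x)) C :=
  hf.of_norm_le fun x => (RCLike.norm_conj (f x)).le

theorem const_mul (c : ℂ) (hf : Decays f C) : Decays (fun x => c * f x) (‖c‖ * C) := fun x => by
  rw [norm_mul, mul_assoc]
  exact mul_le_mul_of_nonneg_left (hf x) (norm_nonneg c)

theorem integrable (hf : Decays f C) (hm : AEStronglyMeasurable f volume) : Integrable f := by
  refine (integrable_inv_one_add_sq.const_mul C).mono' hm (.of_forall fun x => hf.norm_le_inv x)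

end Decays

/-! ### The gauge transform -/

theorem gauge_eq (δ : ℝ) (f : ℝ → ℂ) (x : ℝ) :
    gauge δ f x = Complex.exp (-(Complex.I * δ * ∫ y in Iic x, f y * conj (f y))) := by
  have : ∫ y in Iic x, f y * conj (f y) = ((∫ y in Iic x, ‖f y‖ ^ 2 : ℝ) : ℂ) := by
    refine Eq.trans ?_ (integral_ofReal (𝕜 := ℂ))
    refine integral_congr_ae (.of_forall fun y => ?_)
    simp only [Complex.mul_conj', Complex.coe_algebraMap, RCLike.ofReal_pow]
  rw [this, gauge]

theorem norm_gauge (δ : ℝ) (f : ℝ → ℂ) (x : ℝ) : ‖gauge δ f x‖ = 1 := by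
  rw [gauge, Complex.norm_exp]
  simp [Complex.mul_re, Complex.mul_im]

theorem gauge_ne_zero (δ : ℝ) (f : ℝ → ℂ) (x : ℝ) : gauge δ f x ≠ 0 := Complex.exp_ne_zero _

theorem hasDerivAt_integral_Iic {g : ℝ → ℂ} (hc : Continuous g) (hi : Integrable g) (x : ℝ) :
    HasDerivAt (fun x => ∫ y in Iic x, g y) (g x) x := by
  have h1 : HasDerivAt (fun x => (∫ y in Iic (0 : ℝ), g y) + ∫ y in (0 : ℝ)..x, g y) (g x) x := by
    refine HasDerivAt.const_add _ ?_
    exact intervalIntegral.integral_hasDerivAt_right (hc.intervalIntegrable _ _)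
      (hc.stronglyMeasurableAtFilter _ _) hc.continuousAt
  refine h1.congr_of_eventuallyEq (.of_forall fun y => ?_)
  simp only
  rw [← intervalIntegral.integral_Iic_sub_Iic hi.integrableOn hi.integrableOn]
  ring

theorem hasDerivAt_gauge (δ : ℝ) {f : ℝ → ℂ} (hc : Continuous f)
    (hi : Integrable fun x => f x * conj (f x)) (x : ℝ) :
    HasDerivAt (gauge δ f) (-(Complex.I * δ) * (f x * conj (f x)) * gauge δ f x) x := by
  have h1 := hasDerivAt_integral_Iic (g := fun x => f x * conj (f x))
    (hc.mul (Complex.continuous_conj.comp hc)) hi x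
  have h2 := ((h1.const_mul (Complex.I * δ)).fun_neg).cexp
  have e : gauge δ f = fun x => Complex.exp (-(Complex.I * δ * ∫ y in Iic x, f y * conj (f y))) :=
    funext fun x => gauge_eq δ f x
  rw [e]
  refine h2.congr_deriv ?_
  ring

theorem hasDerivAt_gauge_sq (δ : ℝ) {f : ℝ → ℂ} (hc : Continuous f)
    (hi : Integrable fun x => f x * conj (f x)) (x : ℝ) :
    HasDerivAt (fun x => gauge δ f x ^ 2)
      (-(2 * Complex.I * δ) * (f x * conj (f x)) * gauge δ f x ^ 2) x := by
  refine ((hasDerivAt_gauge δ hc hi x).fun_pow 2).congr_deriv ?_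
  push_cast; ring

/-- `|f|² f`, in the form `f f̄ f`. -/
noncomputable def cubic (f : ℝ → ℂ) (x : ℝ) : ℂ := f x * conj (f x) * f x

/-- The derivative of `cubic f`, in terms of `f` and `f'`. -/
noncomputable def cubic' (f f' : ℝ → ℂ) (x : ℝ) : ℂ :=
  2 * (f x * conj (f x) * f' x) + f x * f x * conj (f' x)

theorem hasDerivAt_conj {f : ℝ → ℂ} {f' : ℂ} {x : ℝ} (h : HasDerivAt f f' x) :
    HasDerivAt (fun x => conj (f x)) (conj f') x := h.star

theorem hasDerivAt_cubic {f : ℝ → ℂ} {f' : ℂ} {x : ℝ} (h : HasDerivAt f f' x) :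
    HasDerivAt (cubic f) (2 * (f x * conj (f x) * f') + f x * f x * conj f') x := by
  refine ((h.fun_mul (hasDerivAt_conj h)).fun_mul h).congr_deriv ?_
  ring

theorem Decays.cubic {f : ℝ → ℂ} {C : ℝ} (h : Decays f C) : Decays (cubic f) (C * C * C) :=
  (h.mul h.comp_conj).mul h

theorem Decays.cubic' {f f' : ℝ → ℂ} {C D : ℝ} (h : Decays f C) (h' : Decays f' D) :
    Decays (cubic' f f') (2 * (C * C * D) + C * C * D) := by
  have := (((h.mul h.comp_conj).mul h').const_mul 2).add ((h.mul h).mul h'.comp_conj)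
  simpa [DNLS.cubic'] using! this

/-- The first unknown `E²f` of the transformed system. -/
noncomputable def gaugeU (δ : ℝ) (f : ℝ → ℂ) (x : ℝ) : ℂ := gauge δ f x ^ 2 * f x

/-- The spatial derivative of `gaugeU δ f`. -/
noncomputable def gaugeU₁ (δ : ℝ) (f : ℝ → ℂ) (x : ℝ) : ℂ :=
  gauge δ f x ^ 2 * (deriv f x - 2 * Complex.I * δ * cubic f x)

/-- The second spatial derivative of `gaugeU δ f`. -/
noncomputable def gaugeU₂ (δ : ℝ) (f : ℝ → ℂ) (x : ℝ) : ℂ :=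
  gauge δ f x ^ 2 * (deriv (deriv f) x - 2 * Complex.I * δ * cubic' f (deriv f) x -
    2 * Complex.I * δ * (f x * conj (f x) * (deriv f x - 2 * Complex.I * δ * cubic f x)))

/-- The second unknown of the transformed system, in terms of the first one. -/
noncomputable def gaugeV (δ : ℝ) (f : ℝ → ℂ) (x : ℝ) : ℂ :=
  gaugeU₁ δ f x + Complex.I * δ * cubic (gaugeU δ f) x

theorem conj_gauge_mul (δ : ℝ) (f : ℝ → ℂ) (x : ℝ) : conj (gauge δ f x) * gauge δ f x = 1 := by
  rw [mul_comm, Complex.mul_conj', norm_gauge]; simp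

theorem cubic_gaugeU (δ : ℝ) (f : ℝ → ℂ) (x : ℝ) :
    cubic (gaugeU δ f) x = gauge δ f x ^ 2 * cubic f x := by
  have h := conj_gauge_mul δ f x
  simp only [cubic, gaugeU, map_mul, map_pow]
  linear_combination (gauge δ f x ^ 2 * f x * conj (f x) * f x *
    (conj (gauge δ f x) * gauge δ f x + 1)) * h

theorem gaugeV_eq (δ : ℝ) (f : ℝ → ℂ) (x : ℝ) :
    gaugeV δ f x = gauge δ f x ^ 2 * (deriv f x - Complex.I * δ * cubic f x) := by
  rw [gaugeV, cubic_gaugeU, gaugeU₁]; ring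

namespace Regular

variable {f : ℝ → ℂ} {K : ℝ}

theorem integrable_density (h : Regular f K) : Integrable fun x => f x * conj (f x) :=
  (h.decays.mul h.decays.comp_conj).integrable
    (h.sob.cont.mul (Complex.continuous_conj.comp h.sob.cont)).aestronglyMeasurable

theorem continuous_deriv (h : Regular f K) : Continuous (deriv f) :=
  continuous_iff_continuousAt.2 fun x => (h.hasDerivAt_deriv x).continuousAt

theorem hasDerivAt_gauge_sq (h : Regular f K) (δ x : ℝ) : HasDerivAt (fun x => gauge δ f x ^ 2)
    (-(2 * Complex.I * δ) * (f x * conj (f x)) * gauge δ f x ^ 2) x :=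
  DNLS.hasDerivAt_gauge_sq δ h.sob.cont h.integrable_density x

theorem hasDerivAt_gaugeU (h : Regular f K) (δ x : ℝ) :
    HasDerivAt (gaugeU δ f) (gaugeU₁ δ f x) x := by
  refine ((h.hasDerivAt_gauge_sq δ x).mul (h.hasDerivAt x)).congr_deriv ?_
  rw [gaugeU₁, cubic]; ring

theorem hasDerivAt_gaugeU₁ (h : Regular f K) (δ x : ℝ) :
    HasDerivAt (gaugeU₁ δ f) (gaugeU₂ δ f x) x := by
  refine ((h.hasDerivAt_gauge_sq δ x).mul ((h.hasDerivAt_deriv x).fun_sub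
    ((hasDerivAt_cubic (h.hasDerivAt x)).const_mul (2 * Complex.I * δ)))).congr_deriv ?_
  rw [gaugeU₂, cubic']; ring

theorem continuous_gaugeU₂ (h : Regular f K) (δ : ℝ) : Continuous (gaugeU₂ δ f) := by
  have h0 := h.sob.cont
  have h1 := h.continuous_deriv
  have h2 := h.continuous_deriv2
  have h3 : Continuous fun x => gauge δ f x ^ 2 :=
    continuous_iff_continuousAt.2 fun x => (h.hasDerivAt_gauge_sq δ x).continuousAt
  have hc := Complex.continuous_conj
  unfold gaugeU₂ cubic' cubic
  fun_prop

theorem transform_eq (h : Regular f K) (δ : ℝ) : transform δ f = (gaugeU δ f, gaugeV δ f) := by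
  rw [transform]
  congr 1
  ext x
  have hd := (DNLS.hasDerivAt_gauge δ h.sob.cont h.integrable_density x).mul (h.hasDerivAt x)
  have e : deriv (fun y => gauge δ f y * f y) x = _ := hd.deriv
  rw [e, gaugeV_eq, cubic]
  ring

theorem norm_gauge_sq_mul (δ : ℝ) (f : ℝ → ℂ) (x : ℝ) (z : ℂ) : ‖gauge δ f x ^ 2 * z‖ = ‖z‖ := by
  rw [norm_mul, norm_pow, norm_gauge, one_pow, one_mul]

theorem exists_decays (δ K : ℝ) : ∃ C : ℝ, ∀ f, Regular f K →
    Decays (gaugeU δ f) C ∧ Decays (gaugeU₁ δ f) C ∧ Decays (gaugeU₂ δ f) C := by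
  refine ⟨|K| + (|K| + ‖2 * Complex.I * (δ : ℂ)‖ * |K * K * K|) +
    (|K| + ‖2 * Complex.I * (δ : ℂ)‖ * |2 * (K * K * K) + K * K * K| +
    ‖2 * Complex.I * (δ : ℂ)‖ *
      (|K * K| * (|K| + ‖2 * Complex.I * (δ : ℂ)‖ * |K * K * K|))), fun f h => ?_⟩
  have hK := h.decays.nonneg
  have a0 : 0 ≤ ‖2 * Complex.I * (δ : ℂ)‖ := norm_nonneg _
  have d1 := h.decays_deriv.sub (h.decays.cubic.const_mul (2 * Complex.I * δ))
  have d2 := (h.decays_deriv2.sub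
    ((h.decays.cubic' h.decays_deriv).const_mul (2 * Complex.I * δ))).sub
    (((h.decays.mul h.decays.comp_conj).mul d1).const_mul (2 * Complex.I * δ))
  rw [abs_of_nonneg hK, abs_of_nonneg (by positivity : 0 ≤ K * K),
    abs_of_nonneg (by positivity : 0 ≤ K * K * K),
    abs_of_nonneg (by positivity : 0 ≤ 2 * (K * K * K) + K * K * K)]
  have n1 : 0 ≤ K + ‖2 * Complex.I * (δ : ℂ)‖ * (K * K * K) := by positivity
  have n2 : 0 ≤ K + ‖2 * Complex.I * (δ : ℂ)‖ * (2 * (K * K * K) + K * K * K) +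
    ‖2 * Complex.I * (δ : ℂ)‖ * (K * K * (K + ‖2 * Complex.I * (δ : ℂ)‖ * (K * K * K))) := by
    positivity
  refine ⟨(h.decays.mono ?_).of_norm_le fun x => (norm_gauge_sq_mul δ f x _).le,
    (d1.mono ?_).of_norm_le fun x => (norm_gauge_sq_mul δ f x _).le,
    (d2.mono ?_).of_norm_le fun x => (norm_gauge_sq_mul δ f x _).le⟩ <;> linarith

theorem exists_sob (δ K : ℝ) : ∃ C : ℝ, ∀ f, Regular f K →
    Sob 4 (gaugeU δ f) C ∧ Sob 4 (gaugeV δ f) C := by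
  obtain ⟨C₁, h₁⟩ := exists_sob_gauge_mul (-(2 * Complex.I * δ)) 4 K K
  obtain ⟨C₂, h₂⟩ := exists_sob_gauge_mul (-(2 * Complex.I * δ)) 4 K
    (7 * K + ‖Complex.I * δ‖ * (12 * 3 ^ 5 * K * K * K))
  refine ⟨max C₁ C₂, fun f h => ⟨?_, ?_⟩⟩
  · have h5 := h.sob.mono_weight (i := 5) (by norm_num)
    exact (h₁ f f _ h5 h5 (fun x => by rw [norm_pow, norm_gauge, one_pow])
      (h.hasDerivAt_gauge_sq δ)).mono (le_max_left _ _)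
  · have h5 := h.sob.mono_weight (i := 5) (by norm_num)
    have e : gaugeV δ f = fun x => gauge δ f x ^ 2 * (deriv f x - Complex.I * δ * cubic f x) :=
      funext (gaugeV_eq δ f)
    rw [e]
    exact (h₂ f _ _ h5 (h.sob.deriv.2.sub ((h5.mul_conj_mul h5 h5).const_mul _))
      (fun x => by rw [norm_pow, norm_gauge, one_pow])
      (h.hasDerivAt_gauge_sq δ)).mono (le_max_right _ _)

end Regular

end DNLS

namespace DNLS

/-! ### The transformed system on the Fourier side -/

theorem fourier_apply (f : ℝ → ℂ) (ξ : ℝ) :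
    𝓕 f ξ = ∫ x, (Real.fourierChar (-(x * ξ)) : ℂ) * f x := by
  simp only [Real.fourier_real_eq, Circle.smul_def, smul_eq_mul]

theorem integrable_fourierChar_mul {f : ℝ → ℂ} (hf : Integrable f) (ξ : ℝ) :
    Integrable fun x => (Real.fourierChar (-(x * ξ)) : ℂ) * f x := by
  have hc : Continuous fun x : ℝ => (Real.fourierChar (-(x * ξ)) : ℂ) := by
    have := Real.continuous_fourierChar
    fun_prop
  refine hf.mono (hc.aestronglyMeasurable.mul hf.1) (.of_forall fun x => ?_)
  rw [norm_mul, Circle.norm_coe, one_mul]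

theorem fourier_add_apply {f g : ℝ → ℂ} (hf : Integrable f) (hg : Integrable g) (ξ : ℝ) :
    𝓕 (fun x => f x + g x) ξ = 𝓕 f ξ + 𝓕 g ξ := by
  simp only [fourier_apply]
  rw [← integral_add (integrable_fourierChar_mul hf ξ) (integrable_fourierChar_mul hg ξ)]
  refine integral_congr_ae (.of_forall fun x => ?_)
  simp only; ring

theorem fourier_const_mul_apply (c : ℂ) (f : ℝ → ℂ) (ξ : ℝ) :
    𝓕 (fun x => c * f x) ξ = c * 𝓕 f ξ := by
  simp only [fourier_apply]
  rw [← integral_const_mul]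
  refine integral_congr_ae (.of_forall fun x => ?_)
  simp only; ring

theorem fourier_hasDerivAt {f f' : ℝ → ℂ} (hf : Integrable f) (hd : ∀ x, HasDerivAt f (f' x) x)
    (hf' : Integrable f') (ξ : ℝ) : 𝓕 f' ξ = dsym ξ * 𝓕 f ξ := by
  have e : deriv f = f' := funext fun x => (hd x).deriv
  have h := Real.fourier_deriv hf (fun x => (hd x).differentiableAt) (by rwa [e])
  rw [e] at h
  rw [h, dsym]
  simp only [smul_eq_mul]

theorem continuousOn_fourier {F : ℝ → ℝ → ℂ} {S : Set ℝ} {C : ℝ}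
    (hm : ∀ t ∈ S, Continuous (F t)) (hb : ∀ t ∈ S, Decays (F t) C)
    (hc : ∀ x, ContinuousOn (fun t => F t x) S) (ξ : ℝ) : ContinuousOn (fun t => 𝓕 (F t) ξ) S := by
  intro t ht
  simp only [fourier_apply]
  have hχ : Continuous fun x : ℝ => (Real.fourierChar (-(x * ξ)) : ℂ) := by
    have := Real.continuous_fourierChar
    fun_prop
  refine continuousWithinAt_of_dominated (bound := fun x => C * (1 + x ^ 2)⁻¹) ?_ ?_
    (integrable_inv_one_add_sq.const_mul C) (.of_forall fun x => ?_)
  · filter_upwards [self_mem_nhdsWithin] with s hs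
    exact (hχ.mul (hm s hs)).aestronglyMeasurable
  · filter_upwards [self_mem_nhdsWithin] with s hs
    refine .of_forall fun x => ?_
    rw [norm_mul, Circle.norm_coe, one_mul]
    exact (hb s hs).norm_le_inv x
  · exact continuousWithinAt_const.mul (hc x t ht)

theorem hasDerivAt_fourier_of_decays {F F' : ℝ → ℝ → ℂ} {T C D : ℝ}
    (hm : ∀ t ∈ Icc 0 T, Continuous (F t)) (hb : ∀ t ∈ Icc 0 T, Decays (F t) C)
    (hm' : ∀ t ∈ Icc 0 T, Continuous (F' t)) (hb' : ∀ t ∈ Icc 0 T, Decays (F' t) D)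
    (hd : ∀ x, ∀ t ∈ Ioo 0 T, HasDerivAt (fun t => F t x) (F' t x) t) (ξ : ℝ) {t : ℝ}
    (ht : t ∈ Ioo 0 T) : HasDerivAt (fun t => 𝓕 (F t) ξ) (𝓕 (F' t) ξ) t := by
  obtain ⟨ε, hε, hball⟩ := Metric.isOpen_iff.1 isOpen_Ioo t ht
  have hI := fun s (hs : s ∈ Metric.ball t ε) => Ioo_subset_Icc_self (hball hs)
  have ht' := Ioo_subset_Icc_self ht
  exact hasDerivAt_fourier_param hε (fun s hs => (hm s (hI s hs)).aestronglyMeasurable)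
    ((hb t ht').integrable (hm t ht').aestronglyMeasurable) (hm' t ht').aestronglyMeasurable
    (.of_forall fun x s hs => (hb' s (hI s hs)).norm_le_inv x)
    (integrable_inv_one_add_sq.const_mul D) (.of_forall fun x s hs => hd x s (hball hs)) ξ

/-- `f` is twice continuously differentiable with derivatives `f₁`, `f₂`, all dominated by
`C / (1 + x²)`. -/
structure C2Decays (f f₁ f₂ : ℝ → ℂ) (C : ℝ) : Prop where
  hasDerivAt : ∀ x, HasDerivAt f (f₁ x) x
  hasDerivAt₁ : ∀ x, HasDerivAt f₁ (f₂ x) x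
  cont₂ : Continuous f₂
  decays : Decays f C
  decays₁ : Decays f₁ C
  decays₂ : Decays f₂ C

/-- The second unknown `v = ∂ₓu + iδ|u|²u`, with `f₁` in the place of `∂ₓu`. -/
noncomputable def second (δ : ℝ) (f f₁ : ℝ → ℂ) (x : ℝ) : ℂ := f₁ x + Complex.I * δ * cubic f x

/-- The right-hand side of `∂ₜu = i∂ₓ²u - 2δu²v̄`. -/
noncomputable def rhs (δ : ℝ) (f f₁ f₂ : ℝ → ℂ) (x : ℝ) : ℂ :=
  Complex.I * f₂ x + -2 * δ * (f x * conj (second δ f f₁ x) * f x)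

/-- The second derivative of `cubic f`. -/
noncomputable def cubic'' (f f₁ f₂ : ℝ → ℂ) (x : ℝ) : ℂ :=
  2 * (f₁ x * conj (f x) * f₁ x) + 2 * (f x * conj (f₁ x) * f₁ x) +
    2 * (f x * conj (f x) * f₂ x) + 2 * (f x * conj (f₁ x) * f₁ x) + f x * f x * conj (f₂ x)

/-- The derivative of `f v̄ f` with `v = second δ f f₁`. -/
noncomputable def coupling' (δ : ℝ) (f f₁ f₂ : ℝ → ℂ) (x : ℝ) : ℂ :=
  2 * (f x * conj (second δ f f₁ x) * f₁ x) +
    f x * f x * conj (f₂ x + Complex.I * δ * cubic' f f₁ x)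

namespace C2Decays

variable {f f₁ f₂ : ℝ → ℂ} {C : ℝ}

theorem cont (h : C2Decays f f₁ f₂ C) : Continuous f :=
  continuous_iff_continuousAt.2 fun x => (h.hasDerivAt x).continuousAt

theorem cont₁ (h : C2Decays f f₁ f₂ C) : Continuous f₁ :=
  continuous_iff_continuousAt.2 fun x => (h.hasDerivAt₁ x).continuousAt

theorem cont_cubic (h : C2Decays f f₁ f₂ C) : Continuous (cubic f) := by
  have := h.cont
  have := Complex.continuous_conj
  unfold cubic; fun_prop

theorem cont_second (h : C2Decays f f₁ f₂ C) (δ : ℝ) : Continuous (second δ f f₁) :=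
  h.cont₁.add (continuous_const.mul h.cont_cubic)

theorem cont_rhs (h : C2Decays f f₁ f₂ C) (δ : ℝ) : Continuous (rhs δ f f₁ f₂) := by
  have := h.cont
  have := h.cont₂
  have := h.cont_second δ
  have := Complex.continuous_conj
  unfold rhs; fun_prop

theorem decays_second (h : C2Decays f f₁ f₂ C) (δ : ℝ) :
    Decays (second δ f f₁) (C + ‖Complex.I * (δ : ℂ)‖ * (C * C * C)) :=
  h.decays₁.add (h.decays.cubic.const_mul _)

theorem decays_rhs (h : C2Decays f f₁ f₂ C) (δ : ℝ) : Decays (rhs δ f f₁ f₂)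
    (‖Complex.I‖ * C + ‖(-2 * δ : ℂ)‖ * (C * (C + ‖Complex.I * (δ : ℂ)‖ * (C * C * C)) * C)) :=
  (h.decays₂.const_mul _).add
    (((h.decays.mul (h.decays_second δ).comp_conj).mul h.decays).const_mul _)

theorem integrable (h : C2Decays f f₁ f₂ C) : Integrable f :=
  h.decays.integrable h.cont.aestronglyMeasurable

theorem fourier_two (h : C2Decays f f₁ f₂ C) (ξ : ℝ) :
    𝓕 f₂ ξ = dsym ξ * (dsym ξ * 𝓕 f ξ) := by
  have i1 := h.decays₁.integrable h.cont₁.aestronglyMeasurable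
  have i2 := h.decays₂.integrable h.cont₂.aestronglyMeasurable
  rw [fourier_hasDerivAt i1 h.hasDerivAt₁ i2, fourier_hasDerivAt h.integrable h.hasDerivAt i1]

theorem cubic (h : C2Decays f f₁ f₂ C) :
    ∃ D, C2Decays (cubic f) (cubic' f f₁) (cubic'' f f₁ f₂) D := by
  have hf := h.cont
  have hf₁ := h.cont₁
  have hf₂ := h.cont₂
  have hc := Complex.continuous_conj
  have d1 := ((((((h.decays₁.mul h.decays.comp_conj).mul h.decays₁).const_mul 2).add
    (((h.decays.mul h.decays₁.comp_conj).mul h.decays₁).const_mul 2)).add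
    (((h.decays.mul h.decays.comp_conj).mul h.decays₂).const_mul 2)).add
    (((h.decays.mul h.decays₁.comp_conj).mul h.decays₁).const_mul 2)).add
    ((h.decays.mul h.decays).mul h.decays₂.comp_conj)
  have d0 := h.decays.cubic
  have d0' := h.decays.cubic' h.decays₁
  refine ⟨_, fun x => hasDerivAt_cubic (h.hasDerivAt x), fun x => ?_, ?_,
    d0.mono ((le_max_left _ _).trans (le_max_left _ _)),
    d0'.mono ((le_max_right _ _).trans (le_max_left _ _)), d1.mono (le_max_right _ _)⟩
  · have a := h.hasDerivAt x
    have b := h.hasDerivAt₁ x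
    refine ((((a.fun_mul (hasDerivAt_conj a)).fun_mul b).const_mul 2).fun_add
      ((a.fun_mul a).fun_mul (hasDerivAt_conj b))).congr_deriv ?_
    rw [cubic'']; ring
  · unfold cubic''; fun_prop

theorem hasDerivAt_second (h : C2Decays f f₁ f₂ C) (δ x : ℝ) :
    HasDerivAt (second δ f f₁) (f₂ x + Complex.I * δ * cubic' f f₁ x) x :=
  (h.hasDerivAt₁ x).add ((hasDerivAt_cubic (h.hasDerivAt x)).const_mul _)

theorem fourier_coupling (h : C2Decays f f₁ f₂ C) (δ ξ : ℝ) :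
    Integrable (coupling' δ f f₁ f₂) ∧ 𝓕 (coupling' δ f f₁ f₂) ξ =
      dsym ξ * 𝓕 (fun x => f x * conj (second δ f f₁ x) * f x) ξ := by
  have hf := h.cont
  have hf₁ := h.cont₁
  have hf₂ := h.cont₂
  have hs := h.cont_second δ
  have hc := Complex.continuous_conj
  have d : ∃ D, Decays (coupling' δ f f₁ f₂) D :=
    ⟨_, (((h.decays.mul (h.decays_second δ).comp_conj).mul h.decays₁).const_mul 2).add
    ((h.decays.mul h.decays).mul
      (h.decays₂.add ((h.decays.cubic' h.decays₁).const_mul (Complex.I * δ))).comp_conj)⟩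
  obtain ⟨D, d⟩ := d
  have hi : Integrable (coupling' δ f f₁ f₂) := by
    refine d.integrable (Continuous.aestronglyMeasurable ?_)
    unfold coupling' cubic'; fun_prop
  refine ⟨hi, fourier_hasDerivAt ?_ (fun x => ?_) hi ξ⟩
  · exact ((h.decays.mul (h.decays_second δ).comp_conj).mul h.decays).integrable
      (Continuous.aestronglyMeasurable (by fun_prop))
  · have a := h.hasDerivAt x
    refine ((a.fun_mul (hasDerivAt_conj (h.hasDerivAt_second δ x))).fun_mul a).congr_deriv ?_
    rw [coupling']; ring

theorem fourier_second (h : C2Decays f f₁ f₂ C) (δ ξ : ℝ) :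
    𝓕 (second δ f f₁) ξ = dsym ξ * 𝓕 f ξ + Complex.I * δ * 𝓕 (DNLS.cubic f) ξ := by
  have i1 := h.decays₁.integrable h.cont₁.aestronglyMeasurable
  have i2 := h.decays.cubic.integrable h.cont_cubic.aestronglyMeasurable
  rw [← fourier_hasDerivAt h.integrable h.hasDerivAt i1, ← fourier_const_mul_apply,
    ← fourier_add_apply i1 (i2.const_mul _)]
  rfl

theorem _root_.DNLS.dsym_mul_self (ξ : ℝ) :
    dsym ξ * dsym ξ = -(((2 * Real.pi * ξ) ^ 2 : ℝ) : ℂ) := by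
  simp only [dsym]
  push_cast
  linear_combination (4 * (Real.pi : ℂ) ^ 2 * (ξ : ℂ) ^ 2) * Complex.I_sq

theorem fourier_rhs (h : C2Decays f f₁ f₂ C) (δ ξ : ℝ) : 𝓕 (rhs δ f f₁ f₂) ξ =
    -(Complex.I * (((2 * Real.pi * ξ) ^ 2 : ℝ) : ℂ)) * 𝓕 f ξ +
      -2 * δ * 𝓕 (fun x => f x * conj (second δ f f₁ x) * f x) ξ := by
  have hf := h.cont
  have hs := h.cont_second δ
  have hc := Complex.continuous_conj
  have i1 := h.decays₂.integrable h.cont₂.aestronglyMeasurable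
  have i2 : Integrable fun x => f x * conj (second δ f f₁ x) * f x :=
    ((h.decays.mul (h.decays_second δ).comp_conj).mul h.decays).integrable
      (Continuous.aestronglyMeasurable (by fun_prop))
  have e := fourier_add_apply (i1.const_mul Complex.I) (i2.const_mul (-2 * δ)) ξ
  rw [fourier_const_mul_apply, fourier_const_mul_apply, h.fourier_two] at e
  change 𝓕 (fun x => Complex.I * f₂ x + -2 * δ * (f x * conj (second δ f f₁ x) * f x)) ξ = _
  rw [e]
  linear_combination (Complex.I * 𝓕 f ξ) * dsym_mul_self ξ

/-- The equation `∂ₜv = i∂ₓ²v + 2δv²ū` follows from the one for `u` and `v = ∂ₓu + iδ|u|²u`. -/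
theorem fourier_rhs_second (h : C2Decays f f₁ f₂ C) (δ ξ : ℝ) :
    dsym ξ * 𝓕 (rhs δ f f₁ f₂) ξ + Complex.I * δ * 𝓕 (cubic' f (rhs δ f f₁ f₂)) ξ =
    -(Complex.I * (((2 * Real.pi * ξ) ^ 2 : ℝ) : ℂ)) * 𝓕 (second δ f f₁) ξ +
      -2 * (-δ) * 𝓕 (fun x => second δ f f₁ x * conj (f x) * second δ f f₁ x) ξ := by
  have hf := h.cont
  have hs := h.cont_second δ
  have hc := Complex.continuous_conj
  have hr := h.cont_rhs δ
  obtain ⟨i1, e1⟩ := h.fourier_coupling δ ξ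
  obtain ⟨D, hD⟩ := h.cubic
  have e2 := hD.fourier_two ξ
  have i2 := hD.decays₂.integrable hD.cont₂.aestronglyMeasurable
  have i3 : Integrable (cubic' f (rhs δ f f₁ f₂)) := by
    refine (h.decays.cubic' (h.decays_rhs δ)).integrable (Continuous.aestronglyMeasurable ?_)
    unfold cubic'; fun_prop
  -- Multiplied by `2δ`, this is `2δv²ū = -2δ(u²v̄)' + δ(|u|²u)'' + iδ∂ₜ(|u|²u)`.
  have hpt : (fun x => second δ f f₁ x * conj (f x) * second δ f f₁ x) = fun x =>
      -1 * coupling' δ f f₁ f₂ x + ((1 / 2) * cubic'' f f₁ f₂ x +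
        Complex.I / 2 * cubic' f (rhs δ f f₁ f₂) x) := by
    ext x
    simp only [coupling', cubic'', cubic', rhs, second, DNLS.cubic, map_add, map_mul, map_neg,
      Complex.conj_conj, Complex.conj_I, Complex.conj_ofReal, map_ofNat]
    ring_nf
    simp only [Complex.I_sq]
    ring
  have e3 : (δ : ℂ) * 𝓕 (fun x => second δ f f₁ x * conj (f x) * second δ f f₁ x) ξ =
      δ * (-1 * 𝓕 (coupling' δ f f₁ f₂) ξ + ((1 / 2) * 𝓕 (cubic'' f f₁ f₂) ξ +
        Complex.I / 2 * 𝓕 (cubic' f (rhs δ f f₁ f₂)) ξ)) := by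
    have i23 : Integrable fun x => (1 / 2) * cubic'' f f₁ f₂ x +
        Complex.I / 2 * cubic' f (rhs δ f f₁ f₂) x := (i2.const_mul _).add (i3.const_mul _)
    rw [hpt, fourier_add_apply (i1.const_mul _) i23,
      fourier_add_apply (i2.const_mul _) (i3.const_mul _), fourier_const_mul_apply,
      fourier_const_mul_apply, fourier_const_mul_apply]
  rw [h.fourier_rhs, h.fourier_second]
  rw [e1, e2] at e3
  linear_combination (-2) * e3 - (δ * 𝓕 (DNLS.cubic f) ξ) * dsym_mul_self ξ +
    (δ * (((2 * Real.pi * ξ) ^ 2 : ℝ) : ℂ) * 𝓕 (DNLS.cubic f) ξ) * Complex.I_sq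

end C2Decays

/-- A solution `u` of `∂ₜu = i∂ₓ²u - 2δu²v̄` with `v = ∂ₓu + iδ|u|²u`, together with its spatial
derivatives, with bounds uniform in time. -/
structure Flow (δ T C : ℝ) (u u₁ u₂ : ℝ → ℝ → ℂ) : Prop where
  c2 : ∀ t ∈ Icc 0 T, C2Decays (u t) (u₁ t) (u₂ t) C
  cont : ∀ x, ContinuousOn (fun t => u t x) (Icc 0 T)
  time : ∀ x, ∀ t ∈ Ioo 0 T, HasDerivAt (fun t => u t x) (rhs δ (u t) (u₁ t) (u₂ t) x) t

theorem Sob.fBound_fourier {j : ℕ} {f : ℝ → ℂ} {K : ℝ} (h : Sob j f K) (hi : Integrable f) :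
    fhat f =ᵐ[volume] 𝓕 f ∧ FBound j (𝓕 f) K :=
  ⟨fhat_eq_fourier hi h.memLp,
    h.bound.congr_ae (continuous_fourier hi).measurable (fhat_eq_fourier hi h.memLp)⟩

theorem Flow.curve {δ T C K : ℝ} {u u₁ u₂ : ℝ → ℝ → ℂ} (h : Flow δ T C u u₁ u₂)
    (hu : ∀ t ∈ Icc 0 T, Sob 4 (u t) K) (hv : ∀ t ∈ Icc 0 T, Sob 4 (second δ (u t) (u₁ t)) K) :
    Curve δ T K u (fun t => second δ (u t) (u₁ t)) (fun t => 𝓕 (u t))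
      (fun t => 𝓕 (second δ (u t) (u₁ t))) := by
  have hi : ∀ t ∈ Icc 0 T, Integrable (second δ (u t) (u₁ t)) := fun t ht =>
    ((h.c2 t ht).decays_second δ).integrable ((h.c2 t ht).cont_second δ).aestronglyMeasurable
  have hd : ∀ ξ, ∀ t ∈ Ioo 0 T, HasDerivAt (fun t => 𝓕 (u t) ξ)
      (𝓕 (rhs δ (u t) (u₁ t) (u₂ t)) ξ) t := fun ξ t ht =>
    hasDerivAt_fourier_of_decays (fun t ht => (h.c2 t ht).cont) (fun t ht => (h.c2 t ht).decays)
      (fun t ht => (h.c2 t ht).cont_rhs δ) (fun t ht => (h.c2 t ht).decays_rhs δ) h.time ξ ht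
  have hcub : ∀ ξ, ∀ t ∈ Ioo 0 T, HasDerivAt (fun t => 𝓕 (cubic (u t)) ξ)
      (𝓕 (cubic' (u t) (rhs δ (u t) (u₁ t) (u₂ t))) ξ) t := fun ξ t ht => by
    refine hasDerivAt_fourier_of_decays (F := fun t => cubic (u t))
      (F' := fun t => cubic' (u t) (rhs δ (u t) (u₁ t) (u₂ t)))
      (fun t ht => (h.c2 t ht).cont_cubic) (fun t ht => (h.c2 t ht).decays.cubic)
      (fun t ht => ?_) (fun t ht => (h.c2 t ht).decays.cubic' ((h.c2 t ht).decays_rhs δ))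
      (fun x t ht => hasDerivAt_cubic (f := fun t => u t x) (h.time x t ht)) ξ ht
    have := (h.c2 t ht).cont
    have := (h.c2 t ht).cont_rhs δ
    have := Complex.continuous_conj
    unfold cubic'; fun_prop
  have hcu : ∀ ξ, ContinuousOn (fun t => 𝓕 (u t) ξ) (Icc 0 T) := fun ξ =>
    continuousOn_fourier (fun t ht => (h.c2 t ht).cont) (fun t ht => (h.c2 t ht).decays) h.cont ξ
  have hcc : ∀ ξ, ContinuousOn (fun t => 𝓕 (cubic (u t)) ξ) (Icc 0 T) := fun ξ =>
    continuousOn_fourier (fun t ht => (h.c2 t ht).cont_cubic)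
      (fun t ht => (h.c2 t ht).decays.cubic) (fun x => ((h.cont x).mul
        (Complex.continuous_conj.comp_continuousOn (h.cont x))).mul (h.cont x)) ξ
  exact
  { memLp_left := fun t ht => (hu t ht).memLp
    memLp_right := fun t ht => (hv t ht).memLp
    fhat_left := fun t ht => ((hu t ht).fBound_fourier (h.c2 t ht).integrable).1
    fhat_right := fun t ht => ((hv t ht).fBound_fourier (hi t ht)).1
    bound_left := fun t ht => ((hu t ht).fBound_fourier (h.c2 t ht).integrable).2
    bound_right := fun t ht => ((hv t ht).fBound_fourier (hi t ht)).2
    cont_left := hcu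
    cont_right := fun ξ => by
      refine ((continuousOn_const (c := dsym ξ)).mul (hcu ξ) |>.add
        ((continuousOn_const (c := Complex.I * δ)).mul (hcc ξ))).congr fun t ht => ?_
      exact (h.c2 t ht).fourier_second δ ξ
    deriv_left := fun ξ t ht => by
      rw [← (h.c2 t (Ioo_subset_Icc_self ht)).fourier_rhs δ ξ]
      exact hd ξ t ht
    deriv_right := fun ξ t ht => by
      rw [← (h.c2 t (Ioo_subset_Icc_self ht)).fourier_rhs_second δ ξ]
      refine (((hd ξ t ht).const_mul (dsym ξ)).fun_add
        ((hcub ξ t ht).const_mul (Complex.I * δ))).congr_of_eventuallyEq ?_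
      filter_upwards [isOpen_Ioo.mem_nhds ht] with s hs
      exact (h.c2 s (Ioo_subset_Icc_self hs)).fourier_second δ ξ }

end DNLS

namespace DNLS

/-! ### Time evolution of the gauge-transformed solution -/

/-- The right-hand side of the derivative nonlinear Schrödinger equation, solved for `∂ₜψ`. -/
noncomputable def timeDeriv (δ : ℝ) (f : ℝ → ℂ) (x : ℝ) : ℂ :=
  Complex.I * deriv (deriv f) x + 2 * δ * cubic' f (deriv f) x

/-- The flux of the conservation law `∂ₜ|ψ|² = ∂ₓ(i(ψ'ψ̄ - ψψ̄') + 3δ|ψ|⁴)`. -/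
noncomputable def flux (δ : ℝ) (f : ℝ → ℂ) (x : ℝ) : ℂ :=
  Complex.I * (deriv f x * conj (f x) - f x * conj (deriv f x)) + 3 * δ * (cubic f x * conj (f x))

/-- `∂ₜ|ψ|²`. -/
noncomputable def densityDeriv (δ : ℝ) (f : ℝ → ℂ) (x : ℝ) : ℂ :=
  timeDeriv δ f x * conj (f x) + f x * conj (timeDeriv δ f x)

namespace Regular

variable {f : ℝ → ℂ} {K : ℝ}

theorem continuous_timeDeriv (h : Regular f K) (δ : ℝ) : Continuous (timeDeriv δ f) := by
  have h0 := h.sob.cont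
  have h1 := h.continuous_deriv
  have h2 := h.continuous_deriv2
  have hc := Complex.continuous_conj
  unfold timeDeriv cubic'; fun_prop

theorem continuous_densityDeriv (h : Regular f K) (δ : ℝ) : Continuous (densityDeriv δ f) := by
  have h0 := h.sob.cont
  have h1 := h.continuous_timeDeriv δ
  have hc := Complex.continuous_conj
  unfold densityDeriv; fun_prop

theorem decays_timeDeriv (h : Regular f K) (δ : ℝ) : Decays (timeDeriv δ f)
    (‖Complex.I‖ * K + ‖(2 * δ : ℂ)‖ * (2 * (K * K * K) + K * K * K)) :=
  (h.decays_deriv2.const_mul _).add ((h.decays.cubic' h.decays_deriv).const_mul _)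

theorem decays_densityDeriv (h : Regular f K) (δ : ℝ) : Decays (densityDeriv δ f)
    ((‖Complex.I‖ * K + ‖(2 * δ : ℂ)‖ * (2 * (K * K * K) + K * K * K)) * K +
      K * (‖Complex.I‖ * K + ‖(2 * δ : ℂ)‖ * (2 * (K * K * K) + K * K * K))) :=
  ((h.decays_timeDeriv δ).mul h.decays.comp_conj).add
    (h.decays.mul (h.decays_timeDeriv δ).comp_conj)

theorem exists_decays_flux (h : Regular f K) (δ : ℝ) : ∃ C, Decays (flux δ f) C :=
  ⟨_, (((h.decays_deriv.mul h.decays.comp_conj).sub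
    (h.decays.mul h.decays_deriv.comp_conj)).const_mul Complex.I).add
    ((h.decays.cubic.mul h.decays.comp_conj).const_mul (3 * δ))⟩

theorem hasDerivAt_flux (h : Regular f K) (δ x : ℝ) :
    HasDerivAt (flux δ f) (densityDeriv δ f x) x := by
  have a := h.hasDerivAt x
  have b := h.hasDerivAt_deriv x
  refine ((((b.fun_mul (hasDerivAt_conj a)).fun_sub (a.fun_mul (hasDerivAt_conj b))).const_mul
    Complex.I).fun_add (((hasDerivAt_cubic a).fun_mul (hasDerivAt_conj a)).const_mul
      (3 * (δ : ℂ)))).congr_deriv ?_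
  simp only [densityDeriv, timeDeriv, cubic', cubic, map_add, map_mul, Complex.conj_conj,
    Complex.conj_I, Complex.conj_ofReal, map_ofNat]
  ring

theorem integral_densityDeriv (h : Regular f K) (δ x : ℝ) :
    ∫ y in Iic x, densityDeriv δ f y = flux δ f x := by
  obtain ⟨C, hC⟩ := h.exists_decays_flux δ
  have hlim : Filter.Tendsto (flux δ f) Filter.atBot (nhds 0) := by
    refine squeeze_zero_norm hC.norm_le_inv ?_
    have h1 : Filter.Tendsto (fun x : ℝ => 1 + x ^ 2) Filter.atBot Filter.atTop :=
      Filter.tendsto_atTop_add_const_left _ _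
        ((Filter.tendsto_pow_atTop two_ne_zero).comp Filter.tendsto_abs_atBot_atTop |>.congr
          fun x => sq_abs x)
    simpa using h1.inv_tendsto_atTop.const_mul C
  have := integral_Iic_of_hasDerivAt_of_tendsto' (a := x) (fun y _ => h.hasDerivAt_flux δ y)
    ((h.decays_densityDeriv δ).integrable
      (h.continuous_densityDeriv δ).aestronglyMeasurable).integrableOn hlim
  simpa using this

theorem c2Decays_gaugeU {C : ℝ} (h : Regular f K) (δ : ℝ)
    (hC : Decays (gaugeU δ f) C ∧ Decays (gaugeU₁ δ f) C ∧ Decays (gaugeU₂ δ f) C) :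
    C2Decays (gaugeU δ f) (gaugeU₁ δ f) (gaugeU₂ δ f) C :=
  ⟨h.hasDerivAt_gaugeU δ, h.hasDerivAt_gaugeU₁ δ, h.continuous_gaugeU₂ δ, hC.1, hC.2.1, hC.2.2⟩

end Regular

namespace IsSolution

variable {δ T K : ℝ} {ψ : ℝ → ℝ → ℂ}

theorem hasDerivAt_time (h : IsSolution δ T ψ) (hr : ∀ t ∈ Icc 0 T, Regular (ψ t) K) {t : ℝ}
    (ht : t ∈ Ioo 0 T) (x : ℝ) : HasDerivAt (fun s => ψ s x) (timeDeriv δ (ψ t) x) t := by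
  have ht' := Ioo_subset_Icc_self ht
  have h1 := ((h.differentiable_time t ht' x).differentiableAt
    (Icc_mem_nhds ht.1 ht.2)).hasDerivAt
  have h2 := h.equation t ht' x
  rw [derivWithin_of_mem_nhds (Icc_mem_nhds ht.1 ht.2)] at h2
  have e1 : iteratedDeriv 2 (ψ t) x = deriv (deriv (ψ t)) x := by
    rw [iteratedDeriv_succ, iteratedDeriv_one]
  have e2 : (fun y : ℝ => ((‖ψ t y‖ ^ 2 : ℝ) : ℂ) * ψ t y) = cubic (ψ t) := by
    ext y
    rw [cubic, Complex.mul_conj']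
    push_cast; rfl
  have e3 : deriv (cubic (ψ t)) x = cubic' (ψ t) (deriv (ψ t)) x :=
    (hasDerivAt_cubic ((hr t ht').hasDerivAt x)).deriv
  rw [e1, e2, e3] at h2
  refine h1.congr_deriv ?_
  rw [timeDeriv]
  linear_combination (-Complex.I) * h2 + (deriv (fun s => ψ s x) t - 2 * δ *
    cubic' (ψ t) (deriv (ψ t)) x) * Complex.I_sq

theorem continuousOn_time (h : IsSolution δ T ψ) (x : ℝ) :
    ContinuousOn (fun s => ψ s x) (Icc 0 T) :=
  fun t ht => (h.differentiable_time t ht x).continuousWithinAt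

theorem hasDerivAt_mass (h : IsSolution δ T ψ) (hr : ∀ t ∈ Icc 0 T, Regular (ψ t) K) {t : ℝ}
    (ht : t ∈ Ioo 0 T) (x : ℝ) :
    HasDerivAt (fun s => ∫ y in Iic x, ψ s y * conj (ψ s y)) (flux δ (ψ t) x) t := by
  have ht' := Ioo_subset_Icc_self ht
  have hm : ∀ s ∈ Icc 0 T, Continuous fun y => ψ s y * conj (ψ s y) := fun s hs =>
    (hr s hs).sob.cont.mul (Complex.continuous_conj.comp (hr s hs).sob.cont)
  have key := hasDerivAt_integral_of_dominated_loc_of_deriv_le (μ := volume.restrict (Iic x))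
    (F := fun s y => ψ s y * conj (ψ s y)) (F' := fun s y => densityDeriv δ (ψ s) y)
    (isOpen_Ioo.mem_nhds ht) ?_ (hr t ht').integrable_density.integrableOn
    ((hr t ht').continuous_densityDeriv δ).aestronglyMeasurable
    (.of_forall fun y s hs => ((hr s (Ioo_subset_Icc_self hs)).decays_densityDeriv δ).norm_le_inv y)
    (integrable_inv_one_add_sq.const_mul _).integrableOn (.of_forall fun y s hs => ?_)
  · rw [← (hr t ht').integral_densityDeriv δ x]
    exact key.2
  · filter_upwards [isOpen_Ioo.mem_nhds ht] with s hs
    exact (hm s (Ioo_subset_Icc_self hs)).aestronglyMeasurable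
  · have := h.hasDerivAt_time hr hs y
    exact this.fun_mul (hasDerivAt_conj this)

theorem continuousOn_mass (h : IsSolution δ T ψ) (hr : ∀ t ∈ Icc 0 T, Regular (ψ t) K) (x : ℝ) :
    ContinuousOn (fun s => ∫ y in Iic x, ψ s y * conj (ψ s y)) (Icc 0 T) := by
  intro t ht
  refine continuousWithinAt_of_dominated (bound := fun y => K * K * (1 + y ^ 2)⁻¹) ?_ ?_
    (integrable_inv_one_add_sq.const_mul _).integrableOn (.of_forall fun y => ?_)
  · filter_upwards [self_mem_nhdsWithin] with s hs
    exact ((hr s hs).sob.cont.mul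
      (Complex.continuous_conj.comp (hr s hs).sob.cont)).aestronglyMeasurable
  · filter_upwards [self_mem_nhdsWithin] with s hs
    exact .of_forall fun y => ((hr s hs).decays.mul (hr s hs).decays.comp_conj).norm_le_inv y
  · have := h.continuousOn_time y t ht
    exact this.mul (Complex.continuous_conj.continuousAt.comp_continuousWithinAt this)

/-- The first unknown `u = E²ψ` of the transformed system solves its equation. -/
theorem flow (h : IsSolution δ T ψ) (hr : ∀ t ∈ Icc 0 T, Regular (ψ t) K) {C : ℝ}
    (hC : ∀ f, Regular f K →
      Decays (gaugeU δ f) C ∧ Decays (gaugeU₁ δ f) C ∧ Decays (gaugeU₂ δ f) C) :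
    Flow δ T C (fun t => gaugeU δ (ψ t)) (fun t => gaugeU₁ δ (ψ t))
      (fun t => gaugeU₂ δ (ψ t)) where
  c2 t ht := (hr t ht).c2Decays_gaugeU δ (hC _ (hr t ht))
  cont x := by
    have h1 := h.continuousOn_mass hr x
    have h2 : ContinuousOn (fun t => gauge δ (ψ t) x) (Icc 0 T) := by
      simp only [gauge_eq]
      exact ((h1.const_smul (Complex.I * (δ : ℂ))).neg).cexp
    exact (h2.pow 2).mul (h.continuousOn_time x)
  time x t ht := by
    have h1 := ((h.hasDerivAt_mass hr ht x).const_mul (Complex.I * (δ : ℂ))).fun_neg.cexp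
    have h2 : HasDerivAt (fun t => gauge δ (ψ t) x)
        (gauge δ (ψ t) x * -(Complex.I * δ * flux δ (ψ t) x)) t := by
      simp only [gauge_eq]
      exact h1
    refine ((h2.fun_pow 2).fun_mul (h.hasDerivAt_time hr ht x)).congr_deriv ?_
    have h3 := conj_gauge_mul δ (ψ t) x
    have h4 := gaugeV_eq δ (ψ t) x
    rw [gaugeV] at h4
    rw [rhs, second, h4]
    simp only [gaugeU, gaugeU₂, timeDeriv, flux, cubic, cubic', map_mul, map_sub, map_pow,
      Complex.conj_I, Complex.conj_ofReal, Complex.conj_conj]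
    generalize gauge δ (ψ t) x = g at *
    generalize conj g = g' at *
    generalize ψ t x = p at *
    generalize conj p = p' at *
    generalize deriv (ψ t) x = q at *
    generalize conj q = q' at *
    generalize deriv (deriv (ψ t)) x = r at *
    have h5 : g' ^ 2 * g ^ 2 = 1 := by rw [← mul_pow, h3, one_pow]
    push_cast
    linear_combination (2 * δ * g ^ 2 * p ^ 2 * (q' + Complex.I * δ * (p' * p * p'))) * h5 +
      (4 * g ^ 2 * δ * (q * p' * p + p ^ 2 * q' - Complex.I * δ * p' ^ 2 * p ^ 3)) * Complex.I_sq

end IsSolution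

end DNLS

namespace DNLS

/-! ### The reconstruction -/

theorem integrable_norm_sq {f : ℝ → ℂ} (hf : MemLp f 2 volume) : Integrable fun x => ‖f x‖ ^ 2 :=
  hf.integrable_norm_pow two_ne_zero

theorem measurable_gauge (δ : ℝ) {f : ℝ → ℂ} (hf : MemLp f 2 volume) : Measurable (gauge δ f) := by
  have hm : Monotone fun x => ∫ y in Iic x, ‖f y‖ ^ 2 := fun x y hxy =>
    setIntegral_mono_set (integrable_norm_sq hf).integrableOn (.of_forall fun z => sq_nonneg _)
      (Filter.Eventually.of_forall (Iic_subset_Iic.2 hxy))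
  have h1 := Complex.measurable_ofReal.comp hm.measurable
  exact Complex.measurable_exp.comp ((h1.const_mul (Complex.I * δ)).neg)

theorem norm_gauge_sub_le (δ : ℝ) (f g : ℝ → ℂ) (x : ℝ) : ‖gauge δ f x - gauge δ g x‖ ≤
    |δ| * |(∫ y in Iic x, ‖f y‖ ^ 2) - ∫ y in Iic x, ‖g y‖ ^ 2| := by
  set a := ∫ y in Iic x, ‖f y‖ ^ 2 with ha
  set b := ∫ y in Iic x, ‖g y‖ ^ 2 with hb
  have e : gauge δ f x = gauge δ g x * Complex.exp (Complex.I * ((-(δ * (a - b)) : ℝ) : ℂ)) := by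
    rw [gauge, gauge, ← ha, ← hb, ← Complex.exp_add]
    congr 1; push_cast; ring
  have e2 : gauge δ f x - gauge δ g x =
      gauge δ g x * (Complex.exp (Complex.I * ((-(δ * (a - b)) : ℝ) : ℂ)) - 1) := by
    rw [e]; ring
  rw [e2, norm_mul, norm_gauge, one_mul]
  refine (Real.norm_exp_I_mul_ofReal_sub_one_le (x := -(δ * (a - b)))).trans ?_
  rw [Real.norm_eq_abs, abs_neg, abs_mul]

/-- The mass to the left of a point depends on the function in a Lipschitz way, in `L²`. -/
theorem abs_mass_sub_le {f g : ℝ → ℂ} {E K : ℝ} (hg : L2Bound g K)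
    (h : L2Bound (fun x => f x - g x) E) (x : ℝ) :
    |(∫ y in Iic x, ‖f y‖ ^ 2) - ∫ y in Iic x, ‖g y‖ ^ 2| ≤ E * (2 * K + E) := by
  have hf : L2Bound f (E + K) := (h.add hg).congr_ae (.of_forall fun x => by simp)
  obtain ⟨i1, b1⟩ := h.integral_norm_mul_le hf
  obtain ⟨i2, b2⟩ := h.integral_norm_mul_le hg
  have jf := integrable_norm_sq hf.memLp
  have jg := integrable_norm_sq hg.memLp
  rw [← integral_sub jf.integrableOn jg.integrableOn, ← Real.norm_eq_abs]
  calc ‖∫ y in Iic x, (‖f y‖ ^ 2 - ‖g y‖ ^ 2)‖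
      ≤ ∫ y in Iic x, ‖‖f y‖ ^ 2 - ‖g y‖ ^ 2‖ := norm_integral_le_integral_norm _
    _ ≤ ∫ y, ‖‖f y‖ ^ 2 - ‖g y‖ ^ 2‖ :=
        setIntegral_le_integral (jf.sub jg).norm (.of_forall fun y => norm_nonneg _)
    _ ≤ ∫ y, (‖(f y - g y) * f y‖ + ‖(f y - g y) * g y‖) := by
        refine integral_mono (jf.sub jg).norm (i1.norm.add i2.norm) fun y => ?_
        simp only [norm_mul, Real.norm_eq_abs]
        rw [sq_sub_sq, abs_mul, abs_of_nonneg (by positivity : 0 ≤ ‖f y‖ + ‖g y‖), mul_comm,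
          ← mul_add]
        exact mul_le_mul_of_nonneg_right (abs_norm_sub_norm_le _ _) (by positivity)
    _ = (∫ y, ‖(f y - g y) * f y‖) + ∫ y, ‖(f y - g y) * g y‖ := integral_add i1.norm i2.norm
    _ ≤ E * (E + K) + E * K := add_le_add b1 b2
    _ = E * (2 * K + E) := by ring

/-- The reconstruction is locally Lipschitz in `L²`. -/
theorem L2Bound.reconstruct_sub (δ : ℝ) {f g : ℝ → ℂ} {E K : ℝ} (hg : L2Bound g K)
    (h : L2Bound (fun x => f x - g x) E) :
    L2Bound (fun x => reconstruct δ f x - reconstruct δ g x)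
      (E + 2 * (|δ| * (E * (2 * K + E))) * K) := by
  have hf : L2Bound f (E + K) := (h.add hg).congr_ae (.of_forall fun x => by simp)
  have hm : ∀ {f : ℝ → ℂ}, MemLp f 2 volume → AEStronglyMeasurable (reconstruct δ f) volume :=
    fun hf => (((measurable_gauge δ hf).pow_const 2).inv).aestronglyMeasurable.mul hf.1
  have hE := h.nonneg
  have hK := hg.nonneg
  have := L2Bound.of_norm_le_add (K := 1) (L := 2 * (|δ| * (E * (2 * K + E)))) zero_le_one
    (by positivity) h hg (u := fun x => reconstruct δ f x - reconstruct δ g x)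
    ((hm hf.memLp).sub (hm hg.memLp)) (.of_forall fun x => ?_)
  · simpa using this
  · have h1 := (norm_gauge_sub_le δ f g x).trans
      (mul_le_mul_of_nonneg_left (abs_mass_sub_le hg h x) (abs_nonneg δ))
    set p := gauge δ f x with hp
    set q := gauge δ g x with hq
    have np : ‖p‖ = 1 := norm_gauge δ f x
    have nq : ‖q‖ = 1 := norm_gauge δ g x
    have p0 : p ≠ 0 := gauge_ne_zero δ f x
    have q0 : q ≠ 0 := gauge_ne_zero δ g x
    have e : reconstruct δ f x - reconstruct δ g x =
        (p ^ 2)⁻¹ * (f x - g x) - (p ^ 2)⁻¹ * (q ^ 2)⁻¹ * ((p - q) * (p + q)) * g x := by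
      rw [reconstruct, reconstruct, ← hp, ← hq]
      field_simp
      ring
    rw [e]
    refine (norm_sub_le _ _).trans ?_
    simp only [norm_mul, norm_inv, norm_pow, np, nq, one_pow, inv_one, one_mul]
    have h2 : ‖p + q‖ ≤ 2 := (norm_add_le p q).trans (by rw [np, nq]; norm_num)
    have h3 : ‖p - q‖ * ‖p + q‖ ≤ |δ| * (E * (2 * K + E)) * 2 :=
      mul_le_mul h1 h2 (norm_nonneg _) (by positivity)
    have h4 := mul_le_mul_of_nonneg_right h3 (norm_nonneg (g x))
    linarith

theorem reconstruct_gaugeU (δ : ℝ) (f : ℝ → ℂ) : reconstruct δ (gaugeU δ f) = f := by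
  have e : gauge δ (gaugeU δ f) = gauge δ f := by
    ext x
    simp only [gauge, gaugeU]
    have : ∀ y, ‖gauge δ f y ^ 2 * f y‖ = ‖f y‖ := fun y => Regular.norm_gauge_sq_mul δ f y _
    simp only [gauge] at this
    simp only [this]
  ext x
  have := gauge_ne_zero δ f x
  rw [reconstruct, e, gaugeU]
  field_simp

end DNLS

/-! ### Convergence of the scheme -/

theorem mainTheorem5 (δ : ℝ) (hδ : δ ≠ 0) (k : ℕ) (hk : (1 / 2 + 5 : ℝ) < k)
    (T : ℝ) (hT : 0 < T) (M : ℝ≥0) :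
    ∃ C : ℝ, 0 < C ∧ ∃ τ₀ : ℝ, 0 < τ₀ ∧
      ∀ ψ : ℝ → ℝ → ℂ, DNLS.IsSolution δ T ψ →
        (⨆ t ∈ Icc (0 : ℝ) T, DNLS.sigmaNorm k (ψ t)) ≤ (M : ℝ≥0∞) →
        ∀ τ : ℝ, 0 < τ → τ < τ₀ → ∀ n : ℕ, (n : ℝ) * τ ≤ T →
          DNLS.PairMemL2 (DNLS.iterate δ τ (ψ 0) n) ∧
          DNLS.PairMemL2 (DNLS.nonlinearFlow δ τ
            (DNLS.linearFlow (τ / 2) (DNLS.iterate δ τ (ψ 0) n))) ∧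
          eLpNorm (DNLS.approx δ τ (ψ 0) n - ψ (n * τ)) 2 volume
            ≤ ENNReal.ofReal (C * τ ^ 2) := by
  have hk6 : 6 ≤ k := by
    have : (5 : ℝ) < k := by linarith
    exact_mod_cast this
  obtain ⟨K, hK⟩ := DNLS.exists_regular M
  obtain ⟨D, hD⟩ := DNLS.Regular.exists_decays δ K
  obtain ⟨S, hS⟩ := DNLS.Regular.exists_sob δ K
  obtain ⟨C, hC, τ₁, hτ₁, hconv⟩ := DNLS.exists_near_iterate δ T |S| hT (abs_nonneg S)
  refine ⟨C + 2 * (|δ| * (C * (2 * |S| + C))) * |S| + 1, by positivity, min τ₁ 1, by positivity,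
    fun ψ hψ hM τ hτ hττ n hn => ?_⟩
  have hr : ∀ t ∈ Icc 0 T, DNLS.Regular (ψ t) K := fun t ht =>
    hK k hk6 _ (hψ.contDiff_space t ht).continuous (iSup₂_le_iff.1 hM t ht)
  have hs : ∀ t ∈ Icc 0 T, DNLS.Sob 4 (DNLS.gaugeU δ (ψ t)) |S| ∧
      DNLS.Sob 4 (DNLS.gaugeV δ (ψ t)) |S| := fun t ht =>
    ⟨(hS _ (hr t ht)).1.mono (le_abs_self S), (hS _ (hr t ht)).2.mono (le_abs_self S)⟩
  have hcurve := (hψ.flow hr hD).curve (fun t ht => (hs t ht).1) (fun t ht => (hs t ht).2)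
  obtain ⟨h1, h2, h3⟩ := hconv _ _ _ _ hcurve (ψ 0) ((hr 0 ⟨le_rfl, hT.le⟩).transform_eq δ) τ hτ
    (hττ.trans_le (min_le_left _ _)) n hn
  refine ⟨h1, h2, ?_⟩
  have hmem : n * τ ∈ Icc 0 T := ⟨by positivity, hn⟩
  have h4 := DNLS.L2Bound.reconstruct_sub δ (hs _ hmem).1.l2Bound h3
  rw [DNLS.reconstruct_gaugeU] at h4
  refine h4.le.trans (ENNReal.ofReal_le_ofReal ?_)
  have hτ1 : τ ^ 2 ≤ 1 := pow_le_one₀ hτ.le (hττ.le.trans (min_le_right _ _))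
  have h5 : C * τ ^ 2 ≤ C := mul_le_of_le_one_right hC hτ1
  have h6 : C * τ ^ 2 * (2 * |S| + C * τ ^ 2) ≤ C * τ ^ 2 * (2 * |S| + C) := by gcongr
  have h7 : 2 * (|δ| * (C * τ ^ 2 * (2 * |S| + C * τ ^ 2))) * |S| ≤
      2 * (|δ| * (C * τ ^ 2 * (2 * |S| + C))) * |S| := by gcongr
  nlinarith [sq_nonneg τ]
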